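/- **Setting.** Let $(\Lambda,Q)$ be an even lattice of signature $(1,\ell-1)$, with bilinear form $\langle x,y\rangle=Q(x+y)-Q(x)-Q(y)$, and let $\Lambda_1=\Lambda\oplus \mathrm{II}_{1,1}$, whose quadratic form on triples $(a,x,b)$ is $Q(x)+ab$. Fix a connected component $P$ (the positive cone) of $\{y\in\Lambda\otimes\mathbb R: Q(y)>0\}$ and put $\mathbb H_\Lambda=\{z\in\Lambda\otimes\mathbb C:\ \mathrm{Im}\, z\in P\}$. Let $G_\Lambda=\mathrm{SO}^+(\Lambda_1\otimes\mathbb R)$ be the identity component of the orthogonal group. It acts on $\mathbb H_\Lambda$ by $$M(-Q(z),z,1)^T=j(M;z)\,(-Q(M\cdot z),\,M\cdot z,\,1)^T,$$ and $(F|_kM)(z)=j(M;z)^{-k}F(M\cdot z)$ for $k\in\mathbb Z$. Let $\Gamma_\Lambda\subseteq G_\Lambda$ be the subgroup of elements acting trivially on $\Lambda_1'/\Lambda_1$. A *modular form* of weight $k$ on $\mathbb H_\Lambda$ is a holomorphic $F:\mathbb H_\Lambda\to\mathbb C$ with $F|_kM=F$ for all $M\in\Gamma_\Lambda$ such that for every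 rational $M\in G_\Lambda$ and every $v\in P$, $(F|_kM)(x+itv)$ is bounded as $t\to\infty$, uniformly in $x\in\Lambda\otimes\mathbb R$. It is a *cusp form* if moreover $(F|_kM)(z+itv)\to0$ as $t\to\infty$ for every rational $M\in G_\Lambda$, every $z\in\mathbb H_\Lambda$ and every $0\ne v\in\overline P$ (equivalently, the Fourier coefficients of every such $F|_kM$ are supported on $P$). For a linear form $r$ and a bilinear form $m$ on a complex vector space, $N\in\mathbb N_0$ and $s\in\mathbb C$, let $G_N^s(r,m)$ be the symmetric multilinear $N$-form $$G_N^s(r,m)=N!\sum_{2n_1+n_2=N}\frac{(-1)^{n_1}}{n_1!\,n_2!}\,\frac{\Gamma(s+n_1+n_2)}{\Gamma(s+\lceil N/2\rceil)}\,\mathrm{Sym}\big(r^{\otimes n_2}\otimes m^{\otimes n_1}\big),$$ where the quotient of Gamma values is read as the polynomial $\prod_{\lceil N/2\rceil\le j<n_1+n_2}(s+j)$ and $\mathrm{Sym}$ is the average over all permutations of the $N$ arguments. **Theorem.** Let $F:\mathbb H_\Lambda\to\mathbb C$ be a modular form of weight $k$, let $L\subseteq\Lambda$ be a sublattice of signature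 $(1,\dim L-1)$ of arbitrary rank, with orthogonal complement $L^\perp$ in $\Lambda$, and let $\mathbb H_L$ be formed with the positive cone $P\cap (L\otimes\mathbb R)$. Then $F$ has a Fourier expansion $$F(z+w)=\sum_{\lambda\in L'}\sum_{\mu\in(L^\perp)'}c(\lambda,\mu)\,e^{2\pi i\langle\lambda,z\rangle}e^{2\pi i\langle\mu,w\rangle}\qquad(z\in L\otimes\mathbb C,\ w\in L^\perp\otimes\mathbb C,\ z+w\in\mathbb H_\Lambda),$$ which converges absolutely, and for every $\lambda$ only finitely many $c(\lambda,\mu)$ are nonzero. Let $B$ be the restriction of $\langle\cdot,\cdot\rangle$ to $L^\perp$, and regard $\mu\in(L^\perp)'$ as the linear form $v\mapsto\langle\mu,v\rangle$. For every $N\in\mathbb N_0$ and $v_1,\dots,v_N\in L^\perp\otimes\mathbb C$ the series $$P_N^LF(z;v_1,\dots,v_N)=\sum_{\lambda\in L'}\Big(\sum_{\mu\in(L^\perp)'}c(\lambda,\mu)\,G_N^{k-\dim L/2}\big(\mu,-Q(\lambda)B/2\big)(v_1,\dots,v_N)\Big)e^{2\pi i\langle\lambda,z\rangle}$$ converges absolutely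 on $\mathbb H_L$, is symmetric and multilinear in $v_1,\dots,v_N$, and is, as a function of $z$, a modular form of weight $k+N$ on $\mathbb H_L$; it is a cusp form if $N\ge1$. It is obtained from $F$ by an explicit differential operator: $$P_N^LF(z;v_1,\dots,v_N)=(2\pi i)^{-N}\,\big[G_N^{k-\dim L/2}(\partial,-\Delta_LB/2)(v_1,\dots,v_N)\,F\big](z),\qquad z\in\mathbb H_L,$$ where $\partial$ is the linear form $v\mapsto\partial_v$ (directional derivative) and $\Delta_L=\frac12\sum_{i,j}s^{ij}\partial_{b_i}\partial_{b_j}$ for a basis $(b_i)$ of $L$ with inverse Gram matrix $(s^{ij})$. -/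

import Mathlib

open Filter Topology Module

noncomputable section

namespace HigherPullback

/-! ### Lattices

A lattice of rank `#ι` is `ℤ^ι` with the bilinear form of an integral symmetric Gram matrix `S`. -/

section Lattice

variable {ι : Type*} [Fintype ι] [DecidableEq ι]

/-- The bilinear form `⟨x, y⟩ = xᵀ S y`, extended to vectors with entries in a field `K`. -/
def form (S : Matrix ι ι ℤ) (K : Type*) [Field K] : LinearMap.BilinForm K (ι → K) :=
  Matrix.toBilin' (S.map (Int.cast : ℤ → K))

/-- The quadratic form `Q(x) = ⟨x, x⟩ / 2`, extended to vectors with entries in a field `K`. -/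
def quad (S : Matrix ι ι ℤ) (K : Type*) [Field K] : QuadraticForm K (ι → K) :=
  (1 / 2 : K) • (form S K).toQuadraticMap

/-- `S` is the Gram matrix of an even lattice. -/
def IsEven (S : Matrix ι ι ℤ) : Prop :=
  S.IsSymm ∧ ∀ i, Even (S i i)

/-- The lattice has signature `(1, rank - 1)`. -/
def IsLorentzian (S : Matrix ι ι ℤ) : Prop :=
  sigPos (quad S ℝ) = 1 ∧ sigNeg (quad S ℝ) + 1 = Fintype.card ι

/-- The dual lattice: the real vectors that pair integrally with all lattice vectors. -/
def dualLattice (S : Matrix ι ι ℤ) : Set (ι → ℝ) :=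
  {x | ∀ y : ι → ℤ, ∃ n : ℤ, form S ℝ x (fun i => (y i : ℝ)) = n}

/-- The orthogonal complement of a sublattice `L` inside the lattice `ℤ^ι`. -/
def orthLattice (S : Matrix ι ι ℤ) (L : Submodule ℤ (ι → ℤ)) : Submodule ℤ (ι → ℤ) where
  carrier := {x | ∀ y ∈ L, Matrix.toBilin' S x y = 0}
  zero_mem' := by intro y _; simp
  add_mem' := by intro a c ha hc y hy; simp [ha y hy, hc y hy]
  smul_mem' := by intro n a ha y hy; rw [map_smul, LinearMap.smul_apply, ha y hy, smul_zero]

variable {κ : Type*} [Fintype κ]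

/-- The Gram matrix of a sublattice with respect to a basis. -/
def subGram (S : Matrix ι ι ℤ) {L : Submodule ℤ (ι → ℤ)} (b : Basis κ ℤ L) : Matrix κ κ ℤ :=
  Matrix.of fun i j => Matrix.toBilin' S (b i : ι → ℤ) (b j : ι → ℤ)

/-- The vector `∑ j, z j • b j` with coordinates `z` in a basis `b` of a sublattice. -/
def embed {L : Submodule ℤ (ι → ℤ)} (b : Basis κ ℤ L) {K : Type*} [Field K] (z : κ → K) :
    ι → K :=
  fun i => ∑ j, z j * ((b j : ι → ℤ) i : K)

end Lattice

/-! ### The upper half-space and the orthogonal group -/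

section ModularForms

variable {ι : Type*} [Fintype ι] [DecidableEq ι]

/-- The positive cone: the connected component of the set of vectors of positive norm that
contains `p`. -/
def posCone (S : Matrix ι ι ℤ) (p : ι → ℝ) : Set (ι → ℝ) :=
  connectedComponentIn {y | 0 < quad S ℝ y} p

/-- The orthogonal upper half-space: vectors whose imaginary part lies in the positive cone. -/
def upperHalf (S : Matrix ι ι ℤ) (p : ι → ℝ) : Set (ι → ℂ) :=
  {z | (fun i => (z i).im) ∈ posCone S p}

/-- Indices for `Λ ⊕ II_{1,1}`, in blocks of size `1, ℓ, 1`. -/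
abbrev Ext (ι : Type*) : Type _ := Unit ⊕ ι ⊕ Unit

/-- The Gram matrix of `Λ ⊕ II_{1,1}`, in blocks `(0, 0, 1; 0, S, 0; 1, 0, 0)`. -/
def extGram (S : Matrix ι ι ℤ) : Matrix (Ext ι) (Ext ι) ℤ :=
  Matrix.of fun
    | Sum.inl _, Sum.inr (Sum.inr _) => 1
    | Sum.inr (Sum.inl i), Sum.inr (Sum.inl j) => S i j
    | Sum.inr (Sum.inr _), Sum.inl _ => 1
    | _, _ => 0

/-- `SO⁺` of the real quadratic space `(Λ ⊕ II_{1,1}) ⊗ ℝ`: the connected component of the identity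
in its orthogonal group. -/
def orthGroup (S : Matrix ι ι ℤ) : Set (Matrix (Ext ι) (Ext ι) ℝ) :=
  connectedComponentIn
    {M | M.transpose * (extGram S).map (Int.cast : ℤ → ℝ) * M =
      (extGram S).map (Int.cast : ℤ → ℝ)} 1

/-- The rational elements of `SO⁺`. -/
def ratOrthGroup (S : Matrix ι ι ℤ) : Set (Matrix (Ext ι) (Ext ι) ℝ) :=
  {M | M ∈ orthGroup S ∧ ∃ M₀ : Matrix (Ext ι) (Ext ι) ℚ, M = M₀.map (Rat.cast : ℚ → ℝ)}

/-- The modular group: the elements of `SO⁺` that act trivially on the discriminant group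
`Λ₁' / Λ₁` of `Λ₁ = Λ ⊕ II_{1,1}`. -/
def modGroup (S : Matrix ι ι ℤ) : Set (Matrix (Ext ι) (Ext ι) ℝ) :=
  {M | M ∈ orthGroup S ∧
    ∀ x ∈ dualLattice (extGram S), ∀ i, ∃ n : ℤ, M.mulVec x i - x i = n}

/-- The vector `M (-Q(z), z, 1)`. -/
def moved (S : Matrix ι ι ℤ) (M : Matrix (Ext ι) (Ext ι) ℝ) (z : ι → ℂ) : Ext ι → ℂ :=
  (M.map ((↑) : ℝ → ℂ)).mulVec
    (Sum.elim (fun _ => -quad S ℂ z) (Sum.elim z (fun _ => 1)))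

/-- The automorphy factor `j(M; z)`; it is the last entry of
`M (-Q(z), z, 1) = j(M; z) (-Q(M z), M z, 1)`. -/
def autFactor (S : Matrix ι ι ℤ) (M : Matrix (Ext ι) (Ext ι) ℝ) (z : ι → ℂ) : ℂ :=
  moved S M z (Sum.inr (Sum.inr ()))

/-- The action `M · z`, read off from `M (-Q(z), z, 1) = j(M; z) (-Q(M z), M z, 1)`. -/
def moebius (S : Matrix ι ι ℤ) (M : Matrix (Ext ι) (Ext ι) ℝ) (z : ι → ℂ) : ι → ℂ :=
  fun i => (autFactor S M z)⁻¹ * moved S M z (Sum.inr (Sum.inl i))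

/-- The slash operator `(F |_k M)(z) = j(M; z)^{-k} F(M · z)`. -/
def slash (S : Matrix ι ι ℤ) (k : ℤ) (F : (ι → ℂ) → ℂ) (M : Matrix (Ext ι) (Ext ι) ℝ)
    (z : ι → ℂ) : ℂ :=
  autFactor S M z ^ (-k) * F (moebius S M z)

/-- Orthogonal modular forms of weight `k`. Bounded growth at the cusps: for every rational `M`
and every `v` in the positive cone, `(F |_k M)(x + itv)` stays bounded as `t → ∞`, uniformly in the
real part `x`. -/
structure IsModularForm (S : Matrix ι ι ℤ) (p : ι → ℝ) (k : ℤ) (F : (ι → ℂ) → ℂ) : Prop where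
  holomorphic : DifferentiableOn ℂ F (upperHalf S p)
  invariant : ∀ M ∈ modGroup S, ∀ z ∈ upperHalf S p, slash S k F M z = F z
  bounded : ∀ M ∈ ratOrthGroup S, ∀ v ∈ posCone S p, ∃ C T : ℝ, ∀ t : ℝ, T ≤ t → ∀ x : ι → ℝ,
    ‖slash S k F M (fun i => (x i : ℂ) + Complex.I * t * v i)‖ ≤ C

/-- Cusp forms: modular forms such that for every rational `M` and every nonzero vector `v` of the
closed positive cone, `(F |_k M)(z + itv) → 0` as `t → ∞`. The vectors `v` in the open cone give
the zero-dimensional cusps, those on its boundary the one-dimensional cusps; equivalently, the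
Fourier coefficients of all `F |_k M` are supported on the open positive cone. -/
structure IsCuspForm (S : Matrix ι ι ℤ) (p : ι → ℝ) (k : ℤ) (F : (ι → ℂ) → ℂ) : Prop
    extends IsModularForm S p k F where
  vanishing : ∀ M ∈ ratOrthGroup S, ∀ v ∈ closure (posCone S p), v ≠ 0 →
    ∀ z ∈ upperHalf S p,
      Tendsto (fun t : ℝ => slash S k F M (fun i => z i + Complex.I * t * v i)) atTop (𝓝 0)

end ModularForms

/-! ### Multilinear Gegenbauer polynomials -/

section Gegenbauer

/-- For `2 n₁ + n₂ = N`, the number `N! (-1)^{n₁} Γ(s + n₁ + n₂) / (Γ(s + ⌈N/2⌉) n₁! n₂!)`, a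
polynomial in `s`. It is the coefficient of `x^{n₂} y^{n₁}` in the rescaled Gegenbauer polynomial
`G_N^s(x, y) = N! Γ(s) / Γ(s + ⌈N/2⌉) · g_N^s(x, y)`, where
`∑ g_N^s(x, y) t^N = (1 - x t + y t²)^{-s}`. -/
def gegenbauerCoeff (s : ℂ) (N n₁ n₂ : ℕ) : ℂ :=
  N.factorial * (-1) ^ n₁ *
    (ascPochhammer ℂ (n₁ + n₂ - (N + 1) / 2)).eval (s + ((N + 1) / 2 : ℕ)) /
    (n₁.factorial * n₂.factorial)

/-- Given a number `a n₁ n₂ e` for each way `e` of distributing `N` arguments over `n₂` single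
slots and `n₁` pairs of slots, average over `e` and sum over `2 n₁ + n₂ = N` with the Gegenbauer
coefficients. -/
def gegenbauerSum (s : ℂ) (N : ℕ)
    (a : ∀ n₁ n₂ : ℕ, (Fin n₂ ⊕ Fin n₁ × Fin 2 ≃ Fin N) → ℂ) : ℂ :=
  ∑ n ∈ (Finset.range (N + 1) ×ˢ Finset.range (N + 1)).filter (fun n => 2 * n.1 + n.2 = N),
    gegenbauerCoeff s N n.1 n.2 * ((1 / (N.factorial : ℂ)) * ∑ e, a n.1 n.2 e)

variable {V : Type*} [AddCommGroup V] [Module ℂ V]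

/-- The symmetric `N`-form `G_N^s(r, m)` of a linear form `r` and a bilinear form `m`: each monomial
`x^{n₂} y^{n₁}` of `G_N^s(x, y)` is replaced by the symmetrization of `r^{⊗ n₂} ⊗ m^{⊗ n₁}`. -/
def gegenbauerForm (s : ℂ) (N : ℕ) (r : V →ₗ[ℂ] ℂ) (m : LinearMap.BilinForm ℂ V)
    (v : Fin N → V) : ℂ :=
  gegenbauerSum s N fun _ _ e =>
    (∏ i, r (v (e (Sum.inl i)))) * ∏ j, m (v (e (Sum.inr (j, 0)))) (v (e (Sum.inr (j, 1))))

end Gegenbauer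

/-! ### Pullbacks

`L` is a sublattice of `ℤ^ι` with basis `b`, and `b'` is a basis of its orthogonal complement. -/

section Pullback

variable {ι κ κ' : Type*} [Fintype ι] [DecidableEq ι] [Fintype κ] [DecidableEq κ] [Fintype κ']
  [DecidableEq κ'] (S : Matrix ι ι ℤ) {L : Submodule ℤ (ι → ℤ)} (b : Basis κ ℤ L)
  (b' : Basis κ' ℤ (orthLattice S L))

/-- The character `e^{2πi ⟨x, z⟩}`. -/
def expChar (T : Matrix κ κ ℤ) (x : κ → ℝ) (z : κ → ℂ) : ℂ :=
  Complex.exp (2 * Real.pi * Complex.I * form T ℂ (fun i => (x i : ℂ)) z)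

/-- `F(z + w) = ∑_{x ∈ L'} ∑_{y ∈ (L^⊥)'} c(x, y) e^{2πi ⟨x, z⟩} e^{2πi ⟨y, w⟩}` for all
`z ∈ L ⊗ ℂ` and `w ∈ L^⊥ ⊗ ℂ` such that `z + w` lies in the upper half-space, as an (absolutely
convergent) unordered sum. -/
def IsFourierExpansion (p : ι → ℝ) (F : (ι → ℂ) → ℂ)
    (c : dualLattice (subGram S b) → dualLattice (subGram S b') → ℂ) : Prop :=
  ∀ (z : κ → ℂ) (w : κ' → ℂ), embed b z + embed b' w ∈ upperHalf S p →
    HasSum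
      (fun xy : dualLattice (subGram S b) × dualLattice (subGram S b') =>
        c xy.1 xy.2 * expChar (subGram S b) xy.1 z * expChar (subGram S b') xy.2 w)
      (F (embed b z + embed b' w))

/-- The coefficient `∑_{y ∈ (L^⊥)'} c(x, y) G_N^{k - dim L / 2}(y, -Q(x) B / 2)(v₁, …, v_N)` of
`e^{2πi ⟨x, z⟩}` in the `N`-th pullback, where `B` is the bilinear form of `L^⊥`. -/
def pullbackCoeff (k : ℤ) (N : ℕ)
    (c : dualLattice (subGram S b) → dualLattice (subGram S b') → ℂ)
    (x : dualLattice (subGram S b)) (v : Fin N → κ' → ℂ) : ℂ :=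
  ∑' y : dualLattice (subGram S b'),
    c x y * gegenbauerForm ((k : ℂ) - (Fintype.card κ : ℂ) / 2) N
      (form (subGram S b') ℂ (fun i => ((y : κ' → ℝ) i : ℂ)))
      ((-((quad (subGram S b) ℝ (x : κ → ℝ) : ℝ) : ℂ) / 2) • form (subGram S b') ℂ) v

/-- The Laplace operator `½ ∑ s^{ij} ∂_i ∂_j` along `L`, where `(s^{ij})` is the inverse Gram
matrix of `L`. -/
def laplacian (f : (ι → ℂ) → ℂ) (u : ι → ℂ) : ℂ :=
  1 / 2 * ∑ i, ∑ j, ((subGram S b).map (Int.cast : ℤ → ℂ))⁻¹ i j *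
    iteratedFDeriv ℂ 2 f u ![embed b (Pi.single i 1), embed b (Pi.single j 1)]

/-- The differential operator `(2πi)^{-N} G_N^{k - dim L / 2}(∂, -Δ_L B / 2)(v₁, …, v_N)`,
evaluated at the point `z ∈ L ⊗ ℂ`. Here `∂` sends a normal vector to its directional
derivative. -/
def pullbackOperator (k : ℤ) (N : ℕ) (F : (ι → ℂ) → ℂ) (z : κ → ℂ) (v : Fin N → κ' → ℂ) : ℂ :=
  (2 * Real.pi * Complex.I) ^ (-(N : ℤ)) *
    gegenbauerSum ((k : ℂ) - (Fintype.card κ : ℂ) / 2) N fun n₁ n₂ e =>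
      iteratedFDeriv ℂ n₂ ((laplacian S b)^[n₁] F) (embed b z)
        (fun i => embed b' (v (e (Sum.inl i)))) *
      ∏ j, (-(form (subGram S b') ℂ (v (e (Sum.inr (j, 0)))) (v (e (Sum.inr (j, 1))))) / 2)

end Pullback

end HigherPullback

end

open HigherPullback

namespace HigherPullback

set_option linter.unusedSectionVars false

/-! ### Bilinear and quadratic forms -/

section Forms

variable {ι : Type*} [Fintype ι] [DecidableEq ι] {S : Matrix ι ι ℤ} {K : Type*} [Field K]

/-! The proof has an analytic half (Fourier expansions) and an algebraic half (covariance of the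
differential operator).

Analysis. Since the lattice is even, translations by lattice vectors lie in the modular group, so
`F` is periodic on a tube domain over a convex open cone. Moving the imaginary part by Cauchy's
theorem gives an absolutely convergent Fourier series (`exists_fourier_expansion`), whose integral
frequencies are split along `L ⊕ L^⊥` by `exists_dual_of_int`. Boundedness forces every frequency `λ
+ μ` to be nonnegative on the cone. The cone is self-dual up to closure
(`quad_nonneg_of_form_nonneg`), so `Q(λ) + Q(μ) ≥ 0`. As `L` already contains a positive vector,
`L^⊥` is negative definite, and each `λ` meets only finitely many `μ`. Termwise differentiation
turns `∂` into `2πi μ` and `Δ_L` into `(2πi)² Q(λ)`, so the differential operator and the series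
agree (`hasSum_pullbackOperator`).

Covariance. Let `M` lie in `SO⁺` of `L ⊕ II_{1,1}`, extended by the identity on `L^⊥`. Lift `F` to
`Φ(a, z, c) = c^{-k} F(z/c)`, which is homogeneous of degree `-k` and does not depend on `a`. On
such functions the Laplacian of `L ⊕ II_{1,1}` reduces to `Δ_L` (`slice_apply`), and it commutes
with `M`. The function `Φ ∘ M` and the lift of `F|_k M` agree only on the null cone, so off the cone
they differ by a multiple of `Q`. What has to be shown is that the Gegenbauer operator does not see
such a multiple at null points of `L ⊕ II_{1,1}`.

Let `q` be multiplication by `Q`, `X` the Laplacian of `L ⊕ II_{1,1}` and `D = ∂_v` for `v` normal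
to `L`. The commutators `[X, q]` (an Euler operator plus half the dimension), `[D, q]` and `[D, [D,
q]]` reduce `D^i X^n q Ψ` at a null point to two terms. The Gegenbauer coefficients are those for
which the sum over `n` telescopes to zero (`eval_gegenbauer_mul_quad`). This fixes the parameter:
`Ψ` has degree `-k-2` and the Laplacian acts in `dim L + 2` variables, hence `s = k - dim L / 2`.

To obtain `Ψ` without dividing by `Q`, the two functions are joined by a family in `τ`, `Φ ∘ M ∘
shear(τ, ·)`, whose `τ`-derivative is `Q` times an explicit homogeneous function (`dirD_deform`,
`linD_deformDeriv`). The Gegenbauer expression is therefore constant in `τ` (`sum_deform_eq`). Its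
value at `τ = 0` is the pullback of `F|_k M` (`paramOp_zero`), and at `τ = 1` it is `j^{-k-N}` times
the pullback of `F` at `M·z` (`paramOp_one`). This treats equal arguments `v, …, v`; polarization
(`MultilinearMap.eq_zero_of_diag`) gives the rest.

Conclusion. The extension of an element of the modular group of `L` lies in that of `Λ`, which gives
invariance. For rational `M` the function `F|_k` of the extension is still periodic for a multiple
of the lattice, so its pullback has an expansion with frequencies nonnegative on the cone of `L`,
hence is bounded. If `N ≥ 1` and `Q(λ) ≤ 0`, then `Q(μ) ≥ 0` forces `μ = 0` and `Q(λ) = 0`, and the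
Gegenbauer form vanishes; so only `Q(λ) > 0` survives, which is cuspidality
(`IsModularForm.exists_isExpSum_slash_pullbackOperator`). -/

theorem form_apply (S : Matrix ι ι ℤ) (x y : ι → K) :
    form S K x y = ∑ i, ∑ j, x i * (S i j : K) * y j := by
  simp [form, Matrix.toBilin'_apply]

theorem form_eq_dotProduct (S : Matrix ι ι ℤ) (x y : ι → K) :
    form S K x y = x ⬝ᵥ ((S.map (Int.cast : ℤ → K)).mulVec y) := by
  rw [form_apply]
  simp [dotProduct, Matrix.mulVec, Finset.mul_sum, mul_assoc]

theorem form_comm (hS : S.IsSymm) (x y : ι → K) : form S K x y = form S K y x := by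
  rw [form_apply, form_apply, Finset.sum_comm]
  refine Finset.sum_congr rfl fun i _ => Finset.sum_congr rfl fun j _ => ?_
  rw [hS.apply i j]; ring

theorem quad_apply (S : Matrix ι ι ℤ) (x : ι → K) : quad S K x = form S K x x / 2 := by
  simp [quad]; ring

theorem quad_smul (c : K) (x : ι → K) : quad S K (c • x) = c ^ 2 * quad S K x := by
  simp [quad_apply]; ring

theorem form_self [CharZero K] (x : ι → K) : form S K x x = 2 * quad S K x := by
  rw [quad_apply]; field_simp

theorem quad_add [CharZero K] (hS : S.IsSymm) (x y : ι → K) :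
    quad S K (x + y) = quad S K x + quad S K y + form S K x y := by
  simp only [quad_apply, map_add, LinearMap.add_apply, form_comm hS y x]; ring

theorem form_map {K' : Type*} [Field K'] (f : K →+* K') (x y : ι → K) :
    form S K' (fun i => f (x i)) (fun i => f (y i)) = f (form S K x y) := by
  simp [form_apply]

theorem form_ofReal (x y : ι → ℝ) :
    form S ℂ (fun i => (x i : ℂ)) (fun i => (y i : ℂ)) = (form S ℝ x y : ℂ) :=
  form_map Complex.ofRealHom x y

theorem quad_ofReal (x : ι → ℝ) :
    quad S ℂ (fun i => (x i : ℂ)) = (quad S ℝ x : ℂ) := by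
  simp [quad_apply, form_ofReal]

theorem continuous_form_left {𝕜 : Type*} [RCLike 𝕜] (x : ι → 𝕜) :
    Continuous fun y => form S 𝕜 x y := by
  simp only [form_apply]; fun_prop

theorem continuous_quad {𝕜 : Type*} [RCLike 𝕜] : Continuous fun y => quad S 𝕜 y := by
  simp only [quad_apply, form_apply]; fun_prop

/-- An even lattice takes integral values. -/
theorem IsEven.quad_int (hS : IsEven S) (x : ι → ℤ) :
    ∃ n : ℤ, ∑ i, ∑ j, x i * S i j * x j = 2 * n := by
  classical
  have key : ∀ s : Finset ι, ∃ n : ℤ, ∑ i ∈ s, ∑ j ∈ s, x i * S i j * x j = 2 * n := by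
    intro s
    induction s using Finset.induction_on with
    | empty => exact ⟨0, by simp⟩
    | insert a s ha ih =>
      obtain ⟨n, hn⟩ := ih
      obtain ⟨m, hm⟩ := hS.2 a
      -- Row `a` and column `a` contribute equal sums by symmetry, and the new diagonal entry is `2
      -- m`.
      refine ⟨n + x a * m * x a + ∑ j ∈ s, x a * S a j * x j, ?_⟩
      have h2 : ∑ i ∈ s, x i * S i a * x a = ∑ j ∈ s, x a * S a j * x j :=
        Finset.sum_congr rfl fun i _ => by rw [hS.1.apply a i]; ring
      simp only [Finset.sum_insert ha, Finset.sum_add_distrib]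
      rw [hn, hm, h2]; ring
  exact key Finset.univ

end Forms

/-! ### The positive cone -/

section Cone

variable {ι : Type*} [Fintype ι] [DecidableEq ι] {S : Matrix ι ι ℤ}

theorem IsLorentzian.radical_eq_bot (h : IsLorentzian S) : (quad S ℝ).radical = ⊥ := by
  have h1 := QuadraticForm.sigPos_add_sigNeg_add_radical (Q := quad S ℝ)
  rw [Module.finrank_fintype_fun_eq_card] at h1
  have h2 := h.1
  have h3 := h.2
  exact Submodule.finrank_eq_zero.1 (by omega)

theorem IsLorentzian.eq_zero_of_form_eq_zero (hS : S.IsSymm) (h : IsLorentzian S) {x : ι → ℝ}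
    (hx : ∀ y, form S ℝ x y = 0) : x = 0 := by
  have h2 : x ∈ (quad S ℝ).radical := by
    rw [QuadraticMap.mem_radical_iff']
    refine ⟨by rw [quad_apply, hx x, zero_div], fun y => ?_⟩
    rw [quad_add hS, hx, quad_apply, quad_apply, hx]; ring
  rwa [h.radical_eq_bot, Submodule.mem_bot] at h2

theorem IsLorentzian.isUnit_det (hS : S.IsSymm) (h : IsLorentzian S) : S.det ≠ 0 := by
  intro hd
  have : (S.map (Int.cast : ℤ → ℝ)).det = 0 := by
    have := (Int.castRingHom ℝ).map_det S
    rw [hd] at this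
    simpa using this.symm
  obtain ⟨v, hv, hv2⟩ := Matrix.exists_mulVec_eq_zero_iff.2 this
  exact hv (h.eq_zero_of_form_eq_zero hS fun y => by
    rw [form_comm hS, form_eq_dotProduct, hv2, dotProduct_zero])

/-- Otherwise `p` and `y` would span a positive definite plane, while the positive index is one. -/
theorem IsLorentzian.quad_nonpos (hS : S.IsSymm) (h : IsLorentzian S) {p y : ι → ℝ}
    (hp : 0 < quad S ℝ p) (hy : form S ℝ p y = 0) : quad S ℝ y ≤ 0 := by
  by_contra! hlt
  have hy' : form S ℝ y p = 0 := by rw [form_comm hS, hy]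
  have hval : ∀ s t : ℝ, quad S ℝ (s • p + t • y) = s ^ 2 * quad S ℝ p + t ^ 2 * quad S ℝ y := by
    intro s t
    rw [quad_add hS, quad_smul, quad_smul]; simp [hy]
  have hli : LinearIndependent ℝ ![p, y] := by
    rw [LinearIndependent.pair_iff]
    intro s t hst
    have h0 := hval s t
    rw [hst] at h0
    simp only [QuadraticMap.map_zero] at h0
    have hs : s ^ 2 * quad S ℝ p ≥ 0 := by positivity
    have ht : t ^ 2 * quad S ℝ y ≥ 0 := by positivity
    have hs0 : s ^ 2 * quad S ℝ p = 0 := by linarith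
    have ht0 : t ^ 2 * quad S ℝ y = 0 := by linarith
    constructor
    · simpa [hp.ne'] using hs0
    · simpa [hlt.ne'] using ht0
  have hpd : ((quad S ℝ).restrict (Submodule.span ℝ (Set.range ![p, y]))).PosDef := by
    rintro ⟨x, hx⟩ hx0
    rw [QuadraticMap.restrict_apply]
    simp only [Matrix.range_cons, Matrix.range_empty, Set.union_empty, Set.singleton_union] at hx
    obtain ⟨s, t, rfl⟩ := Submodule.mem_span_pair.1 hx
    change 0 < quad S ℝ (s • p + t • y)
    rw [hval]
    by_contra! hle
    have hs : s ^ 2 * quad S ℝ p ≥ 0 := by positivity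
    have ht : t ^ 2 * quad S ℝ y ≥ 0 := by positivity
    have hs0 : s ^ 2 * quad S ℝ p = 0 := by linarith
    have ht0 : t ^ 2 * quad S ℝ y = 0 := by linarith
    have hs1 : s = 0 := by simpa [hp.ne'] using hs0
    have ht1 : t = 0 := by simpa [hlt.ne'] using ht0
    exact hx0 (by ext; simp [hs1, ht1])
  have h1 := le_sigPos_of_posDef _ hpd
  rw [finrank_span_eq_card hli, h.1] at h1
  simp at h1

/-- A Lorentzian form is negative definite on the orthogonal complement of a positive vector. -/
theorem IsLorentzian.quad_neg (hS : S.IsSymm) (h : IsLorentzian S) {p y : ι → ℝ}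
    (hp : 0 < quad S ℝ p) (hy : form S ℝ p y = 0) (hy0 : y ≠ 0) : quad S ℝ y < 0 := by
  refine lt_of_le_of_ne (h.quad_nonpos hS hp hy) fun hq => hy0 ?_
  refine h.eq_zero_of_form_eq_zero hS fun z => ?_
  by_contra hz
  set w := z - (form S ℝ p z / form S ℝ p p) • p with hw
  have hpp : form S ℝ p p ≠ 0 := by rw [form_self]; positivity
  have hpw : form S ℝ p w = 0 := by simp [hw]; field_simp; simp
  have hyw : form S ℝ y w = form S ℝ y z := by simp [hw, form_comm hS y p, hy]
  -- An isotropic `y` is not in the radical, so it pairs nontrivially with some `w` orthogonal to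
  -- `p`. As `Q(t y + w) = t ⟨y, w⟩ + Q(w)`, this `t` produces the value 1 inside the complement of
  -- `p`.
  have := h.quad_nonpos hS hp (y := ((1 - quad S ℝ w) / form S ℝ y z) • y + w) (by simp [hpw, hy])
  rw [quad_add hS, quad_smul, hq, map_smul, LinearMap.smul_apply, hyw, smul_eq_mul,
    div_mul_cancel₀ _ hz] at this
  linarith

theorem isOpen_posSet : IsOpen {y : ι → ℝ | 0 < quad S ℝ y} :=
  isOpen_lt continuous_const continuous_quad

theorem isOpen_posCone (p : ι → ℝ) : IsOpen (posCone S p) :=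
  isOpen_posSet.connectedComponentIn

theorem quad_pos_of_mem {p x : ι → ℝ} (hx : x ∈ posCone S p) : 0 < quad S ℝ x :=
  connectedComponentIn_subset {y : ι → ℝ | 0 < quad S ℝ y} p hx

theorem mem_posCone_self {p : ι → ℝ} (hp : 0 < quad S ℝ p) : p ∈ posCone S p :=
  mem_connectedComponentIn hp

theorem posCone_eq {p x : ι → ℝ} (hx : x ∈ posCone S p) : posCone S x = posCone S p :=
  (connectedComponentIn_eq hx).symm

/-- A zero of `⟨x, ·⟩` on the connected cone would be a positive vector orthogonal to `x`. So the
sign is constant, and it is positive at `x` itself. -/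
theorem form_pos_of_mem (hS : S.IsSymm) (h : IsLorentzian S) {p x y : ι → ℝ}
    (hx : x ∈ posCone S p) (hy : y ∈ posCone S p) : 0 < form S ℝ x y := by
  have hQx := quad_pos_of_mem hx
  have hne : ∀ z ∈ posCone S p, form S ℝ x z ≠ 0 := fun z hz h0 =>
    absurd (h.quad_nonpos hS hQx h0) (not_le.2 (quad_pos_of_mem hz))
  by_contra! hle
  have hpc : IsPreconnected (posCone S p) := isPreconnected_connectedComponentIn
  have hxx : 0 < form S ℝ x x := by rw [form_self]; positivity
  obtain ⟨z, hz, hz0⟩ := hpc.intermediate_value hy hx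
    (continuous_form_left (S := S) x).continuousOn ⟨hle, hxx.le⟩
  exact hne z hz hz0

theorem mem_posCone_of_segment {p x y : ι → ℝ} (hx : x ∈ posCone S p)
    (hseg : ∀ z ∈ segment ℝ x y, 0 < quad S ℝ z) : y ∈ posCone S p := by
  rw [← posCone_eq hx]
  exact (convex_segment x y).isPreconnected.subset_connectedComponentIn
    (left_mem_segment ℝ x y) hseg (right_mem_segment ℝ x y)

/-- On the segment from `x` to `y` the expansion of `Q(a x + c y)` has no negative term, so the
segment stays in the positive set. This is the membership test behind convexity and scaling. -/
theorem mem_posCone_of_form_nonneg (hS : S.IsSymm) {p x y : ι → ℝ}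
    (hx : x ∈ posCone S p) (hy : 0 < quad S ℝ y) (hxy : 0 ≤ form S ℝ x y) : y ∈ posCone S p := by
  refine mem_posCone_of_segment hx ?_
  rintro z ⟨a, c, ha, hc, hac, rfl⟩
  have hQx := quad_pos_of_mem hx
  rw [quad_add hS, quad_smul, quad_smul]
  simp only [map_smul, LinearMap.smul_apply, smul_eq_mul]
  have h1 : 0 ≤ a * (c * form S ℝ x y) := by positivity
  rcases ha.eq_or_lt with rfl | ha'
  · have : c = 1 := by linarith
    subst this; simpa using hy
  · have : 0 < a ^ 2 * quad S ℝ x := by positivity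
    have : 0 ≤ c ^ 2 * quad S ℝ y := by positivity
    have h4 : c * (a * form S ℝ x y) = a * (c * form S ℝ x y) := by ring
    rw [h4]
    linarith

theorem convex_posCone (hS : S.IsSymm) (h : IsLorentzian S) (p : ι → ℝ) :
    Convex ℝ (posCone S p) := by
  intro x hx y hy a c ha hc hac
  have hxy := form_pos_of_mem hS h hx hy
  have hxx : 0 < form S ℝ x x := by rw [form_self]; linarith [quad_pos_of_mem hx]
  have hf : 0 ≤ form S ℝ x (a • x + c • y) := by
    simp only [map_add, map_smul, smul_eq_mul]; positivity
  refine mem_posCone_of_form_nonneg hS hx ?_ hf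
  have hQx := quad_pos_of_mem hx
  have hQy := quad_pos_of_mem hy
  rw [quad_add hS, quad_smul, quad_smul]
  simp only [map_smul, LinearMap.smul_apply, smul_eq_mul]
  rcases ha.eq_or_lt with rfl | ha'
  · have : c = 1 := by linarith
    subst this; simpa using hQy
  · positivity

theorem smul_mem_posCone (hS : S.IsSymm) {p x : ι → ℝ} (hx : x ∈ posCone S p) {c : ℝ}
    (hc : 0 < c) : c • x ∈ posCone S p := by
  have hQx := quad_pos_of_mem hx
  refine mem_posCone_of_form_nonneg hS hx (by rw [quad_smul]; positivity) ?_
  rw [map_smul, form_self, smul_eq_mul]; positivity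

theorem quad_nonneg_of_mem_closure {p v : ι → ℝ} (hv : v ∈ closure (posCone S p)) :
    0 ≤ quad S ℝ v :=
  closure_minimal (fun _ hx => (quad_pos_of_mem hx).le)
    (isClosed_le continuous_const continuous_quad) hv

theorem form_nonneg_of_mem_closure {p x v : ι → ℝ} (hx : ∀ y ∈ posCone S p, 0 ≤ form S ℝ x y)
    (hv : v ∈ closure (posCone S p)) : 0 ≤ form S ℝ x v :=
  closure_minimal (t := {y | 0 ≤ form S ℝ x y}) hx
    (isClosed_le continuous_const (continuous_form_left x)) hv

theorem add_mem_posCone_of_closure (hS : S.IsSymm) (h : IsLorentzian S) {p x v : ι → ℝ}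
    (hx : x ∈ posCone S p) (hv : v ∈ closure (posCone S p)) : x + v ∈ posCone S p := by
  have h0 : 0 ≤ form S ℝ x v :=
    form_nonneg_of_mem_closure (fun y hy => (form_pos_of_mem hS h hx hy).le) hv
  have hQ := quad_nonneg_of_mem_closure hv
  have hQx := quad_pos_of_mem hx
  refine mem_posCone_of_form_nonneg hS hx (by rw [quad_add hS]; positivity) ?_
  rw [map_add, form_self]; positivity

/-- The complement of a positive vector is negative definite and contains no nonzero limit of
positive vectors. In contrapositive form this makes positive frequencies decay at every cusp,
one-dimensional ones included. -/
theorem quad_nonpos_of_orthogonal_closure (hS : S.IsSymm) (h : IsLorentzian S) {p x v : ι → ℝ}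
    (hv : v ∈ closure (posCone S p)) (hv0 : v ≠ 0) (hx : form S ℝ x v = 0) : quad S ℝ x ≤ 0 := by
  by_contra! hlt
  exact absurd (quad_nonneg_of_mem_closure hv) (not_le.2 (h.quad_neg hS hlt hx hv0))

/-- The dual of the positive cone is contained in its closure. -/
theorem quad_nonneg_of_form_nonneg (hS : S.IsSymm) {p x : ι → ℝ} (hp : 0 < quad S ℝ p)
    (hx : ∀ y ∈ posCone S p, 0 ≤ form S ℝ x y) : 0 ≤ quad S ℝ x := by
  by_contra! hlt
  -- With this `c` the vector `v = p - c x` is the projection of `p` to the complement of `x`.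
  set c : ℝ := form S ℝ x p / (2 * quad S ℝ x) with hc
  set v := p - c • x with hv
  have hcx : c * (2 * quad S ℝ x) = form S ℝ x p := by
    rw [hc]; exact div_mul_cancel₀ _ (by linarith)
  have hval : ∀ s : ℝ, quad S ℝ (p - s • x) = quad S ℝ p + s ^ 2 * quad S ℝ x
      - s * form S ℝ x p := by
    intro s
    have : p - s • x = p + (-s) • x := by rw [neg_smul, sub_eq_add_neg]
    rw [this, quad_add hS, quad_smul, map_smul, form_comm hS p x, smul_eq_mul]; ring
  -- Along the segment, `Q(p - e c x) = Q(p) - e (2 - e) c² Q(x)`, which is at least `Q(p)` because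
  -- `Q(x) < 0`.
  have hvP : v ∈ posCone S p := by
    refine mem_posCone_of_segment (mem_posCone_self hp) ?_
    rintro z ⟨a, e, ha, he, hae, rfl⟩
    have : a • p + e • v = p - (e * c) • x := by
      rw [hv, smul_sub, smul_smul, ← add_sub_assoc, ← add_smul, hae, one_smul]
    rw [this, hval, ← hcx]
    have he1 : e ≤ 1 := by linarith
    have h3 : 0 ≤ e * (2 - e) := mul_nonneg he (by linarith)
    have h4 : 0 ≤ c ^ 2 * (-quad S ℝ x) := mul_nonneg (sq_nonneg _) (by linarith)
    nlinarith [mul_nonneg h3 h4]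
  have hxv : form S ℝ x v = 0 := by
    rw [hv, map_sub, map_smul, form_self, smul_eq_mul, hcx, sub_self]
  have hcont : Continuous fun s : ℝ => v + s • x := by fun_prop
  -- The cone is open, so it contains `v + s x` for some `s > 0`; there the pairing with `x` is `2 s
  -- Q(x) < 0`.
  have hev : ∀ᶠ s in 𝓝 (0 : ℝ), v + s • x ∈ posCone S p :=
    hcont.continuousAt.eventually_mem ((isOpen_posCone p).mem_nhds (by simpa using hvP))
  obtain ⟨s, hs, hs0⟩ := ((hev.filter_mono nhdsWithin_le_nhds).and
    (self_mem_nhdsWithin (s := Set.Ioi (0 : ℝ)))).exists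
  have := hx _ hs
  rw [map_add, hxv, map_smul, form_self, smul_eq_mul] at this
  have hs0' : (0 : ℝ) < s := hs0
  nlinarith

theorem isOpen_upperHalf (p : ι → ℝ) : IsOpen (upperHalf S p) :=
  (isOpen_posCone p).preimage (by fun_prop)

end Cone


/-! ### Sublattices and their orthogonal complements -/

section Sublattice

variable {ι κ κ' : Type*} [Fintype ι] [DecidableEq ι] [Fintype κ] [DecidableEq κ] [Fintype κ']
  [DecidableEq κ'] {S : Matrix ι ι ℤ} {L : Submodule ℤ (ι → ℤ)} (b : Basis κ ℤ L)
  (b' : Basis κ' ℤ (orthLattice S L)) {K : Type*} [Field K]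

/-- The matrix whose columns are the vectors of a basis of a sublattice. -/
noncomputable def basisMatrix {L : Submodule ℤ (ι → ℤ)} (b : Basis κ ℤ L) : Matrix ι κ ℤ :=
  Matrix.of fun i j => (b j : ι → ℤ) i

/-- `embed` as a linear map. -/
noncomputable def embedLin (K : Type*) [Field K] : (κ → K) →ₗ[K] (ι → K) :=
  ((basisMatrix b).map (Int.cast : ℤ → K)).mulVecLin

theorem embedLin_apply (z : κ → K) : embedLin b K z = embed b z := by
  ext i
  simp [embedLin, embed, Matrix.mulVec, dotProduct, basisMatrix, mul_comm]

theorem embed_eq_mulVec (z : κ → K) :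
    embed b z = ((basisMatrix b).map (Int.cast : ℤ → K)).mulVec z := by
  rw [← embedLin_apply]; rfl

theorem embed_smul (c : K) (x : κ → K) : embed b (c • x) = c • embed b x := by
  simp only [← embedLin_apply, map_smul]

theorem embed_zero : embed b (0 : κ → K) = 0 := by
  simp only [← embedLin_apply, map_zero]

theorem embed_map {K' : Type*} [Field K'] (f : K →+* K') (x : κ → K) :
    embed b (fun i => f (x i)) = fun i => f (embed b x i) := by
  ext i; simp [embed]

theorem embed_ofReal (x : κ → ℝ) :
    embed b (fun i => (x i : ℂ)) = fun i => ((embed b x i : ℝ) : ℂ) :=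
  embed_map b Complex.ofRealHom x

theorem embed_im (z : κ → ℂ) (i : ι) : (embed b z i).im = embed b (fun j => (z j).im) i := by
  simp [embed, Complex.mul_im]

theorem continuous_embed {𝕜 : Type*} [RCLike 𝕜] : Continuous (embed b : (κ → 𝕜) → ι → 𝕜) := by
  unfold embed; fun_prop

theorem toBilin'_apply_int (x y : ι → ℤ) :
    Matrix.toBilin' S x y = ∑ i, ∑ j, x i * S i j * y j := Matrix.toBilin'_apply S x y

theorem form_intCast (x y : ι → ℤ) :
    form S K (fun i => (x i : K)) (fun i => (y i : K)) = ((Matrix.toBilin' S x y : ℤ) : K) := by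
  simp [form_apply, toBilin'_apply_int]

theorem embed_eq_sum (z : κ → K) :
    embed b z = ∑ j, z j • fun i => ((b j : ι → ℤ) i : K) := by
  ext i; simp [embed, Finset.sum_apply]

theorem form_embed_left (x : κ → K) (u : ι → K) :
    form S K (embed b x) u = ∑ j, x j * form S K (fun i => ((b j : ι → ℤ) i : K)) u := by
  simp [embed_eq_sum]

theorem form_embed (x y : κ → K) :
    form S K (embed b x) (embed b y) = form (subGram S b) K x y := by
  rw [form_embed_left, form_apply]
  refine Finset.sum_congr rfl fun i _ => ?_
  rw [embed_eq_sum, map_sum, Finset.mul_sum]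
  refine Finset.sum_congr rfl fun j _ => ?_
  rw [map_smul, form_intCast, subGram, Matrix.of_apply, smul_eq_mul]; ring

theorem quad_embed (x : κ → K) : quad S K (embed b x) = quad (subGram S b) K x := by
  rw [quad_apply, quad_apply, form_embed]

theorem toBilin'_comm (hS : S.IsSymm) (x y : ι → ℤ) :
    Matrix.toBilin' S x y = Matrix.toBilin' S y x := by
  rw [toBilin'_apply_int, toBilin'_apply_int, Finset.sum_comm]
  refine Finset.sum_congr rfl fun i _ => Finset.sum_congr rfl fun j _ => ?_
  rw [hS.apply i j]; ring

theorem form_embed_orth (hS : S.IsSymm) (x : κ → K) (y : κ' → K) :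
    form S K (embed b x) (embed b' y) = 0 := by
  rw [form_embed_left]
  refine Finset.sum_eq_zero fun i _ => ?_
  rw [embed_eq_sum, map_sum, Finset.sum_eq_zero, mul_zero]
  intro j _
  rw [map_smul, form_intCast, toBilin'_comm hS, (b' j).2 _ (b i).2]; simp

theorem form_embed_orth' (hS : S.IsSymm) (x : κ → K) (y : κ' → K) :
    form S K (embed b' y) (embed b x) = 0 := by
  rw [form_comm hS, form_embed_orth b b' hS]

theorem subGram_isSymm (hS : S.IsSymm) : (subGram S b).IsSymm := by
  ext i j
  simp only [subGram, Matrix.transpose_apply, Matrix.of_apply]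
  exact toBilin'_comm hS _ _

/-- Multiplication by the discriminant of `L` maps the lattice into `L ⊕ L^⊥`. -/
theorem exists_int_decomp (hS : S.IsSymm) (x : ι → ℤ) :
    ∃ (z : κ → ℤ) (w : κ' → ℤ), ∀ i, (subGram S b).det * x i =
      ∑ j, z j * (b j : ι → ℤ) i + ∑ j, w j * (b' j : ι → ℤ) i := by
  set T := subGram S b with hT
  set m : κ → ℤ := fun i => Matrix.toBilin' S (b i : ι → ℤ) x with hm
  -- The projection of `x` to `L` has coordinates `T⁻¹ m`; the adjugate gives `det T` times these
  -- over the integers.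
  set z : κ → ℤ := T.adjugate.mulVec m with hz
  have hTz : T.mulVec z = T.det • m := by
    rw [hz, Matrix.mulVec_mulVec, Matrix.mul_adjugate, Matrix.smul_mulVec, Matrix.one_mulVec]
  set l : ι → ℤ := ∑ j, z j • (b j : ι → ℤ) with hl
  have hmem : T.det • x - l ∈ orthLattice S L := by
    intro y hy
    obtain ⟨c, rfl⟩ : ∃ c : κ → ℤ, y = ∑ j, c j • (b j : ι → ℤ) := by
      refine ⟨fun j => b.repr ⟨y, hy⟩ j, ?_⟩
      have := congrArg L.subtype (b.sum_repr ⟨y, hy⟩)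
      rw [map_sum] at this
      exact this.symm
    have h0 : ∀ i, Matrix.toBilin' S (T.det • x - l) (b i : ι → ℤ) = 0 := by
      intro i
      rw [toBilin'_comm hS, map_sub, map_smul, hl, map_sum]
      have h1 := congrFun hTz i
      simp only [Matrix.mulVec, dotProduct, Pi.smul_apply, smul_eq_mul] at h1
      simp only [map_smul, smul_eq_mul]
      rw [show Matrix.toBilin' S (b i : ι → ℤ) x = m i from rfl, ← h1, sub_eq_zero]
      exact Finset.sum_congr rfl fun j _ => by rw [hT, subGram, Matrix.of_apply]; ring
    rw [map_sum, Finset.sum_eq_zero]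
    intro j _
    rw [map_smul, h0, smul_zero]
  refine ⟨z, fun j => b'.repr ⟨_, hmem⟩ j, fun i => ?_⟩
  have h1 : ∑ j, (b'.repr ⟨_, hmem⟩ j) • (b' j : ι → ℤ) = T.det • x - l := by
    have := congrArg (orthLattice S L).subtype (b'.sum_repr ⟨_, hmem⟩)
    rw [map_sum] at this
    exact this
  have h2 := congrFun h1 i
  simp only [Finset.sum_apply, Pi.smul_apply, smul_eq_mul, Pi.sub_apply, hl] at h2
  rw [h2]; ring

theorem exists_embed_add_embed [CharZero K] (hS : S.IsSymm) (hd : (subGram S b).det ≠ 0)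
    (u : ι → K) : ∃ (z : κ → K) (w : κ' → K), u = embed b z + embed b' w := by
  suffices h : LinearMap.range (embedLin b K) ⊔ LinearMap.range (embedLin b' K) = ⊤ by
    have : u ∈ LinearMap.range (embedLin b K) ⊔ LinearMap.range (embedLin b' K) := by
      rw [h]; trivial
    obtain ⟨_, ⟨z, rfl⟩, _, ⟨w, rfl⟩, rfl⟩ := Submodule.mem_sup.1 this
    exact ⟨z, w, by rw [embedLin_apply, embedLin_apply]⟩
  rw [eq_top_iff, ← (Pi.basisFun K ι).span_eq, Submodule.span_le]
  rintro _ ⟨i, rfl⟩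
  obtain ⟨z, w, h⟩ := exists_int_decomp b b' hS (Pi.single i 1)
  have hd' : ((subGram S b).det : K) ≠ 0 := by exact_mod_cast hd
  refine Submodule.mem_sup.2 ⟨_, ⟨((subGram S b).det : K)⁻¹ • fun j => (z j : K), rfl⟩, _,
    ⟨((subGram S b).det : K)⁻¹ • fun j => (w j : K), rfl⟩, ?_⟩
  rw [map_smul, map_smul, ← smul_add, inv_smul_eq_iff₀ hd', embedLin_apply, embedLin_apply]
  ext k
  have := congrArg (Int.cast : ℤ → K) (h k)
  rw [Int.cast_mul] at this
  simp only [Int.cast_add, Int.cast_sum, Int.cast_mul] at this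
  simp only [Pi.add_apply, embed, Pi.basisFun_apply, Pi.smul_apply, smul_eq_mul]
  rw [← this]
  simp [Pi.single_apply]

/-- Independence over `ℤ` passes to the fraction field `ℚ`. The resulting rational left inverse is a
matrix, so it survives base change to every field of characteristic zero. -/
theorem embed_injective [CharZero K] : Function.Injective (embed b : (κ → K) → ι → K) := by
  have hQ : Function.Injective (embedLin b ℚ) := by
    let c : (ι → ℤ) →ₗ[ℤ] (ι → ℚ) :=
      { toFun := fun x i => (x i : ℚ)
        map_add' := by intro x y; ext; simp
        map_smul' := by intro x y; ext; simp }
    have hc : LinearMap.ker c = ⊥ := by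
      rw [LinearMap.ker_eq_bot]
      intro x y hxy
      ext i
      have := congrFun hxy i
      simpa [c] using this
    have h1 : LinearIndependent ℤ (fun j => c (b j : ι → ℤ)) :=
      (b.linearIndependent.map' L.subtype L.ker_subtype).map' c hc
    have h2 := (LinearIndependent.iff_fractionRing ℤ ℚ).1 h1
    rw [← LinearMap.ker_eq_bot, LinearMap.ker_eq_bot']
    intro z hz
    have h3 := Fintype.linearIndependent_iff.1 h2 z (by
      rw [embedLin_apply, embed_eq_sum] at hz
      exact hz)
    exact funext h3
  obtain ⟨g, hg⟩ := LinearMap.exists_leftInverse_of_injective _ (LinearMap.ker_eq_bot.2 hQ)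
  have hGM : LinearMap.toMatrix' g * (basisMatrix b).map (Int.cast : ℤ → ℚ) = 1 := by
    rw [← LinearMap.toMatrix'_id, ← hg, LinearMap.toMatrix'_comp]
    congr 1
    exact (LinearMap.toMatrix'_toLin' _).symm
  have hGK : (LinearMap.toMatrix' g).map (Rat.castHom K) *
      (basisMatrix b).map (Int.cast : ℤ → K) = 1 := by
    have := congrArg (fun A => A.map (Rat.castHom K)) hGM
    simp only [Matrix.map_mul, Matrix.map_one _ (map_zero (Rat.castHom K)) (map_one _)] at this
    rw [← this]
    congr 1
    ext; simp
  intro x y hxy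
  rw [embed_eq_mulVec, embed_eq_mulVec] at hxy
  have := congrArg ((LinearMap.toMatrix' g).map (Rat.castHom K)).mulVec hxy
  simpa only [Matrix.mulVec_mulVec, hGK, Matrix.one_mulVec] using this

/-- The single positive direction is used up by `L`. Both the finiteness of the inner sums and
cuspidality rest on this. -/
theorem quad_subGram_orth_neg (hS : S.IsSymm) (hΛ : IsLorentzian S) {p : κ → ℝ}
    (hp : 0 < quad (subGram S b) ℝ p) {w : κ' → ℝ} (hw : w ≠ 0) :
    quad (subGram S b') ℝ w < 0 := by
  rw [← quad_embed] at hp ⊢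
  refine hΛ.quad_neg hS hp (form_embed_orth b b' hS p w) fun h => hw ?_
  exact embed_injective b' (h.trans (embed_zero b').symm)

/-- The image of a connected set of positive vectors is again connected and consists of positive
vectors. -/
theorem embed_mem_posCone {p y : κ → ℝ} (hy : y ∈ posCone (subGram S b) p) :
    embed b y ∈ posCone S (embed b p) := by
  have hp : p ∈ posCone (subGram S b) p := by
    refine mem_connectedComponentIn ?_
    by_contra h
    rw [posCone, connectedComponentIn_eq_empty h] at hy
    exact hy
  have h := (isPreconnected_connectedComponentIn (x := p)
    (F := {y : κ → ℝ | 0 < quad (subGram S b) ℝ y})).image (embed b) (continuous_embed b).continuousOn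
  refine h.subset_connectedComponentIn (Set.mem_image_of_mem _ hp) ?_ (Set.mem_image_of_mem _ hy)
  rintro _ ⟨x, hx, rfl⟩
  have := quad_pos_of_mem (S := subGram S b) hx
  rwa [← quad_embed] at this

theorem embed_mem_upperHalf {p : κ → ℝ} {z : κ → ℂ} (hz : z ∈ upperHalf (subGram S b) p) :
    embed b z ∈ upperHalf S (embed b p) := by
  have := embed_mem_posCone b hz
  rw [upperHalf, Set.mem_ofPred_eq]
  convert this using 1
  ext i
  exact embed_im b z i

/-! ### Dual lattices -/

/-- An integral linear form on the lattice is given by a pair of dual vectors of `L` and its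
orthogonal complement. -/
theorem exists_dual_of_int (hS : S.IsSymm) (hΛ : IsLorentzian S) (hL : IsLorentzian (subGram S b))
    (n : ι → ℤ) : ∃ x ∈ dualLattice (subGram S b), ∃ y ∈ dualLattice (subGram S b'),
      ∀ u : ι → ℝ, form S ℝ (embed b x + embed b' y) u = ∑ i, (n i : ℝ) * u i := by
  have hdet : (S.map (Int.cast : ℤ → ℝ)).det ≠ 0 := by
    have := (Int.castRingHom ℝ).map_det S
    intro h
    exact hΛ.isUnit_det hS (Int.cast_eq_zero.1 (this.trans h))
  -- The form `n` is represented by `S⁻¹ n`. Its components in `L ⊗ ℝ` and `L^⊥ ⊗ ℝ` pair with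
  -- lattice vectors through `n`, hence integrally.
  set l : ι → ℝ := (S.map (Int.cast : ℤ → ℝ))⁻¹.mulVec (fun i => (n i : ℝ)) with hl
  have hform : ∀ u : ι → ℝ, form S ℝ l u = ∑ i, (n i : ℝ) * u i := by
    intro u
    rw [form_comm hS, form_eq_dotProduct, hl, Matrix.mulVec_mulVec,
      Matrix.mul_nonsing_inv _ (Ne.isUnit hdet), Matrix.one_mulVec, dotProduct_comm]
    rfl
  obtain ⟨x, y, hxy⟩ := exists_embed_add_embed b b' hS (hL.isUnit_det (subGram_isSymm b hS)) l
  refine ⟨x, fun e => ⟨∑ i, n i * ∑ j, e j * (b j : ι → ℤ) i, ?_⟩, y,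
    fun e => ⟨∑ i, n i * ∑ j, e j * (b' j : ι → ℤ) i, ?_⟩, fun u => by rw [← hxy, hform]⟩
  · have := hform (embed b fun i => (e i : ℝ))
    rw [hxy, map_add, LinearMap.add_apply, form_embed, form_embed_orth' b b' hS, add_zero] at this
    rw [this]; simp [embed]
  · have := hform (embed b' fun i => (e i : ℝ))
    rw [hxy, map_add, LinearMap.add_apply, form_embed, form_embed_orth b b' hS, zero_add] at this
    rw [this]; simp [embed]

/-- The vector of the linear form `⟨x + y, ·⟩`. -/
noncomputable def freq (x : κ → ℝ) (y : κ' → ℝ) : ι → ℝ :=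
  fun i => form S ℝ (embed b x + embed b' y) (Pi.single i 1)

theorem sum_freq_mul (x : κ → ℝ) (y : κ' → ℝ) (u : ι → ℝ) :
    ∑ i, freq b b' x y i * u i = form S ℝ (embed b x + embed b' y) u := by
  conv_rhs => rw [← Finset.univ_sum_single u]
  rw [map_sum]
  refine Finset.sum_congr rfl fun i _ => ?_
  rw [freq, show (Pi.single i (u i) : ι → ℝ) = u i • Pi.single i 1 by
    rw [← Pi.single_smul, smul_eq_mul, mul_one], map_smul, smul_eq_mul, mul_comm]

theorem sum_freq_mul_complex (x : κ → ℝ) (y : κ' → ℝ) (u : ι → ℂ) :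
    ∑ i, (freq b b' x y i : ℂ) * u i =
      form S ℂ (embed b (fun i => (x i : ℂ)) + embed b' (fun i => (y i : ℂ))) u := by
  conv_rhs => rw [← Finset.univ_sum_single u]
  rw [map_sum]
  refine Finset.sum_congr rfl fun i _ => ?_
  rw [freq, show (Pi.single i (u i) : ι → ℂ) = u i • fun j => ((Pi.single i 1 : ι → ℝ) j : ℂ) by
    ext j; by_cases h : j = i
    · subst h; simp
    · simp [h], map_smul, smul_eq_mul, mul_comm, embed_ofReal, embed_ofReal]
  congr 1
  rw [← form_ofReal]
  congr 2
  ext j; simp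

theorem sum_freq_mul_embed (hS : S.IsSymm) (x : κ → ℝ) (y : κ' → ℝ) (z : κ → ℂ) (w : κ' → ℂ) :
    ∑ i, (freq b b' x y i : ℂ) * (embed b z + embed b' w) i =
      form (subGram S b) ℂ (fun i => (x i : ℂ)) z + form (subGram S b') ℂ (fun i => (y i : ℂ)) w := by
  rw [sum_freq_mul_complex]
  simp only [map_add, LinearMap.add_apply, form_embed, form_embed_orth b b' hS,
    form_embed_orth' b b' hS]
  ring

/-- Pairs of dual vectors are integral on `L ⊕ L^⊥`, which contains the determinant times the
lattice. The common denominator makes Fourier analysis on the standard torus applicable. -/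
theorem freq_integral (hS : S.IsSymm) {x : κ → ℝ} {y : κ' → ℝ} (hx : x ∈ dualLattice (subGram S b))
    (hy : y ∈ dualLattice (subGram S b')) (i : ι) :
    ∃ n : ℤ, ((subGram S b).det : ℝ) * freq b b' x y i = n := by
  obtain ⟨z, w, h⟩ := exists_int_decomp b b' hS (Pi.single i 1)
  obtain ⟨n, hn⟩ := hx z
  obtain ⟨m, hm⟩ := hy w
  refine ⟨n + m, ?_⟩
  have h1 : ((subGram S b).det : ℝ) • (Pi.single i 1 : ι → ℝ) =
      embed b (fun j => (z j : ℝ)) + embed b' (fun j => (w j : ℝ)) := by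
    ext k
    have := congrArg (Int.cast : ℤ → ℝ) (h k)
    rw [Int.cast_mul] at this
    simp only [Int.cast_add, Int.cast_sum, Int.cast_mul] at this
    simp only [Pi.add_apply, embed, Pi.smul_apply, smul_eq_mul]
    rw [← this]
    simp [Pi.single_apply]
  rw [freq, ← smul_eq_mul, ← map_smul, h1]
  simp only [map_add, LinearMap.add_apply, form_embed, form_embed_orth b b' hS,
    form_embed_orth' b b' hS, hn, hm]
  push_cast; ring

theorem freq_injective (hS : S.IsSymm) (hΛ : IsLorentzian S) (hL : IsLorentzian (subGram S b))
    {p : κ → ℝ} (hp : 0 < quad (subGram S b) ℝ p)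
    {x x' : κ → ℝ} {y y' : κ' → ℝ} (h : freq b b' x y = freq b b' x' y') : x = x' ∧ y = y' := by
  have h1 : ∀ u, form S ℝ (embed b (x - x') + embed b' (y - y')) u = 0 := by
    intro u
    have h2 : embed b (x - x') + embed b' (y - y') =
        (embed b x + embed b' y) - (embed b x' + embed b' y') := by
      simp only [← embedLin_apply, map_sub]; abel
    rw [h2, map_sub, LinearMap.sub_apply, ← sum_freq_mul, ← sum_freq_mul, h, sub_self]
  constructor
  · rw [← sub_eq_zero]
    refine hL.eq_zero_of_form_eq_zero (subGram_isSymm b hS) fun z => ?_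
    have := h1 (embed b z)
    rwa [map_add, LinearMap.add_apply, form_embed, form_embed_orth' b b' hS, add_zero] at this
  · rw [← sub_eq_zero]
    by_contra hne
    have := h1 (embed b' (y - y'))
    rw [map_add, LinearMap.add_apply, form_embed, form_embed_orth b b' hS, zero_add, form_self]
      at this
    linarith [quad_subGram_orth_neg b b' hS hΛ hp hne]

/-- A negative definite dual lattice has only finitely many vectors of bounded norm. -/
theorem finite_dual_of_neg {T : Matrix κ κ ℤ} (hT : T.IsSymm)
    (hneg : ∀ w : κ → ℝ, w ≠ 0 → quad T ℝ w < 0) (C : ℝ) :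
    {y : dualLattice T | C ≤ quad T ℝ (y : κ → ℝ)}.Finite := by
  have hle : ∀ w : κ → ℝ, quad T ℝ w ≤ 0 := fun w => by
    rcases eq_or_ne w 0 with rfl | h
    · simp
    · exact (hneg w h).le
  -- Cauchy–Schwarz, from the discriminant of the nonnegative polynomial `t ↦ -Q(v + t w)`.
  have hcs : ∀ v w : κ → ℝ, form T ℝ v w ^ 2 ≤ 4 * (quad T ℝ v * quad T ℝ w) := by
    intro v w
    have := discrim_le_zero (a := -quad T ℝ w) (b := -form T ℝ v w) (c := -quad T ℝ v) (by
      intro t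
      have := hle (v + t • w)
      rw [quad_add hT, quad_smul, map_smul, smul_eq_mul] at this
      linarith)
    rw [discrim] at this
    linarith
  -- The integers `⟨y, e_i⟩` determine `y` by definiteness, and Cauchy–Schwarz bounds each of them.
  have hint : ∀ (y : dualLattice T) (i : κ), ∃ n : ℤ, form T ℝ (y : κ → ℝ) (Pi.single i 1) = n := by
    intro y i
    obtain ⟨n, hn⟩ := y.2 (Pi.single i 1)
    refine ⟨n, by rw [← hn]; congr 1; ext j; simp [Pi.single_apply]⟩
  choose f hf using hint
  have hinj : Function.Injective f := by
    intro y y' h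
    have h0 : ∀ u, form T ℝ ((y : κ → ℝ) - y') u = 0 := by
      intro u
      rw [← Finset.univ_sum_single u, map_sum]
      refine Finset.sum_eq_zero fun i _ => ?_
      rw [show (Pi.single i (u i) : κ → ℝ) = u i • Pi.single i 1 by
        rw [← Pi.single_smul, smul_eq_mul, mul_one], map_smul, map_sub, LinearMap.sub_apply, hf, hf,
        h, sub_self, smul_zero]
    by_contra hne
    have h1 := hneg ((y : κ → ℝ) - y') (sub_ne_zero.2 fun h => hne (Subtype.ext h))
    have h2 := h0 ((y : κ → ℝ) - y')
    rw [form_self] at h2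
    linarith
  refine Set.Finite.of_finite_image (f := f) ?_ hinj.injOn
  set B : κ → ℝ := fun i => 4 * (C * quad T ℝ (Pi.single i 1)) with hB
  refine (Set.Finite.pi' (t := fun i => Set.Icc (-⌈B i⌉) ⌈B i⌉)
    fun i => Set.finite_Icc _ _).subset ?_
  rintro _ ⟨y, hy, rfl⟩ i
  have h1 := hcs y (Pi.single i 1)
  rw [hf] at h1
  have h2 : quad T ℝ (y : κ → ℝ) * quad T ℝ (Pi.single i 1) ≤ C * quad T ℝ (Pi.single i 1) :=
    mul_le_mul_of_nonpos_right hy (hle _)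
  have h3 : ((f y i) ^ 2 : ℤ) ≤ ⌈B i⌉ := by
    rw [Int.le_ceil_iff]
    push_cast
    simp only [hB]; linarith
  -- For an integer, `|f| ≤ f²`, so the bound on the square bounds `f` from both sides.
  constructor <;> nlinarith

end Sublattice

/-! ### The action of the orthogonal group -/

section Action

variable {ι : Type*} [Fintype ι] [DecidableEq ι] {S : Matrix ι ι ℤ} {K : Type*} [Field K]

/-- The vector `(a, z, c)`. -/
def extVec (a : K) (z : ι → K) (c : K) : Ext ι → K :=
  Sum.elim (fun _ => a) (Sum.elim z (fun _ => c))

@[simp] theorem extVec_fst (a : K) (z : ι → K) (c : K) (u : Unit) :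
    extVec a z c (Sum.inl u) = a := rfl

@[simp] theorem extVec_mid (a : K) (z : ι → K) (c : K) (i : ι) :
    extVec a z c (Sum.inr (Sum.inl i)) = z i := rfl

@[simp] theorem extVec_last (a : K) (z : ι → K) (c : K) (u : Unit) :
    extVec a z c (Sum.inr (Sum.inr u)) = c := rfl

theorem extVec_eta (Z : Ext ι → K) :
    extVec (Z (Sum.inl ())) (fun i => Z (Sum.inr (Sum.inl i))) (Z (Sum.inr (Sum.inr ()))) = Z := by
  ext (_ | _ | _) <;> rfl

theorem smul_extVec (d a c : K) (z : ι → K) :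
    d • extVec a z c = extVec (d * a) (d • z) (d * c) := by
  ext (_ | _ | _) <;> rfl

theorem extVec_inj {a a' c c' : K} {z z' : ι → K} :
    extVec a z c = extVec a' z' c' ↔ a = a' ∧ z = z' ∧ c = c' := by
  constructor
  · intro h
    exact ⟨congrFun h (Sum.inl ()), funext fun i => congrFun h (Sum.inr (Sum.inl i)),
      congrFun h (Sum.inr (Sum.inr ()))⟩
  · rintro ⟨rfl, rfl, rfl⟩; rfl

theorem extGram_isSymm (hS : S.IsSymm) : (extGram S).IsSymm := by
  ext (_ | i | _) (_ | j | _) <;> simp [extGram, hS.apply]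

theorem form_extGram (Z W : Ext ι → K) :
    form (extGram S) K Z W = Z (Sum.inl ()) * W (Sum.inr (Sum.inr ())) +
      Z (Sum.inr (Sum.inr ())) * W (Sum.inl ()) +
      form S K (fun i => Z (Sum.inr (Sum.inl i))) (fun i => W (Sum.inr (Sum.inl i))) := by
  rw [form_apply, form_apply]
  simp [extGram, Fintype.sum_sum_type]
  ring

theorem form_extVec (a c a' c' : K) (z z' : ι → K) :
    form (extGram S) K (extVec a z c) (extVec a' z' c') = a * c' + c * a' + form S K z z' := by
  rw [form_extGram]; rfl

theorem quad_extVec [CharZero K] (a c : K) (z : ι → K) :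
    quad (extGram S) K (extVec a z c) = a * c + quad S K z := by
  rw [quad_apply, quad_apply, form_extVec]; field_simp; ring

/-- The real orthogonal group of `Λ ⊕ II_{1,1}`. -/
def orthSet (S : Matrix ι ι ℤ) : Set (Matrix (Ext ι) (Ext ι) ℝ) :=
  {M | M.transpose * (extGram S).map (Int.cast : ℤ → ℝ) * M =
      (extGram S).map (Int.cast : ℤ → ℝ)}

theorem orthGroup_subset : orthGroup S ⊆ orthSet S := connectedComponentIn_subset _ _

theorem one_mem_orthSet : (1 : Matrix (Ext ι) (Ext ι) ℝ) ∈ orthSet S := by simp [orthSet]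

theorem one_mem_orthGroup : (1 : Matrix (Ext ι) (Ext ι) ℝ) ∈ orthGroup S :=
  mem_connectedComponentIn one_mem_orthSet

theorem mulVec_dotProduct_mulVec {m n R : Type*} [Fintype m] [Fintype n] [CommRing R]
    (A B : Matrix m n R) (G : Matrix m m R) (x y : n → R) :
    A.mulVec x ⬝ᵥ G.mulVec (B.mulVec y) = x ⬝ᵥ (A.transpose * G * B).mulVec y := by
  rw [← Matrix.mulVec_mulVec, ← Matrix.mulVec_mulVec, Matrix.dotProduct_mulVec x,
    Matrix.vecMul_transpose]

theorem form_mulVec_of_orth {M : Matrix (Ext ι) (Ext ι) ℝ} (hM : M ∈ orthSet S) (Z W : Ext ι → ℝ) :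
    form (extGram S) ℝ (M.mulVec Z) (M.mulVec W) = form (extGram S) ℝ Z W := by
  rw [form_eq_dotProduct, form_eq_dotProduct, mulVec_dotProduct_mulVec, hM]

theorem form_mulVec_of_orth_complex {M : Matrix (Ext ι) (Ext ι) ℝ} (hM : M ∈ orthSet S)
    (Z W : Ext ι → ℂ) : form (extGram S) ℂ ((M.map ((↑) : ℝ → ℂ)).mulVec Z)
      ((M.map ((↑) : ℝ → ℂ)).mulVec W) = form (extGram S) ℂ Z W := by
  have h : (extGram S).map (Int.cast : ℤ → ℂ) =
      ((extGram S).map (Int.cast : ℤ → ℝ)).map Complex.ofRealHom := by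
    ext; simp
  have h2 : M.map ((↑) : ℝ → ℂ) = M.map Complex.ofRealHom := rfl
  rw [form_eq_dotProduct, form_eq_dotProduct, mulVec_dotProduct_mulVec, h, h2,
    ← Matrix.transpose_map, ← Matrix.map_mul, ← Matrix.map_mul, hM]

theorem mem_orthSet_of_form {M : Matrix (Ext ι) (Ext ι) ℝ}
    (h : ∀ Z W, form (extGram S) ℝ (M.mulVec Z) (M.mulVec W) = form (extGram S) ℝ Z W) :
    M ∈ orthSet S := by
  refine Matrix.ext_of_mulVec_single fun j => funext fun i => ?_
  have := h (Pi.single i 1) (Pi.single j 1)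
  rw [form_eq_dotProduct, form_eq_dotProduct, mulVec_dotProduct_mulVec] at this
  simpa using this

theorem moved_eq_mulVec (M : Matrix (Ext ι) (Ext ι) ℝ) (z : ι → ℂ) :
    moved S M z = (M.map ((↑) : ℝ → ℂ)).mulVec (extVec (-quad S ℂ z) z 1) := rfl

theorem quad_re_im (hS : S.IsSymm) (z : ι → ℂ) :
    quad S ℂ z = ((quad S ℝ (fun i => (z i).re) - quad S ℝ (fun i => (z i).im) : ℝ) : ℂ) +
      (form S ℝ (fun i => (z i).re) (fun i => (z i).im) : ℝ) * Complex.I := by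
  have hz : z = (fun i => ((z i).re : ℂ)) + Complex.I • (fun i => ((z i).im : ℂ)) := by
    ext i
    simp only [Pi.add_apply, Pi.smul_apply, smul_eq_mul]
    rw [mul_comm]; exact (Complex.re_add_im _).symm
  conv_lhs => rw [hz]
  rw [quad_add hS, quad_smul, quad_ofReal, quad_ofReal, map_smul, form_ofReal, Complex.I_sq]
  push_cast
  simp only [smul_eq_mul]; ring

theorem form_conj_self (hS : S.IsSymm) (z : ι → ℂ) :
    form S ℂ (fun i => starRingEnd ℂ (z i)) z =
      ((2 * quad S ℝ (fun i => (z i).re) + 2 * quad S ℝ (fun i => (z i).im) : ℝ) : ℂ) := by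
  have hz : z = (fun i => ((z i).re : ℂ)) + Complex.I • (fun i => ((z i).im : ℂ)) := by
    ext i
    simp only [Pi.add_apply, Pi.smul_apply, smul_eq_mul]
    rw [mul_comm]; exact (Complex.re_add_im _).symm
  have hz' : (fun i => starRingEnd ℂ (z i)) =
      (fun i => ((z i).re : ℂ)) - Complex.I • (fun i => ((z i).im : ℂ)) := by
    ext i
    simp only [Pi.sub_apply, Pi.smul_apply, smul_eq_mul]
    apply Complex.ext <;> simp
  conv_lhs => rw [hz']; rhs; rw [hz]
  simp only [map_sub, map_add, map_smul, LinearMap.sub_apply, LinearMap.smul_apply, form_ofReal,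
    smul_eq_mul, ← form_self]
  have hc := form_comm hS (fun i => (z i).im) (fun i => (z i).re)
  rw [hc]
  push_cast
  linear_combination (-(form S ℝ (fun i => (z i).im) (fun i => (z i).im) : ℂ)) * Complex.I_sq

/-- The hermitian norm of the null vector attached to `z` sees only `Im z`. Real isometries preserve
it, which controls both the automorphy factor and the norm of `Im (M·z)`. -/
theorem form_conj_extVec (hS : S.IsSymm) (z : ι → ℂ) :
    form (extGram S) ℂ (fun i => starRingEnd ℂ (extVec (-quad S ℂ z) z 1 i))
      (extVec (-quad S ℂ z) z 1) = ((4 * quad S ℝ (fun i => (z i).im) : ℝ) : ℂ) := by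
  rw [form_extGram]
  simp only [extVec_fst, extVec_mid, extVec_last, form_conj_self hS, quad_re_im hS]
  apply Complex.ext <;> simp
  ring

theorem conj_mulVec (M : Matrix (Ext ι) (Ext ι) ℝ) (Z : Ext ι → ℂ) :
    (fun i => starRingEnd ℂ ((M.map ((↑) : ℝ → ℂ)).mulVec Z i)) =
      (M.map ((↑) : ℝ → ℂ)).mulVec (fun i => starRingEnd ℂ (Z i)) := by
  ext i
  simp [Matrix.mulVec, dotProduct]

theorem quad_moved {M : Matrix (Ext ι) (Ext ι) ℝ} (hM : M ∈ orthSet S) (z : ι → ℂ) :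
    quad (extGram S) ℂ (moved S M z) = 0 := by
  rw [quad_apply, moved_eq_mulVec, form_mulVec_of_orth_complex hM, ← quad_apply, quad_extVec]
  ring

theorem form_conj_moved (hS : S.IsSymm) {M : Matrix (Ext ι) (Ext ι) ℝ} (hM : M ∈ orthSet S)
    (z : ι → ℂ) : form (extGram S) ℂ (fun i => starRingEnd ℂ (moved S M z i)) (moved S M z) =
      ((4 * quad S ℝ (fun i => (z i).im) : ℝ) : ℂ) := by
  rw [moved_eq_mulVec, conj_mulVec, form_mulVec_of_orth_complex hM, form_conj_extVec hS]

theorem moved_eq_extVec (M : Matrix (Ext ι) (Ext ι) ℝ) (z : ι → ℂ) :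
    moved S M z = extVec (moved S M z (Sum.inl ()))
      (fun i => moved S M z (Sum.inr (Sum.inl i))) (autFactor S M z) :=
  (extVec_eta _).symm

/-- If the last coordinate vanished, the middle block `x + i y` would be null with positive
hermitian norm: `Q(x) = Q(y) > 0` and `⟨x, y⟩ = 0`, against the signature. -/
theorem autFactor_ne_zero (hS : S.IsSymm) (hΛ : IsLorentzian S) {M : Matrix (Ext ι) (Ext ι) ℝ}
    (hM : M ∈ orthSet S) {z : ι → ℂ} (hz : 0 < quad S ℝ (fun i => (z i).im)) :
    autFactor S M z ≠ 0 := by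
  intro h0
  have h1 := quad_moved hM z
  have h2 := form_conj_moved hS hM z
  rw [moved_eq_extVec, h0] at h1 h2
  rw [quad_extVec, mul_zero, zero_add, quad_re_im hS] at h1
  rw [form_extGram] at h2
  simp only [extVec_fst, extVec_mid, extVec_last, form_conj_self hS, mul_zero, map_zero, zero_mul,
    zero_add, Complex.ofReal_inj] at h2
  have hre := congrArg Complex.re h1
  have him := congrArg Complex.im h1
  simp at hre him
  set x : ι → ℝ := fun i => (moved S M z (Sum.inr (Sum.inl i))).re
  set y : ι → ℝ := fun i => (moved S M z (Sum.inr (Sum.inl i))).im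
  have hx : 0 < quad S ℝ x := by linarith
  have := hΛ.quad_nonpos hS hx him
  linarith

theorem moved_eq_smul {M : Matrix (Ext ι) (Ext ι) ℝ} (hM : M ∈ orthSet S) {z : ι → ℂ}
    (hj : autFactor S M z ≠ 0) : moved S M z =
      autFactor S M z • extVec (-quad S ℂ (moebius S M z)) (moebius S M z) 1 := by
  have hmid : (fun i => moved S M z (Sum.inr (Sum.inl i))) = autFactor S M z • moebius S M z := by
    ext i
    simp only [moebius, Pi.smul_apply, smul_eq_mul]
    rw [mul_inv_cancel_left₀ hj]
  have h1 := quad_moved hM z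
  rw [moved_eq_extVec, hmid, quad_extVec, quad_smul] at h1
  rw [moved_eq_extVec, hmid, smul_extVec, extVec_inj]
  refine ⟨?_, rfl, by rw [mul_one]⟩
  apply mul_right_cancel₀ hj
  linear_combination h1

theorem quad_im_moebius (hS : S.IsSymm) {M : Matrix (Ext ι) (Ext ι) ℝ} (hM : M ∈ orthSet S)
    {z : ι → ℂ} (hj : autFactor S M z ≠ 0) :
    ‖autFactor S M z‖ ^ 2 * quad S ℝ (fun i => (moebius S M z i).im) =
      quad S ℝ (fun i => (z i).im) := by
  have h1 := form_conj_moved hS hM z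
  rw [moved_eq_smul hM hj] at h1
  have h2 : (fun i => starRingEnd ℂ
      ((autFactor S M z • extVec (-quad S ℂ (moebius S M z)) (moebius S M z) 1) i)) =
      starRingEnd ℂ (autFactor S M z) •
        fun i => starRingEnd ℂ (extVec (-quad S ℂ (moebius S M z)) (moebius S M z) 1 i) := by
    ext i; simp
  rw [h2, map_smul, map_smul, LinearMap.smul_apply, form_conj_extVec hS, smul_smul, smul_eq_mul, Complex.mul_conj, Complex.normSq_eq_norm_sq, ← Complex.ofReal_mul,
    Complex.ofReal_inj] at h1
  linarith

theorem moved_mul (M N : Matrix (Ext ι) (Ext ι) ℝ) (hN : N ∈ orthSet S) {z : ι → ℂ}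
    (hj : autFactor S N z ≠ 0) :
    moved S (M * N) z = autFactor S N z • moved S M (moebius S N z) := by
  have : (M * N).map ((↑) : ℝ → ℂ) = M.map ((↑) : ℝ → ℂ) * N.map ((↑) : ℝ → ℂ) :=
    Matrix.map_mul (f := Complex.ofRealHom)
  rw [moved_eq_mulVec, this, ← Matrix.mulVec_mulVec, ← moved_eq_mulVec, moved_eq_smul hN hj,
    Matrix.mulVec_smul, ← moved_eq_mulVec]

theorem autFactor_mul (M N : Matrix (Ext ι) (Ext ι) ℝ) (hN : N ∈ orthSet S) {z : ι → ℂ}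
    (hj : autFactor S N z ≠ 0) :
    autFactor S (M * N) z = autFactor S N z * autFactor S M (moebius S N z) := by
  rw [autFactor, moved_mul M N hN hj]; rfl

theorem moebius_mul (M N : Matrix (Ext ι) (Ext ι) ℝ) (hN : N ∈ orthSet S) {z : ι → ℂ}
    (hj : autFactor S N z ≠ 0) :
    moebius S (M * N) z = moebius S M (moebius S N z) := by
  ext i
  rw [moebius, autFactor_mul M N hN hj, moved_mul M N hN hj, Pi.smul_apply, smul_eq_mul, moebius]
  field_simp

theorem slash_mul (k : ℤ) (F : (ι → ℂ) → ℂ) (M N : Matrix (Ext ι) (Ext ι) ℝ) (hN : N ∈ orthSet S)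
    {z : ι → ℂ} (hj : autFactor S N z ≠ 0) :
    slash S k F (M * N) z = slash S k (slash S k F M) N z := by
  rw [slash, autFactor_mul M N hN hj, moebius_mul M N hN hj, mul_zpow, slash, slash]; ring

theorem moved_one (z : ι → ℂ) : moved S 1 z = extVec (-quad S ℂ z) z 1 := by
  rw [moved_eq_mulVec]
  have : (1 : Matrix (Ext ι) (Ext ι) ℝ).map ((↑) : ℝ → ℂ) = 1 :=
    Matrix.map_one _ Complex.ofReal_zero Complex.ofReal_one
  rw [this, Matrix.one_mulVec]

theorem autFactor_one (z : ι → ℂ) : autFactor S 1 z = 1 := by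
  rw [autFactor, moved_one]; rfl

theorem moebius_one (z : ι → ℂ) : moebius S 1 z = z := by
  ext i
  rw [moebius, autFactor_one, moved_one]; simp

theorem slash_one (k : ℤ) (F : (ι → ℂ) → ℂ) (z : ι → ℂ) : slash S k F 1 z = F z := by
  rw [slash, autFactor_one, moebius_one, one_zpow, one_mul]

theorem upperHalf_quad_pos {p : ι → ℝ} {z : ι → ℂ} (hz : z ∈ upperHalf S p) :
    0 < quad S ℝ (fun i => (z i).im) := quad_pos_of_mem hz

theorem continuous_moved (z : ι → ℂ) : Continuous fun M => moved S M z := by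
  simp only [moved_eq_mulVec]
  unfold Matrix.mulVec dotProduct
  simp only [Matrix.map_apply]
  fun_prop

/-- `SO⁺` preserves the upper half-space. -/
theorem moebius_mem_upperHalf (hS : S.IsSymm) (hΛ : IsLorentzian S) {p : ι → ℝ}
    {M : Matrix (Ext ι) (Ext ι) ℝ} (hM : M ∈ orthGroup S) {z : ι → ℂ} (hz : z ∈ upperHalf S p) :
    moebius S M z ∈ upperHalf S p := by
  have hQ := upperHalf_quad_pos hz
  have hj : ∀ N ∈ orthSet S, autFactor S N z ≠ 0 := fun N hN => autFactor_ne_zero hS hΛ hN hQ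
  -- The imaginary part of `N·z` depends continuously on `N` in the connected group and keeps
  -- positive norm, so it cannot leave the component of `Im z`.
  have hcont : ContinuousOn (fun N => fun i => (moebius S N z i).im) (orthGroup S) := by
    have h0 : ContinuousOn (fun N => moebius S N z) (orthGroup S) := by
      refine continuousOn_pi.2 fun i => ContinuousOn.mul (ContinuousOn.inv₀ ?_ ?_) ?_
      · exact ((continuous_apply _).comp (continuous_moved z)).continuousOn
      · exact fun N hN => hj N (orthGroup_subset hN)
      · exact ((continuous_apply _).comp (continuous_moved z)).continuousOn
    have h1 : Continuous fun w : ι → ℂ => fun i => (w i).im := by fun_prop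
    exact h1.comp_continuousOn h0
  have hpre := (isPreconnected_connectedComponentIn (x := (1 : Matrix (Ext ι) (Ext ι) ℝ))
    (F := orthSet S)).image _ hcont
  have hz' : (fun i => (z i).im) ∈ posCone S p := hz
  have hsub := hpre.subset_connectedComponentIn (x := fun i => (z i).im)
    (F := {y : ι → ℝ | 0 < quad S ℝ y})
    ⟨1, one_mem_orthGroup, by simp [moebius_one]⟩ (by
      rintro _ ⟨N, hN, rfl⟩
      have h1 := quad_im_moebius hS (orthGroup_subset hN) (hj N (orthGroup_subset hN))
      rw [← h1] at hQ
      exact pos_of_mul_pos_right hQ (by positivity))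
  have := hsub ⟨M, hM, rfl⟩
  change _ ∈ posCone S p
  rw [← posCone_eq hz']
  exact this

theorem differentiable_moved (M : Matrix (Ext ι) (Ext ι) ℝ) (i : Ext ι) :
    Differentiable ℂ fun z => moved S M z i := by
  simp only [moved_eq_mulVec, Matrix.mulVec, dotProduct, Fintype.sum_sum_type, extVec_fst,
    extVec_mid, extVec_last, quad_apply, form_apply]
  fun_prop

theorem contDiff_moved (M : Matrix (Ext ι) (Ext ι) ℝ) (i : Ext ι) {n : WithTop ℕ∞} :
    ContDiff ℂ n fun z => moved S M z i := by
  simp only [moved_eq_mulVec, Matrix.mulVec, dotProduct, Fintype.sum_sum_type, extVec_fst,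
    extVec_mid, extVec_last, quad_apply, form_apply]
  fun_prop

theorem differentiableOn_slash (hS : S.IsSymm) (hΛ : IsLorentzian S) {p : ι → ℝ} (k : ℤ)
    {F : (ι → ℂ) → ℂ} (hF : DifferentiableOn ℂ F (upperHalf S p)) {M : Matrix (Ext ι) (Ext ι) ℝ}
    (hM : M ∈ orthGroup S) : DifferentiableOn ℂ (slash S k F M) (upperHalf S p) := by
  have hj : ∀ z ∈ upperHalf S p, autFactor S M z ≠ 0 := fun z hz =>
    autFactor_ne_zero hS hΛ (orthGroup_subset hM) (upperHalf_quad_pos hz)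
  have haut : DifferentiableOn ℂ (autFactor S M) (upperHalf S p) :=
    (differentiable_moved M _).differentiableOn
  refine DifferentiableOn.mul (haut.zpow (Or.inl hj)) (hF.comp ?_
    fun z hz => moebius_mem_upperHalf hS hΛ hM hz)
  exact differentiableOn_pi.2 fun i => (haut.inv hj).mul (differentiable_moved M _).differentiableOn

end Action

/-! ### Translations -/

section Translation

variable {ι : Type*} [Fintype ι] [DecidableEq ι] {S : Matrix ι ι ℤ}

/-- The translation by `x` as an element of the orthogonal group of `Λ ⊕ II_{1,1}`. -/
noncomputable def trans (S : Matrix ι ι ℤ) (x : ι → ℝ) : Matrix (Ext ι) (Ext ι) ℝ :=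
  Matrix.of fun
    | Sum.inl _, Sum.inl _ => 1
    | Sum.inl _, Sum.inr (Sum.inl j) => -form S ℝ x (Pi.single j 1)
    | Sum.inl _, Sum.inr (Sum.inr _) => -quad S ℝ x
    | Sum.inr (Sum.inl i), Sum.inr (Sum.inl j) => if i = j then 1 else 0
    | Sum.inr (Sum.inl i), Sum.inr (Sum.inr _) => x i
    | Sum.inr (Sum.inr _), Sum.inr (Sum.inr _) => 1
    | _, _ => 0

theorem trans_mulVec (x : ι → ℝ) (a c : ℝ) (z : ι → ℝ) :
    (trans S x).mulVec (extVec a z c) =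
      extVec (a - form S ℝ x z - quad S ℝ x * c) (z + c • x) c := by
  have hsum : form S ℝ x z = ∑ j, form S ℝ x (Pi.single j 1) * z j := by
    conv_lhs => rw [← Finset.univ_sum_single z]
    rw [map_sum]
    refine Finset.sum_congr rfl fun i _ => ?_
    rw [show (Pi.single i (z i) : ι → ℝ) = z i • Pi.single i 1 by
      rw [← Pi.single_smul, smul_eq_mul, mul_one], map_smul, smul_eq_mul, mul_comm]
  ext (_ | i | _)
  · simp [Matrix.mulVec, dotProduct, Fintype.sum_sum_type, trans, hsum]; ring
  · simp [Matrix.mulVec, dotProduct, Fintype.sum_sum_type, trans]; ring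
  · simp [Matrix.mulVec, dotProduct, Fintype.sum_sum_type, trans]

theorem trans_mem_orthSet (hS : S.IsSymm) (x : ι → ℝ) : trans S x ∈ orthSet S := by
  refine mem_orthSet_of_form fun Z W => ?_
  rw [← extVec_eta Z, ← extVec_eta W, trans_mulVec, trans_mulVec, form_extVec, form_extVec]
  simp only [map_add, map_smul, LinearMap.add_apply, LinearMap.smul_apply, smul_eq_mul, form_self]
  rw [form_comm hS _ x]; ring

theorem trans_zero : trans S 0 = 1 := by
  refine Matrix.ext_of_mulVec_single fun j => ?_
  rw [← extVec_eta (Pi.single j 1), trans_mulVec, Matrix.one_mulVec]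
  simp

theorem continuous_trans (x : ι → ℝ) : Continuous fun s : ℝ => trans S (s • x) := by
  refine continuous_matrix fun i j => ?_
  have hf : ∀ s : ℝ, form S ℝ (s • x) = s • form S ℝ x := fun s => map_smul _ _ _
  rcases i with _ | i | _ <;> rcases j with _ | j | _ <;> simp [trans, quad_smul, hf] <;> fun_prop

theorem trans_mulVec_complex (hS : S.IsSymm) (x : ι → ℝ) (z : ι → ℂ) :
    ((trans S x).map ((↑) : ℝ → ℂ)).mulVec (extVec (-quad S ℂ z) z 1) =
      extVec (-quad S ℂ (z + fun i => (x i : ℂ))) (z + fun i => (x i : ℂ)) 1 := by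
  have hsum : form S ℂ (fun i => (x i : ℂ)) z =
      ∑ j, ((form S ℝ x (Pi.single j 1) : ℝ) : ℂ) * z j := by
    conv_lhs => rw [← Finset.univ_sum_single z]
    rw [map_sum]
    refine Finset.sum_congr rfl fun i _ => ?_
    rw [show (Pi.single i (z i) : ι → ℂ) = z i • fun j => ((Pi.single i 1 : ι → ℝ) j : ℂ) by
      ext j; by_cases h : j = i
      · subst h; simp
      · simp [h], map_smul, form_ofReal, smul_eq_mul, mul_comm]
  ext (_ | i | _)
  · simp only [Matrix.mulVec, dotProduct, Fintype.sum_sum_type, trans, extVec_fst, quad_add hS,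
      quad_ofReal, form_comm hS z, hsum]
    simp
    ring
  · simp [Matrix.mulVec, dotProduct, Fintype.sum_sum_type, trans, apply_ite ((↑) : ℝ → ℂ)]
  · simp [Matrix.mulVec, dotProduct, Fintype.sum_sum_type, trans]

theorem moved_mul_trans (hS : S.IsSymm) (M : Matrix (Ext ι) (Ext ι) ℝ) (x : ι → ℝ) (z : ι → ℂ) :
    moved S (M * trans S x) z = moved S M (z + fun i => (x i : ℂ)) := by
  have : (M * trans S x).map ((↑) : ℝ → ℂ) =
      M.map ((↑) : ℝ → ℂ) * (trans S x).map ((↑) : ℝ → ℂ) := Matrix.map_mul (f := Complex.ofRealHom)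
  rw [moved_eq_mulVec, moved_eq_mulVec, this, ← Matrix.mulVec_mulVec, trans_mulVec_complex hS]

theorem slash_mul_trans (hS : S.IsSymm) (k : ℤ) (F : (ι → ℂ) → ℂ) (M : Matrix (Ext ι) (Ext ι) ℝ)
    (x : ι → ℝ) (z : ι → ℂ) :
    slash S k F (M * trans S x) z = slash S k F M (z + fun i => (x i : ℂ)) := by
  have h1 : autFactor S (M * trans S x) z = autFactor S M (z + fun i => (x i : ℂ)) := by
    rw [autFactor, moved_mul_trans hS]; rfl
  have h2 : moebius S (M * trans S x) z = moebius S M (z + fun i => (x i : ℂ)) := by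
    ext i; rw [moebius, h1, moved_mul_trans hS]; rfl
  rw [slash, h1, h2]; rfl

theorem det_extGram_ne_zero (hS : S.IsSymm) (hΛ : IsLorentzian S) :
    ((extGram S).map (Int.cast : ℤ → ℝ)).det ≠ 0 := by
  intro hd
  obtain ⟨v, hv, hv2⟩ := Matrix.exists_mulVec_eq_zero_iff.2 hd
  have h0 : ∀ w, form (extGram S) ℝ w v = 0 := fun w => by
    rw [form_eq_dotProduct, hv2, dotProduct_zero]
  apply hv
  rw [← extVec_eta v] at h0 ⊢
  have h1 := h0 (extVec 1 0 0)
  have h2 := h0 (extVec 0 0 1)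
  have h3 : (fun i => v (Sum.inr (Sum.inl i))) = 0 := by
    refine hΛ.eq_zero_of_form_eq_zero hS fun y => ?_
    have := h0 (extVec 0 y 0)
    rw [form_extVec] at this
    rw [form_comm hS]; simpa using this
  rw [form_extVec] at h1 h2
  simp at h1 h2
  rw [h1, h2, h3]
  ext (_ | _ | _) <;> rfl

/-- The inverse of an element of the orthogonal group. -/
noncomputable def orthInv (S : Matrix ι ι ℤ) (M : Matrix (Ext ι) (Ext ι) ℝ) :
    Matrix (Ext ι) (Ext ι) ℝ :=
  ((extGram S).map (Int.cast : ℤ → ℝ))⁻¹ * M.transpose * (extGram S).map (Int.cast : ℤ → ℝ)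

theorem orthInv_mul (hS : S.IsSymm) (hΛ : IsLorentzian S) {M : Matrix (Ext ι) (Ext ι) ℝ}
    (hM : M ∈ orthSet S) : orthInv S M * M = 1 := by
  rw [orthInv, Matrix.mul_assoc, Matrix.mul_assoc, ← Matrix.mul_assoc M.transpose, hM,
    Matrix.nonsing_inv_mul _ (Ne.isUnit (det_extGram_ne_zero hS hΛ))]

theorem mul_orthInv (hS : S.IsSymm) (hΛ : IsLorentzian S) {M : Matrix (Ext ι) (Ext ι) ℝ}
    (hM : M ∈ orthSet S) : M * orthInv S M = 1 :=
  mul_eq_one_comm.1 (orthInv_mul hS hΛ hM)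

theorem mul_mem_orthSet {M N : Matrix (Ext ι) (Ext ι) ℝ} (hM : M ∈ orthSet S) (hN : N ∈ orthSet S) :
    M * N ∈ orthSet S := by
  refine mem_orthSet_of_form fun Z W => ?_
  rw [← Matrix.mulVec_mulVec, ← Matrix.mulVec_mulVec, form_mulVec_of_orth hM,
    form_mulVec_of_orth hN]

theorem orthInv_mem_orthSet (hS : S.IsSymm) (hΛ : IsLorentzian S) {M : Matrix (Ext ι) (Ext ι) ℝ}
    (hM : M ∈ orthSet S) : orthInv S M ∈ orthSet S := by
  refine mem_orthSet_of_form fun Z W => ?_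
  rw [← form_mulVec_of_orth hM, Matrix.mulVec_mulVec, Matrix.mulVec_mulVec, mul_orthInv hS hΛ hM,
    Matrix.one_mulVec, Matrix.one_mulVec]

/-- The path `s ↦ M T_{s x} M⁻¹` starts at the identity and stays in the orthogonal group. -/
theorem conj_trans_mem_orthGroup (hS : S.IsSymm) (hΛ : IsLorentzian S)
    {M : Matrix (Ext ι) (Ext ι) ℝ} (hM : M ∈ orthSet S) (x : ι → ℝ) :
    M * trans S x * orthInv S M ∈ orthGroup S := by
  have hcont : Continuous fun s : ℝ => M * trans S (s • x) * orthInv S M :=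
    (continuous_const.matrix_mul (continuous_trans x)).matrix_mul continuous_const
  have hpre := (isPreconnected_univ (α := ℝ)).image _ hcont.continuousOn
  have := hpre.subset_connectedComponentIn (x := (1 : Matrix (Ext ι) (Ext ι) ℝ)) (F := orthSet S)
    ⟨0, trivial, by simp [trans_zero, mul_orthInv hS hΛ hM]⟩ (by
      rintro _ ⟨s, -, rfl⟩
      exact mul_mem_orthSet (mul_mem_orthSet hM (trans_mem_orthSet hS _))
        (orthInv_mem_orthSet hS hΛ hM))
  exact this ⟨1, trivial, by simp⟩

/-- Write `M T_x = (M T_x M⁻¹) M` and use the invariance of `F` under the first factor. -/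
theorem slash_add_of_conj_mem (hS : S.IsSymm) (hΛ : IsLorentzian S) {p : ι → ℝ} {k : ℤ}
    {F : (ι → ℂ) → ℂ} (hF : IsModularForm S p k F) {M : Matrix (Ext ι) (Ext ι) ℝ}
    (hM : M ∈ orthGroup S) {x : ι → ℝ} (hx : M * trans S x * orthInv S M ∈ modGroup S)
    {z : ι → ℂ} (hz : z ∈ upperHalf S p) :
    slash S k F M (z + fun i => (x i : ℂ)) = slash S k F M z := by
  have hM' := orthGroup_subset hM
  have hj := autFactor_ne_zero hS hΛ hM' (upperHalf_quad_pos hz)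
  have h1 : M * trans S x = M * trans S x * orthInv S M * M := by
    rw [Matrix.mul_assoc _ _ M, orthInv_mul hS hΛ hM', Matrix.mul_one]
  rw [← slash_mul_trans hS, h1, slash_mul k F _ M hM' hj]
  rw [slash, hF.invariant _ hx _ (moebius_mem_upperHalf hS hΛ hM hz)]
  rfl

theorem exists_common_denominator {α : Type*} [Fintype α] (q : α → ℚ) :
    ∃ d : ℕ, 0 < d ∧ ∀ i, ∃ n : ℤ, (d : ℚ) * q i = n := by
  classical
  refine ⟨∏ i, (q i).den, Finset.prod_pos fun i _ => (q i).pos, fun i => ?_⟩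
  refine ⟨(∏ j ∈ Finset.univ.erase i, ((q j).den : ℤ)) * (q i).num, ?_⟩
  rw [← Finset.mul_prod_erase _ _ (Finset.mem_univ i)]
  push_cast
  have := Rat.den_mul_eq_num (q i)
  linear_combination (∏ j ∈ Finset.univ.erase i, ((q j).den : ℚ)) * this

theorem IsEven.quad_intCast (hS : IsEven S) (x : ι → ℤ) :
    ∃ n : ℤ, quad S ℝ (fun i => (x i : ℝ)) = n := by
  obtain ⟨n, hn⟩ := hS.quad_int x
  refine ⟨n, ?_⟩
  have := congrArg (Int.cast : ℤ → ℝ) hn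
  push_cast at this
  rw [quad_apply, form_apply, this]; ring

theorem form_intCast_int (x y : ι → ℤ) :
    ∃ n : ℤ, form S ℝ (fun i => (x i : ℝ)) (fun i => (y i : ℝ)) = n :=
  ⟨_, form_intCast x y⟩

theorem dual_extGram {a c : ℝ} {y : ι → ℝ} (hY : extVec a y c ∈ dualLattice (extGram S)) :
    (∃ n : ℤ, a = n) ∧ (∃ n : ℤ, c = n) ∧
      ∀ x : ι → ℤ, ∃ n : ℤ, form S ℝ y (fun i => (x i : ℝ)) = n := by
  have key : ∀ (a' c' : ℤ) (x : ι → ℤ), ∃ n : ℤ,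
      form (extGram S) ℝ (extVec a y c) (extVec a' (fun i => (x i : ℝ)) c') = n := by
    intro a' c' x
    obtain ⟨n, hn⟩ := hY (Sum.elim (fun _ => a') (Sum.elim x fun _ => c'))
    refine ⟨n, hn ▸ ?_⟩
    congr 1
    ext (_ | _ | _) <;> rfl
  refine ⟨?_, ?_, fun x => ?_⟩
  · obtain ⟨n, hn⟩ := key 0 1 0
    rw [form_extVec] at hn
    exact ⟨n, by rw [← hn, form_apply]; simp⟩
  · obtain ⟨n, hn⟩ := key 1 0 0
    rw [form_extVec] at hn
    exact ⟨n, by rw [← hn, form_apply]; simp⟩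
  · obtain ⟨n, hn⟩ := key 0 0 x
    rw [form_extVec] at hn
    exact ⟨n, by rw [← hn]; simp⟩

/-- Translations by lattice vectors belong to the modular group. -/
theorem trans_mem_modGroup (hS : IsEven S) (hΛ : IsLorentzian S) (x : ι → ℤ) :
    1 * trans S (fun i => (x i : ℝ)) * orthInv S 1 ∈ modGroup S := by
  have h0 := conj_trans_mem_orthGroup hS.1 hΛ one_mem_orthSet (fun i => (x i : ℝ))
  refine ⟨h0, fun Y hY i => ?_⟩
  have h1 : orthInv S 1 = 1 := by
    have := orthInv_mul hS.1 hΛ (one_mem_orthSet (S := S)); rwa [Matrix.mul_one] at this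
  rw [h1, Matrix.mul_one, Matrix.one_mul]
  rw [← extVec_eta Y] at hY ⊢
  obtain ⟨-, ⟨c, hc⟩, hx⟩ := dual_extGram hY
  obtain ⟨n, hn⟩ := hx x
  obtain ⟨q, hq⟩ := hS.quad_intCast x
  rw [trans_mulVec, form_comm hS.1, hn, hq, hc]
  rcases i with _ | i | _
  · exact ⟨-n - q * c, by simp; ring⟩
  · exact ⟨c * x i, by simp⟩
  · exact ⟨0, by simp⟩

/-- For rational `M`, the conjugates by `M` of the translations by suitable multiples of lattice
vectors belong to the modular group. -/
theorem exists_conj_trans_mem_modGroup (hS : IsEven S) (hΛ : IsLorentzian S)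
    {M : Matrix (Ext ι) (Ext ι) ℝ} (hM : M ∈ ratOrthGroup S) :
    ∃ h : ℕ, 0 < h ∧ ∀ x : ι → ℤ,
      M * trans S (fun i => ((h : ℝ) * x i : ℝ)) * orthInv S M ∈ modGroup S := by
  obtain ⟨hM1, M₀, hM₀⟩ := hM
  have hM' := orthGroup_subset hM1
  set G := (extGram S).map (Int.cast : ℤ → ℝ) with hG
  set G₀ := (extGram S).map (Int.cast : ℤ → ℚ) with hG₀
  have hmap : G = G₀.map (Rat.castHom ℝ) := by ext; simp [hG, hG₀]
  have hdet₀ : G₀.det ≠ 0 := by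
    intro h
    apply det_extGram_ne_zero hS.1 hΛ
    have := (Rat.castHom ℝ).map_det G₀
    rw [h, map_zero] at this
    rw [← hG, hmap]; exact this.symm
  have hinv : G⁻¹ = (G₀⁻¹).map (Rat.castHom ℝ) := by
    refine Matrix.inv_eq_right_inv ?_
    rw [hmap, ← Matrix.map_mul, Matrix.mul_nonsing_inv _ (Ne.isUnit hdet₀)]
    exact Matrix.map_one _ (map_zero _) (map_one _)
  set N₀ := G₀⁻¹ * M₀.transpose with hN₀
  have hN : G⁻¹ * M.transpose = N₀.map (Rat.castHom ℝ) := by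
    rw [hN₀, Matrix.map_mul, ← hinv, hM₀]; rfl
  obtain ⟨d₁, hd₁, h₁⟩ := exists_common_denominator fun i : Ext ι × Ext ι => M₀ i.1 i.2
  obtain ⟨d₂, hd₂, h₂⟩ := exists_common_denominator fun i : Ext ι × Ext ι => N₀ i.1 i.2
  -- For a dual vector `Y` the vector `G Y` is integral and `M⁻¹ Y = (G⁻¹ Mᵀ)(G Y)`. So `d₂` clears
  -- the denominators of `v = M⁻¹ Y`, and `d₁` those of the final multiplication by `M`.
  refine ⟨d₁ * d₂, by positivity, fun x => ⟨conj_trans_mem_orthGroup hS.1 hΛ hM' _,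
    fun Y hY i => ?_⟩⟩
  choose m hm using h₁
  choose n hn using h₂
  have hM_int : ∀ i j, (d₁ : ℝ) * M i j = m (i, j) := fun i j => by
    rw [hM₀]; have := congrArg (Rat.cast : ℚ → ℝ) (hm (i, j)); push_cast at this; exact this
  have hN_int : ∀ i j, (d₂ : ℝ) * (G⁻¹ * M.transpose) i j = n (i, j) := fun i j => by
    rw [hN]; have := congrArg (Rat.cast : ℚ → ℝ) (hn (i, j)); push_cast at this; exact this
  have hGY : ∀ i, ∃ e : ℤ, G.mulVec Y i = e := by
    intro i
    obtain ⟨e, he⟩ := hY (Pi.single i 1)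
    refine ⟨e, ?_⟩
    rw [form_comm (extGram_isSymm hS.1), form_eq_dotProduct] at he
    rw [← he]
    simp only [← hG]
    rw [show (fun j => ((Pi.single i 1 : Ext ι → ℤ) j : ℝ)) = Pi.single i 1 by
      ext j; simp [Pi.single_apply], single_one_dotProduct]
  choose e he using hGY
  set v := (orthInv S M).mulVec Y with hv
  have hv_int : ∃ w : Ext ι → ℤ, ∀ i, (d₂ : ℝ) * v i = w i := by
    refine ⟨fun i => ∑ j, n (i, j) * e j, fun i => ?_⟩
    rw [hv, orthInv, ← Matrix.mulVec_mulVec]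
    simp only [← hG]
    rw [Matrix.mulVec, dotProduct, Finset.mul_sum]
    push_cast
    exact Finset.sum_congr rfl fun j _ => by rw [← hN_int, ← he]; ring
  obtain ⟨w, hw⟩ := hv_int
  have hMv : M.mulVec v = Y := by
    rw [hv, Matrix.mulVec_mulVec, mul_orthInv hS.1 hΛ hM', Matrix.one_mulVec]
  obtain ⟨q, hq⟩ := hS.quad_intCast x
  obtain ⟨f, hf⟩ := form_intCast_int (S := S) x fun i => w (Sum.inr (Sum.inl i))
  have hx : (fun i => (((d₁ * d₂ : ℕ) : ℝ) * x i : ℝ)) =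
      ((d₁ * d₂ : ℕ) : ℝ) • fun i => (x i : ℝ) := rfl
  -- Each entry of `T_{h x} v - v` carries a factor `h = d₁ d₂`; the `d₂` makes the entries of `v`
  -- integral and `d₁` is left over.
  have hdiff : ∃ u : Ext ι → ℤ, (trans S (fun i => (((d₁ * d₂ : ℕ) : ℝ) * x i : ℝ))).mulVec v - v =
      (d₁ : ℝ) • fun i => (u i : ℝ) := by
    refine ⟨Sum.elim (fun _ => -f - d₁ * d₂ * q * w (Sum.inr (Sum.inr ())))
      (Sum.elim (fun i => w (Sum.inr (Sum.inr ())) * x i) fun _ => 0), ?_⟩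
    have h1 : (fun i => (w (Sum.inr (Sum.inl i)) : ℝ)) =
        (d₂ : ℝ) • fun i => v (Sum.inr (Sum.inl i)) := by
      ext i; exact (hw _).symm
    rw [h1, map_smul, smul_eq_mul] at hf
    have h3 := hw (Sum.inr (Sum.inr ()))
    rw [← extVec_eta v, trans_mulVec, hx, map_smul, LinearMap.smul_apply, quad_smul, hq]
    ext (_ | i | _)
    · simp
      rw [← hf, ← h3]; ring
    · simp
      rw [← h3]; ring
    · simp
  obtain ⟨u, hu⟩ := hdiff
  refine ⟨∑ j, m (i, j) * u j, ?_⟩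
  have h1 : (M * trans S (fun i => (((d₁ * d₂ : ℕ) : ℝ) * x i : ℝ)) * orthInv S M).mulVec Y - Y =
      M.mulVec ((d₁ : ℝ) • fun i => (u i : ℝ)) := by
    rw [← hu, Matrix.mulVec_sub, hMv, ← Matrix.mulVec_mulVec, ← Matrix.mulVec_mulVec]
  have h2 := congrFun h1 i
  rw [Pi.sub_apply] at h2
  rw [h2, Matrix.mulVec, dotProduct]
  push_cast
  refine Finset.sum_congr rfl fun j _ => ?_
  rw [← hM_int, Pi.smul_apply, smul_eq_mul]; ring

end Translation

/-! ### Extension of isometries from a sublattice -/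

section Extension

variable {ι κ κ' : Type*} [Fintype ι] [DecidableEq ι] [Fintype κ] [DecidableEq κ] [Fintype κ']
  [DecidableEq κ'] {S : Matrix ι ι ℤ} {L : Submodule ℤ (ι → ℤ)} (b : Basis κ ℤ L)

/-- The matrix of the embedding `L ⊕ II_{1,1} → Λ ⊕ II_{1,1}`. -/
noncomputable def extBasis {L : Submodule ℤ (ι → ℤ)} (b : Basis κ ℤ L) :
    Matrix (Ext ι) (Ext κ) ℤ :=
  Matrix.of fun
    | Sum.inl _, Sum.inl _ => 1
    | Sum.inr (Sum.inl i), Sum.inr (Sum.inl j) => (b j : ι → ℤ) i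
    | Sum.inr (Sum.inr _), Sum.inr (Sum.inr _) => 1
    | _, _ => 0

theorem extBasis_mulVec {K : Type*} [Field K] (a c : K) (z : κ → K) :
    ((extBasis b).map (Int.cast : ℤ → K)).mulVec (extVec a z c) = extVec a (embed b z) c := by
  ext (_ | i | _)
  · simp [Matrix.mulVec, dotProduct, Fintype.sum_sum_type, extBasis]
  · simp [Matrix.mulVec, dotProduct, Fintype.sum_sum_type, extBasis, embed, mul_comm]
  · simp [Matrix.mulVec, dotProduct, Fintype.sum_sum_type, extBasis]

theorem form_extBasis {K : Type*} [Field K] (Z W : Ext κ → K) :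
    form (extGram S) K (((extBasis b).map (Int.cast : ℤ → K)).mulVec Z)
      (((extBasis b).map (Int.cast : ℤ → K)).mulVec W) = form (extGram (subGram S b)) K Z W := by
  rw [← extVec_eta Z, ← extVec_eta W, extBasis_mulVec, extBasis_mulVec, form_extVec, form_extVec,
    form_embed]

theorem transpose_extBasis_mul {K : Type*} [Field K] :
    ((extBasis b).map (Int.cast : ℤ → K)).transpose * (extGram S).map (Int.cast : ℤ → K) *
      (extBasis b).map (Int.cast : ℤ → K) = (extGram (subGram S b)).map (Int.cast : ℤ → K) := by
  refine Matrix.ext_of_mulVec_single fun j => funext fun i => ?_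
  have := form_extBasis (S := S) b (Pi.single i 1 : Ext κ → K) (Pi.single j 1)
  rw [form_eq_dotProduct, form_eq_dotProduct, mulVec_dotProduct_mulVec] at this
  simpa using this

/-- Coordinates of the orthogonal projection to `L ⊕ II_{1,1}`. -/
noncomputable def extProj (S : Matrix ι ι ℤ) {L : Submodule ℤ (ι → ℤ)} (b : Basis κ ℤ L) (K : Type*)
    [Field K] : Matrix (Ext κ) (Ext ι) K :=
  ((extGram (subGram S b)).map (Int.cast : ℤ → K))⁻¹ *
    ((extBasis b).map (Int.cast : ℤ → K)).transpose * (extGram S).map (Int.cast : ℤ → K)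

/-- The extension of an isometry of `L ⊕ II_{1,1}` by the identity on the orthogonal complement. -/
noncomputable def extend (S : Matrix ι ι ℤ) {L : Submodule ℤ (ι → ℤ)} (b : Basis κ ℤ L) {K : Type*}
    [Field K] (M : Matrix (Ext κ) (Ext κ) K) : Matrix (Ext ι) (Ext ι) K :=
  1 + (extBasis b).map (Int.cast : ℤ → K) * (M - 1) * extProj S b K

variable (hS : S.IsSymm) (hL : IsLorentzian (subGram S b))

include hS hL

theorem det_extGram_subGram (K : Type*) [Field K] [CharZero K] :
    ((extGram (subGram S b)).map (Int.cast : ℤ → K)).det ≠ 0 := by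
  have h1 := det_extGram_ne_zero (subGram_isSymm b hS) hL
  have h2 := (Int.castRingHom ℝ).map_det (extGram (subGram S b))
  have h3 := (Int.castRingHom K).map_det (extGram (subGram S b))
  have h4 : (extGram (subGram S b)).det ≠ 0 := by
    intro h; rw [h, map_zero] at h2; exact h1 h2.symm
  intro h
  apply h4
  have : (Int.castRingHom K) (extGram (subGram S b)).det = 0 := h3.trans h
  simpa using this

theorem extProj_mul_extBasis (K : Type*) [Field K] [CharZero K] :
    extProj S b K * (extBasis b).map (Int.cast : ℤ → K) = 1 := by
  rw [extProj, Matrix.mul_assoc, Matrix.mul_assoc, ← Matrix.mul_assoc _ _ ((extBasis b).map _),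
    transpose_extBasis_mul, Matrix.nonsing_inv_mul _ (Ne.isUnit (det_extGram_subGram b hS hL K))]

theorem extend_mul_extBasis {K : Type*} [Field K] [CharZero K] (M : Matrix (Ext κ) (Ext κ) K) :
    extend S b M * (extBasis b).map (Int.cast : ℤ → K) =
      (extBasis b).map (Int.cast : ℤ → K) * M := by
  rw [extend, Matrix.add_mul, Matrix.mul_assoc, extProj_mul_extBasis b hS hL, Matrix.mul_one,
    Matrix.one_mul, Matrix.mul_sub, Matrix.mul_one]
  abel

theorem transpose_extProj_mul (K : Type*) [Field K] [CharZero K] :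
    (extProj S b K).transpose * (extGram (subGram S b)).map (Int.cast : ℤ → K) =
      (extGram S).map (Int.cast : ℤ → K) * (extBasis b).map (Int.cast : ℤ → K) := by
  have h1 : ((extGram S).map (Int.cast : ℤ → K)).transpose = (extGram S).map (Int.cast : ℤ → K) := by
    rw [← Matrix.transpose_map, extGram_isSymm hS]
  have h2 : ((extGram (subGram S b)).map (Int.cast : ℤ → K)).transpose =
      (extGram (subGram S b)).map (Int.cast : ℤ → K) := by
    rw [← Matrix.transpose_map, extGram_isSymm (subGram_isSymm b hS)]
  rw [extProj, Matrix.transpose_mul, Matrix.transpose_mul, Matrix.transpose_transpose, h1,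
    Matrix.transpose_nonsing_inv, h2, Matrix.mul_assoc, Matrix.mul_assoc,
    Matrix.nonsing_inv_mul _ (Ne.isUnit (det_extGram_subGram b hS hL K)), Matrix.mul_one]

theorem extend_mem_orthSet {M : Matrix (Ext κ) (Ext κ) ℝ} (hM : M ∈ orthSet (subGram S b)) :
    extend S b M ∈ orthSet S := by
  set G := (extGram S).map (Int.cast : ℤ → ℝ) with hG
  set T := (extGram (subGram S b)).map (Int.cast : ℤ → ℝ) with hT
  set B := (extBasis b).map (Int.cast : ℤ → ℝ) with hB
  set R := extProj S b ℝ with hR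
  have h1 : R.transpose * T = G * B := transpose_extProj_mul b hS hL ℝ
  have hTt : T.transpose = T := by
    rw [hT, ← Matrix.transpose_map, extGram_isSymm (subGram_isSymm b hS)]
  have hGt : G.transpose = G := by
    rw [hG, ← Matrix.transpose_map, extGram_isSymm hS]
  have h2 : B.transpose * G = T * R := by
    have := congrArg Matrix.transpose h1
    rw [Matrix.transpose_mul, Matrix.transpose_mul, Matrix.transpose_transpose, hTt, hGt] at this
    exact this.symm
  have h3 : B.transpose * G * B = T := transpose_extBasis_mul b
  have hM' : M.transpose * T * M = T := hM
  change (extend S b M).transpose * G * extend S b M = G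
  -- With `B` the inclusion and `R` the projection, `Bᵀ G = T R` turns every correction term into
  -- the shape `Rᵀ (·) R`. Together they are `Rᵀ (Mᵀ T M - T) R`.
  have hexp : (extend S b M).transpose * G * extend S b M =
      G + (G * B) * (M - 1) * R + R.transpose * (M - 1).transpose * (B.transpose * G) +
        R.transpose * (M - 1).transpose * (B.transpose * G * B) * (M - 1) * R := by
    simp only [extend, ← hB, ← hR, Matrix.transpose_add, Matrix.transpose_one,
      Matrix.transpose_mul, Matrix.add_mul, Matrix.mul_add, Matrix.one_mul, Matrix.mul_one,
      Matrix.mul_assoc]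
    abel
  rw [hexp, h3, h2, ← h1]
  have : G + R.transpose * T * (M - 1) * R + R.transpose * (M - 1).transpose * (T * R) +
      R.transpose * (M - 1).transpose * T * (M - 1) * R =
      G + R.transpose * (M.transpose * T * M - T) * R := by
    simp only [Matrix.transpose_sub, Matrix.transpose_one, Matrix.mul_sub, Matrix.sub_mul,
      Matrix.mul_one, Matrix.mul_assoc]
    abel
  rw [this, hM', sub_self, Matrix.mul_zero, Matrix.zero_mul, add_zero]

theorem extend_mem_orthGroup {M : Matrix (Ext κ) (Ext κ) ℝ} (hM : M ∈ orthGroup (subGram S b)) :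
    extend S b M ∈ orthGroup S := by
  have hcont : Continuous fun M : Matrix (Ext κ) (Ext κ) ℝ => extend S b M := by
    unfold extend
    exact continuous_const.add ((continuous_const.matrix_mul
      (continuous_id.sub continuous_const)).matrix_mul continuous_const)
  have hpre := (isPreconnected_connectedComponentIn (x := (1 : Matrix (Ext κ) (Ext κ) ℝ))
    (F := orthSet (subGram S b))).image _ hcont.continuousOn
  exact hpre.subset_connectedComponentIn (x := (1 : Matrix (Ext ι) (Ext ι) ℝ)) (F := orthSet S)
    ⟨1, one_mem_orthGroup, by simp [extend]⟩ (by
      rintro _ ⟨N, hN, rfl⟩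
      exact extend_mem_orthSet b hS hL (orthGroup_subset hN)) ⟨M, hM, rfl⟩

theorem extend_mem_ratOrthGroup {M : Matrix (Ext κ) (Ext κ) ℝ}
    (hM : M ∈ ratOrthGroup (subGram S b)) : extend S b M ∈ ratOrthGroup S := by
  obtain ⟨hM1, M₀, hM₀⟩ := hM
  refine ⟨extend_mem_orthGroup b hS hL hM1, extend S b M₀, ?_⟩
  have hinv : ((extGram (subGram S b)).map (Int.cast : ℤ → ℝ))⁻¹ =
      (((extGram (subGram S b)).map (Int.cast : ℤ → ℚ))⁻¹).map (Rat.castHom ℝ) := by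
    refine Matrix.inv_eq_right_inv ?_
    have : (extGram (subGram S b)).map (Int.cast : ℤ → ℝ) =
        ((extGram (subGram S b)).map (Int.cast : ℤ → ℚ)).map (Rat.castHom ℝ) := by ext; simp
    rw [this, ← Matrix.map_mul,
      Matrix.mul_nonsing_inv _ (Ne.isUnit (det_extGram_subGram b hS hL ℚ))]
    exact Matrix.map_one _ (map_zero _) (map_one _)
  have hB : (extBasis b).map (Int.cast : ℤ → ℝ) =
      ((extBasis b).map (Int.cast : ℤ → ℚ)).map (Rat.castHom ℝ) := by ext; simp
  have hG : (extGram S).map (Int.cast : ℤ → ℝ) =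
      ((extGram S).map (Int.cast : ℤ → ℚ)).map (Rat.castHom ℝ) := by ext; simp
  have hR : extProj S b ℝ = (extProj S b ℚ).map (Rat.castHom ℝ) := by
    rw [extProj, extProj, Matrix.map_mul, Matrix.map_mul, ← hG, ← hinv, Matrix.transpose_map, ← hB]
  change extend S b M = (extend S b M₀).map (Rat.castHom ℝ)
  rw [extend, extend, Matrix.map_add _ (map_add _), Matrix.map_mul, Matrix.map_mul, ← hR, ← hB,
    Matrix.map_sub _ (map_sub _), Matrix.map_one _ (map_zero _) (map_one _),
    Matrix.map_one _ (map_zero _) (map_one _), hM₀]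
  rfl

/-- Projecting to `L ⊕ II_{1,1}` does not change pairings with vectors of that lattice, so a dual
vector `Y` projects to a dual vector `X`. The extension moves `Y` by the image of `M X - X`, which
is integral. -/
theorem extend_mem_modGroup {M : Matrix (Ext κ) (Ext κ) ℝ}
    (hM : M ∈ modGroup (subGram S b)) : extend S b M ∈ modGroup S := by
  refine ⟨extend_mem_orthGroup b hS hL hM.1, fun Y hY i => ?_⟩
  set X := (extProj S b ℝ).mulVec Y with hX
  have hdual : X ∈ dualLattice (extGram (subGram S b)) := by
    intro Z
    obtain ⟨n, hn⟩ := hY ((extBasis b).mulVec Z)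
    refine ⟨n, ?_⟩
    have hBZ : (fun i => (((extBasis b).mulVec Z i : ℤ) : ℝ)) =
        ((extBasis b).map (Int.cast : ℤ → ℝ)).mulVec (fun i => (Z i : ℝ)) := by
      ext i; simp [Matrix.mulVec, dotProduct]
    rw [hBZ, form_eq_dotProduct, ] at hn
    rw [← hn, form_eq_dotProduct, hX, Matrix.mulVec_mulVec, ← transpose_extProj_mul b hS hL,
      ← Matrix.mulVec_mulVec, Matrix.dotProduct_mulVec Y, Matrix.vecMul_transpose]
  obtain hM2 := hM.2 X hdual
  choose n hn using hM2
  refine ⟨(extBasis b).mulVec n i, ?_⟩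
  have h1 : (extend S b M).mulVec Y - Y =
      ((extBasis b).map (Int.cast : ℤ → ℝ)).mulVec (fun i => (n i : ℝ)) := by
    have : (fun i => (n i : ℝ)) = M.mulVec X - X := by ext i; rw [← hn]; rfl
    rw [this, extend, Matrix.add_mulVec, Matrix.one_mulVec, add_sub_cancel_left,
      ← Matrix.mulVec_mulVec, ← Matrix.mulVec_mulVec, Matrix.sub_mulVec, Matrix.one_mulVec]
  rw [← Pi.sub_apply, h1]
  simp [Matrix.mulVec, dotProduct]

theorem extend_map (M : Matrix (Ext κ) (Ext κ) ℝ) :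
    (extend S b M).map ((↑) : ℝ → ℂ) = extend S b (M.map ((↑) : ℝ → ℂ)) := by
  have hinv : ((extGram (subGram S b)).map (Int.cast : ℤ → ℂ))⁻¹ =
      (((extGram (subGram S b)).map (Int.cast : ℤ → ℝ))⁻¹).map Complex.ofRealHom := by
    refine Matrix.inv_eq_right_inv ?_
    have : (extGram (subGram S b)).map (Int.cast : ℤ → ℂ) =
        ((extGram (subGram S b)).map (Int.cast : ℤ → ℝ)).map Complex.ofRealHom := by ext; simp
    rw [this, ← Matrix.map_mul,
      Matrix.mul_nonsing_inv _ (Ne.isUnit (det_extGram_subGram b hS hL ℝ))]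
    exact Matrix.map_one _ (map_zero _) (map_one _)
  have hB : (extBasis b).map (Int.cast : ℤ → ℂ) =
      ((extBasis b).map (Int.cast : ℤ → ℝ)).map Complex.ofRealHom := by ext; simp
  have hG : (extGram S).map (Int.cast : ℤ → ℂ) =
      ((extGram S).map (Int.cast : ℤ → ℝ)).map Complex.ofRealHom := by ext; simp
  have hR : extProj S b ℂ = (extProj S b ℝ).map Complex.ofRealHom := by
    rw [extProj, extProj, Matrix.map_mul, Matrix.map_mul, ← hG, ← hinv, Matrix.transpose_map, ← hB]
  change (extend S b M).map Complex.ofRealHom = extend S b (M.map Complex.ofRealHom)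
  rw [extend, extend, Matrix.map_add _ (map_add _), Matrix.map_mul, Matrix.map_mul, ← hR, ← hB,
    Matrix.map_sub _ (map_sub _), Matrix.map_one _ (map_zero _) (map_one _),
    Matrix.map_one _ (map_zero _) (map_one _)]

theorem moved_extend (M : Matrix (Ext κ) (Ext κ) ℝ) (z : κ → ℂ) :
    moved S (extend S b M) (embed b z) =
      ((extBasis b).map (Int.cast : ℤ → ℂ)).mulVec (moved (subGram S b) M z) := by
  rw [moved_eq_mulVec, moved_eq_mulVec, quad_embed, ← extBasis_mulVec, Matrix.mulVec_mulVec,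
    extend_map b hS hL, extend_mul_extBasis b hS hL, Matrix.mulVec_mulVec]

theorem autFactor_extend (M : Matrix (Ext κ) (Ext κ) ℝ) (z : κ → ℂ) :
    autFactor S (extend S b M) (embed b z) = autFactor (subGram S b) M z := by
  rw [autFactor, moved_extend b hS hL, moved_eq_extVec, extBasis_mulVec, extVec_last]

theorem moebius_extend (M : Matrix (Ext κ) (Ext κ) ℝ) (z : κ → ℂ) :
    moebius S (extend S b M) (embed b z) = embed b (moebius (subGram S b) M z) := by
  have : moebius (subGram S b) M z = (autFactor (subGram S b) M z)⁻¹ •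
      fun i => moved (subGram S b) M z (Sum.inr (Sum.inl i)) := rfl
  rw [this, embed_smul]
  ext i
  rw [moebius, autFactor_extend b hS hL, moved_extend b hS hL, moved_eq_extVec, extBasis_mulVec,
    extVec_mid]
  rfl

/-- Normal vectors are killed by the projection. Hence the arguments `v₁, …, v_N` are not
transformed by `M`, and the pullback is scalar-valued for fixed arguments. -/
theorem extend_mulVec_of_orth {K : Type*} [Field K] [CharZero K] (M : Matrix (Ext κ) (Ext κ) K)
    {w : ι → K} (hw : ∀ z : κ → K, form S K (embed b z) w = 0) :
    (extend S b M).mulVec (extVec 0 w 0) = extVec 0 w 0 := by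
  have h0 : (((extBasis b).map (Int.cast : ℤ → K)).transpose).mulVec
      (((extGram S).map (Int.cast : ℤ → K)).mulVec (extVec 0 w 0)) = 0 := by
    ext j
    have h1 : form (extGram S) K (((extBasis b).map (Int.cast : ℤ → K)).mulVec (Pi.single j 1))
        (extVec 0 w 0) = 0 := by
      rw [← extVec_eta (Pi.single j 1), extBasis_mulVec, form_extVec, hw]; simp
    rw [form_eq_dotProduct, ← Matrix.vecMul_transpose, ← Matrix.dotProduct_mulVec,
      single_one_dotProduct] at h1
    exact h1
  rw [extend, Matrix.add_mulVec, Matrix.one_mulVec, ← Matrix.mulVec_mulVec, extProj,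
    ← Matrix.mulVec_mulVec, ← Matrix.mulVec_mulVec, ← Matrix.mulVec_mulVec, h0, Matrix.mulVec_zero,
    Matrix.mulVec_zero, Matrix.mulVec_zero, add_zero]

end Extension

/-! ### Fourier series on tube domains -/

section Torus

open MeasureTheory UnitAddTorus

variable {ι : Type*} [Fintype ι]

/-- The projection of a vector to the torus. -/
def toTorus (x : ι → ℝ) : UnitAddTorus ι := fun i => (x i : UnitAddCircle)

theorem isOpenQuotientMap_toTorus : IsOpenQuotientMap (toTorus : (ι → ℝ) → UnitAddTorus ι) :=
  IsOpenQuotientMap.piMap fun _ => QuotientAddGroup.isOpenQuotientMap_mk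

theorem toTorus_add (x y : ι → ℝ) : toTorus (x + y) = toTorus x + toTorus y := rfl

theorem exists_int_of_toTorus_eq {x y : ι → ℝ} (h : toTorus x = toTorus y) :
    ∃ n : ι → ℤ, y = x + fun i => (n i : ℝ) := by
  have : ∀ i, ∃ n : ℤ, y i = x i + n := by
    intro i
    have h1 := congrFun h i
    simp only [toTorus] at h1
    rw [← sub_eq_zero, ← AddCircle.coe_sub, AddCircle.coe_eq_zero_iff] at h1
    obtain ⟨n, hn⟩ := h1
    refine ⟨-n, ?_⟩
    simp only [zsmul_eq_mul, mul_one] at hn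
    push_cast; linarith
  choose n hn using this
  exact ⟨n, funext hn⟩

/-- A continuous periodic function descends to the torus. -/
theorem exists_lift_torus {φ : (ι → ℝ) → ℂ} (hc : Continuous φ)
    (hp : ∀ (x : ι → ℝ) (n : ι → ℤ), φ (x + fun i => (n i : ℝ)) = φ x) :
    ∃ g : C(UnitAddTorus ι, ℂ), ∀ x, g (toTorus x) = φ x := by
  have hq : IsQuotientMap (⟨toTorus, isOpenQuotientMap_toTorus.continuous⟩ :
      C(ι → ℝ, UnitAddTorus ι)) := isOpenQuotientMap_toTorus.isQuotientMap
  have hfac : Function.FactorsThrough (⟨φ, hc⟩ : C(ι → ℝ, ℂ))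
      (⟨toTorus, isOpenQuotientMap_toTorus.continuous⟩ : C(ι → ℝ, UnitAddTorus ι)) := by
    intro x y h
    obtain ⟨n, rfl⟩ := exists_int_of_toTorus_eq h
    exact (hp x n).symm
  exact ⟨hq.lift ⟨φ, hc⟩ hfac,
    fun x => congrFun (congrArg DFunLike.coe (hq.lift_comp ⟨φ, hc⟩ hfac)) x⟩

theorem mFourier_toTorus (n : ι → ℤ) (x : ι → ℝ) :
    mFourier n (toTorus x) = Complex.exp (2 * Real.pi * Complex.I * ∑ i, (n i : ℂ) * x i) := by
  simp only [mFourier, ContinuousMap.coe_mk, toTorus, fourier_coe_apply]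
  rw [← Complex.exp_sum, Finset.mul_sum]
  congr 1
  refine Finset.sum_congr rfl fun i _ => ?_
  push_cast; ring

/-- The Haar probability measure of the torus. -/
noncomputable abbrev torusMeasure (ι : Type*) [Fintype ι] : Measure (UnitAddTorus ι) :=
  Measure.pi fun _ => AddCircle.haarAddCircle

open Classical in
theorem integral_mFourier (n : ι → ℤ) :
    ∫ θ, mFourier n θ ∂torusMeasure ι = if n = 0 then 1 else 0 := by
  have := (orthonormal_iff_ite.1 (orthonormal_mFourier (d := ι))) 0 n
  simp only [ContinuousMap.inner_toLp, ← mFourier_neg, ← mFourier_add] at this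
  simp only [neg_zero, add_zero, eq_comm (a := (0 : ι → ℤ))] at this
  exact this

theorem norm_mFourier_apply (n : ι → ℤ) (θ : UnitAddTorus ι) : ‖mFourier n θ‖ = 1 := by
  simp [mFourier, norm_prod, Circle.norm_coe, fourier_apply]

/-- Fourier coefficients of an absolutely convergent Fourier series. -/
theorem norm_coeff_le_of_hasSum {I : Type*} {m : I → ι → ℤ} (hm : Function.Injective m)
    {c : I → ℂ} (hc : Summable fun i => ‖c i‖) {φ : (ι → ℝ) → ℂ} {C : ℝ}
    (hφ : ∀ x, HasSum
      (fun i => c i * Complex.exp (2 * Real.pi * Complex.I * ∑ j, (m i j : ℂ) * x j)) (φ x))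
    (hb : ∀ x, ‖φ x‖ ≤ C) (i : I) : ‖c i‖ ≤ C := by
  classical
  have := hm.countable
  have hsum : Summable fun i => c i • (mFourier (m i) : C(UnitAddTorus ι, ℂ)) := by
    refine Summable.of_norm ?_
    simpa only [norm_smul, mFourier_norm, mul_one] using hc
  obtain ⟨g, hg⟩ := hsum
  have hgx : ∀ x, g (toTorus x) = φ x := by
    intro x
    have h1 := (ContinuousMap.evalCLM ℂ (toTorus x)).hasSum hg
    have h2 : HasSum (fun i => c i • mFourier (m i) (toTorus x)) (g (toTorus x)) := by
      simpa only [map_smul] using! h1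
    refine h2.unique ?_
    simpa only [mFourier_toTorus, smul_eq_mul] using hφ x
  have hgb : ∀ θ, ‖g θ‖ ≤ C := by
    intro θ
    obtain ⟨x, rfl⟩ := isOpenQuotientMap_toTorus.surjective θ
    rw [hgx]; exact hb x
  have hgs : ∀ θ, HasSum (fun k => c k * mFourier (m k) θ) (g θ) := by
    intro θ
    have h1 := (ContinuousMap.evalCLM ℂ θ).hasSum hg
    simpa only [map_smul] using! h1
  -- Integrating against the conjugate character isolates one coefficient, and the mean of a
  -- function bounded by `C` is bounded by `C`.
  have hint := hasSum_integral_of_summable_integral_norm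
    (F := fun k (θ : UnitAddTorus ι) => mFourier (-m i) θ * (c k * mFourier (m k) θ))
    (μ := torusMeasure ι) (fun k => by
      refine Continuous.integrable_of_hasCompactSupport (by fun_prop) ?_
      exact HasCompactSupport.of_compactSpace _) (by
      simp only [norm_mul, norm_mFourier_apply, mul_one, one_mul]
      simpa using hc)
  have hval : ∀ k, ∫ θ, mFourier (-m i) θ * (c k * mFourier (m k) θ) ∂torusMeasure ι =
      if k = i then c i else 0 := by
    intro k
    have : ∀ θ : UnitAddTorus ι, mFourier (-m i) θ * (c k * mFourier (m k) θ) =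
        c k * mFourier (-m i + m k) θ := fun θ => by rw [mFourier_add]; ring
    simp only [this]
    rw [integral_const_mul, integral_mFourier]
    by_cases h : k = i
    · subst h; simp
    · have : -m i + m k ≠ 0 := fun h0 => h (hm (by
        rw [neg_add_eq_zero] at h0; exact h0.symm))
      simp [h, this]
  simp only [hval] at hint
  have h3 : c i = ∫ θ, mFourier (-m i) θ * g θ ∂torusMeasure ι := by
    refine (hasSum_ite_eq i (c i)).unique hint |>.trans ?_
    congr 1
    ext θ
    rw [tsum_mul_left, (hgs θ).tsum_eq]
  rw [h3]
  refine (norm_integral_le_of_norm_le_const (C := C) (ae_of_all _ fun θ => ?_)).trans ?_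
  · rw [norm_mul, norm_mFourier_apply, one_mul]; exact hgb θ
  · simp

theorem summable_exp_neg_sum_abs {r : ℝ} (hr : 0 < r) :
    Summable fun n : ι → ℤ => Real.exp (-r * ∑ i, |(n i : ℝ)|) := by
  classical
  have h1 : Summable fun n : ℤ => Real.exp (-r * |(n : ℝ)|) := by
    have h2 : Summable fun n : ℕ => Real.exp (-r * n) := by
      simpa [mul_comm] using Real.summable_exp_nat_mul_iff.2 (neg_lt_zero.2 hr)
    refine Summable.of_nat_of_neg ?_ ?_
    · simpa using h2
    · simpa using h2
  refine summable_of_sum_le (c := ∏ _i : ι, ∑' n : ℤ, Real.exp (-r * |(n : ℝ)|))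
    (fun n => (Real.exp_pos _).le) fun u => ?_
  -- Every finite index set lies in a box, on which the sum factors into one-dimensional sums.
  set t : ι → Finset ℤ := fun i => u.image fun n => n i with ht
  have hsub : u ⊆ Fintype.piFinset t := fun n hn => Fintype.mem_piFinset.2 fun i =>
    Finset.mem_image_of_mem _ hn
  calc ∑ n ∈ u, Real.exp (-r * ∑ i, |(n i : ℝ)|)
      ≤ ∑ n ∈ Fintype.piFinset t, Real.exp (-r * ∑ i, |(n i : ℝ)|) :=
        Finset.sum_le_sum_of_subset_of_nonneg hsub fun _ _ _ => (Real.exp_pos _).le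
    _ = ∑ n ∈ Fintype.piFinset t, ∏ i, Real.exp (-r * |(n i : ℝ)|) := by
        refine Finset.sum_congr rfl fun n _ => ?_
        rw [← Real.exp_sum, Finset.mul_sum]
    _ = ∏ i, ∑ n ∈ t i, Real.exp (-r * |(n : ℝ)|) :=
        (Finset.prod_univ_sum t fun _ n => Real.exp (-r * |(n : ℝ)|)).symm
    _ ≤ _ := Finset.prod_le_prod (fun i _ => Finset.sum_nonneg fun _ _ => (Real.exp_pos _).le)
        fun i _ => h1.sum_le_tsum _ fun _ _ => (Real.exp_pos _).le

/-- The tube domain over a set of real vectors. -/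
def tube (P : Set (ι → ℝ)) : Set (ι → ℂ) := {z | (fun i => (z i).im) ∈ P}

/-- The point `x + i y`. -/
def cplx (x y : ι → ℝ) : ι → ℂ := fun i => (x i : ℂ) + Complex.I * y i

theorem cplx_im (x y : ι → ℝ) : (fun i => (cplx x y i).im) = y := by
  ext i; simp [cplx]

theorem cplx_re_im (z : ι → ℂ) : cplx (fun i => (z i).re) (fun i => (z i).im) = z := by
  ext i
  rw [cplx, mul_comm]; exact Complex.re_add_im (z i)

theorem cplx_mem_tube {P : Set (ι → ℝ)} (x : ι → ℝ) {y : ι → ℝ} (hy : y ∈ P) :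
    cplx x y ∈ tube P := by
  rw [tube, Set.mem_ofPred_eq, cplx_im]; exact hy

theorem continuous_cplx : Continuous fun q : (ι → ℝ) × (ι → ℝ) => cplx q.1 q.2 := by
  unfold cplx; fun_prop

theorem cplx_add_int (x y : ι → ℝ) (n : ι → ℤ) :
    cplx (x + fun i => (n i : ℝ)) y = cplx x y + fun i => (n i : ℂ) := by
  ext i; simp [cplx]; ring

variable {P : Set (ι → ℝ)} {f : (ι → ℂ) → ℂ}

/-- Periodicity moves the real part into the unit cube, which leaves a compact set. -/
theorem exists_bound_of_periodic (hf : ContinuousOn f (tube P))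
    (hp : ∀ z ∈ tube P, ∀ n : ι → ℤ, f (z + fun i => (n i : ℂ)) = f z) {C : Set (ι → ℝ)}
    (hC : IsCompact C) (hCP : C ⊆ P) : ∃ K, ∀ x, ∀ y ∈ C, ‖f (cplx x y)‖ ≤ K := by
  have hcomp : IsCompact ((Set.Icc (0 : ι → ℝ) 1) ×ˢ C) := isCompact_Icc.prod hC
  obtain ⟨K, hK⟩ := hcomp.exists_bound_of_continuousOn
    (f := fun q : (ι → ℝ) × (ι → ℝ) => f (cplx q.1 q.2))
    (hf.comp continuous_cplx.continuousOn fun q hq => cplx_mem_tube _ (hCP hq.2))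
  refine ⟨K, fun x y hy => ?_⟩
  have h1 : cplx x y = cplx (fun i => Int.fract (x i)) y + fun i => ((⌊x i⌋ : ℤ) : ℂ) := by
    rw [← cplx_add_int]
    congr 1
    ext i
    exact (Int.fract_add_floor (x i)).symm
  rw [h1, hp _ (cplx_mem_tube _ (hCP hy))]
  exact hK (_, y) ⟨⟨fun i => Int.fract_nonneg _, fun i => (Int.fract_lt_one _).le⟩, hy⟩

theorem exists_lift_of_periodic (hf : ContinuousOn f (tube P))
    (hp : ∀ z ∈ tube P, ∀ n : ι → ℤ, f (z + fun i => (n i : ℂ)) = f z) {y : ι → ℝ} (hy : y ∈ P) :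
    ∃ g : C(UnitAddTorus ι, ℂ), ∀ x, g (toTorus x) = f (cplx x y) := by
  refine exists_lift_torus ?_ fun x n => ?_
  · exact hf.comp_continuous (continuous_cplx.comp (by fun_prop : Continuous fun x => (x, y)))
      fun x => cplx_mem_tube x hy
  · rw [cplx_add_int, hp _ (cplx_mem_tube x hy)]

/-- The mean of a periodic function over a line segment averages to its mean over the torus. -/
theorem integral_interval_average (g : C(UnitAddTorus ι, ℂ)) (w : ι → ℝ) {R : ℝ} (hR : 0 ≤ R) :
    ∫ θ, (∫ s in (0 : ℝ)..R, g (θ + toTorus (s • w))) ∂torusMeasure ι =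
      R • ∫ θ, g θ ∂torusMeasure ι := by
  have hcont : Continuous (Function.uncurry fun (θ : UnitAddTorus ι) (s : ℝ) =>
      g (θ + toTorus (s • w))) := by
    have : Continuous (toTorus : (ι → ℝ) → UnitAddTorus ι) := isOpenQuotientMap_toTorus.continuous
    unfold Function.uncurry
    fun_prop
  simp only [intervalIntegral.integral_of_le hR]
  rw [MeasureTheory.integral_integral_swap]
  · have : ∀ s : ℝ, ∫ θ, g (θ + toTorus (s • w)) ∂torusMeasure ι = ∫ θ, g θ ∂torusMeasure ι :=
      fun s => integral_add_right_eq_self (fun θ => g θ) _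
    simp only [this]
    simp [hR]
  · refine Integrable.of_bound hcont.aestronglyMeasurable ‖g‖ (ae_of_all _ fun q => ?_)
    exact g.norm_coe_le_norm _

/-- The mean value over the real directions of a periodic holomorphic function is constant. -/
theorem integral_lift_eq (hP : Convex ℝ P) (hf : DifferentiableOn ℂ f (tube P)) (hPo : IsOpen P)
    (hp : ∀ z ∈ tube P, ∀ n : ι → ℤ, f (z + fun i => (n i : ℂ)) = f z) {y y' : ι → ℝ}
    (hy : y ∈ P) (hy' : y' ∈ P) {g g' : C(UnitAddTorus ι, ℂ)}
    (hg : ∀ x, g (toTorus x) = f (cplx x y)) (hg' : ∀ x, g' (toTorus x) = f (cplx x y')) :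
    ∫ θ, g θ ∂torusMeasure ι = ∫ θ, g' θ ∂torusMeasure ι := by
  have hseg : segment ℝ y y' ⊆ P := hP.segment_subset hy hy'
  obtain ⟨K, hK⟩ := exists_bound_of_periodic hf.continuousOn hp
    (C := segment ℝ y y') (by rw [segment_eq_image_lineMap]; exact isCompact_Icc.image (by fun_prop))
    hseg
  set w := y' - y with hw
  have hmem : ∀ τ ∈ Set.Icc (0 : ℝ) 1, y + τ • w ∈ segment ℝ y y' := by
    intro τ hτ
    rw [segment_eq_image']
    exact ⟨τ, hτ, rfl⟩
  have hopen : IsOpen (tube P) := hPo.preimage (by fun_prop)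
  -- Cauchy's theorem on the rectangle with corners `0` and `R + i` in the complex line through `w`.
  -- The horizontal sides are integrals of length `R`; the vertical sides stay over the compact
  -- segment and are bounded by `K`, whatever `R` is.
  have key : ∀ R : ℝ, 0 ≤ R → ∀ θ : UnitAddTorus ι,
      ‖(∫ s in (0 : ℝ)..R, g (θ + toTorus (s • w))) -
        ∫ s in (0 : ℝ)..R, g' (θ + toTorus (s • w))‖ ≤ 2 * K := by
    intro R hR θ
    obtain ⟨x, rfl⟩ := isOpenQuotientMap_toTorus.surjective θ
    simp only [← toTorus_add, hg, hg']
    set H : ℂ → ℂ := fun ζ => f (cplx x y + ζ • fun i => (w i : ℂ)) with hH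
    have hpt : ∀ s τ : ℝ, cplx x y + ((s : ℂ) + τ * Complex.I) • (fun i => (w i : ℂ)) =
        cplx (x + s • w) (y + τ • w) := by
      intro s τ
      ext i
      simp [cplx]; ring
    have hHd : DifferentiableOn ℂ H
        (Set.uIcc (0 : ℂ).re ((R : ℂ) + Complex.I).re ×ℂ
          Set.uIcc (0 : ℂ).im ((R : ℂ) + Complex.I).im) := by
      refine hf.comp (by fun_prop) fun ζ hζ => ?_
      rw [Complex.mem_reProdIm] at hζ
      have h2 := hζ.2
      simp only [Complex.zero_im, Complex.add_im, Complex.ofReal_im, Complex.I_im, zero_add,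
        Set.uIcc_of_le zero_le_one] at h2
      have := hpt ζ.re ζ.im
      rw [Complex.re_add_im] at this
      rw [this]
      exact cplx_mem_tube _ (hseg (hmem _ h2))
    have hrect := Complex.integral_boundary_rect_eq_zero_of_differentiableOn H 0
      ((R : ℂ) + Complex.I) hHd
    simp only [Complex.zero_re, Complex.zero_im, Complex.add_re, Complex.ofReal_re, Complex.I_re,
      add_zero, Complex.add_im, Complex.ofReal_im, Complex.I_im, zero_add, Complex.ofReal_zero,
      zero_mul, Complex.ofReal_one, one_mul] at hrect
    have hH0 : ∀ s : ℝ, H (s : ℂ) = f (cplx (x + s • w) y) := by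
      intro s
      have := hpt s 0
      simp only [Complex.ofReal_zero, zero_mul, add_zero, zero_smul] at this
      rw [hH]; simp only [this]
    have hH1 : ∀ s : ℝ, H ((s : ℂ) + Complex.I) = f (cplx (x + s • w) y') := by
      intro s
      have := hpt s 1
      simp only [Complex.ofReal_one, one_mul, one_smul, hw, add_sub_cancel] at this
      rw [hH]; simp only [hw, this]
    simp only [hH0, hH1] at hrect
    have hb : ∀ s : ℝ, ‖∫ τ in (0 : ℝ)..1, H ((s : ℂ) + τ * Complex.I)‖ ≤ K := by
      intro s
      have := intervalIntegral.norm_integral_le_of_norm_le_const (a := (0 : ℝ)) (b := 1) (C := K)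
        (f := fun τ : ℝ => H ((s : ℂ) + τ * Complex.I)) (by
          intro τ hτ
          rw [Set.uIoc_of_le zero_le_one] at hτ
          simp only [hH, hpt]
          exact hK _ _ (hmem τ ⟨hτ.1.le, hτ.2⟩))
      simpa using this
    have h1 := hb R
    have h2 := hb 0
    simp only [Complex.ofReal_zero, zero_add] at h2
    have h3 : (∫ s in (0 : ℝ)..R, f (cplx (x + s • w) y)) -
        ∫ s in (0 : ℝ)..R, f (cplx (x + s • w) y') =
        Complex.I • (∫ τ in (0 : ℝ)..1, H (τ * Complex.I)) -
          Complex.I • ∫ τ in (0 : ℝ)..1, H ((R : ℂ) + τ * Complex.I) := by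
      linear_combination hrect
    rw [h3]
    refine (norm_sub_le _ _).trans ?_
    rw [norm_smul, norm_smul, Complex.norm_I, one_mul, one_mul]
    linarith
  have hint : ∀ (G : C(UnitAddTorus ι, ℂ)) (R : ℝ), Integrable
      (fun θ => ∫ s in (0 : ℝ)..R, G (θ + toTorus (s • w))) (torusMeasure ι) := by
    intro G R
    have hcont : Continuous fun θ : UnitAddTorus ι => ∫ s in (0 : ℝ)..R, G (θ + toTorus (s • w)) := by
      refine intervalIntegral.continuous_parametric_intervalIntegral_of_continuous' ?_ 0 R
      have : Continuous (toTorus : (ι → ℝ) → UnitAddTorus ι) := isOpenQuotientMap_toTorus.continuous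
      unfold Function.uncurry
      fun_prop
    exact hcont.integrable_of_hasCompactSupport (HasCompactSupport.of_compactSpace _)
  -- Averaging over the torus replaces a line integral of length `R` by `R` times the mean. A
  -- difference of means bounded by `2 K / R` for every `R` is zero, without any rationality of the
  -- direction `w`.
  have hbound : ∀ R : ℝ, 0 ≤ R →
      R * ‖(∫ θ, g θ ∂torusMeasure ι) - ∫ θ, g' θ ∂torusMeasure ι‖ ≤ 2 * K := by
    intro R hR
    have h1 : R * ‖(∫ θ, g θ ∂torusMeasure ι) - ∫ θ, g' θ ∂torusMeasure ι‖ =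
        ‖∫ θ, ((∫ s in (0 : ℝ)..R, g (θ + toTorus (s • w))) -
          ∫ s in (0 : ℝ)..R, g' (θ + toTorus (s • w))) ∂torusMeasure ι‖ := by
      rw [integral_sub (hint g R) (hint g' R), integral_interval_average g w hR,
        integral_interval_average g' w hR, ← smul_sub, norm_smul, Real.norm_of_nonneg hR]
    rw [h1]
    refine (norm_integral_le_of_norm_le_const (ae_of_all _ (key R hR))).trans ?_
    simp
  by_contra hne
  have hpos : 0 < ‖(∫ θ, g θ ∂torusMeasure ι) - ∫ θ, g' θ ∂torusMeasure ι‖ :=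
    norm_pos_iff.2 (sub_ne_zero.2 hne)
  have hK0 : 0 ≤ 2 * K := by simpa using hbound 0 le_rfl
  have := hbound ((2 * K + 1) / ‖(∫ θ, g θ ∂torusMeasure ι) - ∫ θ, g' θ ∂torusMeasure ι‖)
    (by positivity)
  rw [div_mul_cancel₀ _ hpos.ne'] at this
  linarith

/-- A holomorphic function on a tube domain that is periodic with respect to the integral vectors
has an absolutely convergent Fourier expansion. -/
theorem exists_fourier_expansion (hP : Convex ℝ P) (hPo : IsOpen P) (hPn : P.Nonempty)
    (hf : DifferentiableOn ℂ f (tube P))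
    (hp : ∀ z ∈ tube P, ∀ n : ι → ℤ, f (z + fun i => (n i : ℂ)) = f z) :
    ∃ a : (ι → ℤ) → ℂ, ∀ z ∈ tube P,
      HasSum (fun n => a n * Complex.exp (2 * Real.pi * Complex.I * ∑ i, (n i : ℂ) * z i)) (f z) := by
  have hlift := fun (y : P) => exists_lift_of_periodic hf.continuousOn hp y.2
  choose g hg using hlift
  -- Each side is the mean over the real directions of the periodic holomorphic function
  -- `e^{-2πi⟨n,z⟩} f(z)`, hence does not depend on the height.
  have hcoef : ∀ (y y' : P) (n : ι → ℤ),
      mFourierCoeff (g y) n * Complex.exp (2 * Real.pi * ∑ i, (n i : ℂ) * (y : ι → ℝ) i) =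
      mFourierCoeff (g y') n * Complex.exp (2 * Real.pi * ∑ i, (n i : ℂ) * (y' : ι → ℝ) i) := by
    intro y y' n
    set G : (ι → ℂ) → ℂ := fun z =>
      Complex.exp (-(2 * Real.pi * Complex.I * ∑ i, (n i : ℂ) * z i)) * f z with hG
    have hGd : DifferentiableOn ℂ G (tube P) := by
      refine DifferentiableOn.mul ?_ hf
      fun_prop
    have hGp : ∀ z ∈ tube P, ∀ m : ι → ℤ, G (z + fun i => (m i : ℂ)) = G z := by
      intro z hz m
      have h1 : -(2 * Real.pi * Complex.I * ∑ i, (n i : ℂ) * (z + fun i => (m i : ℂ)) i) =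
          -(2 * Real.pi * Complex.I * ∑ i, (n i : ℂ) * z i) +
            ((-∑ i, n i * m i : ℤ) : ℂ) * (2 * Real.pi * Complex.I) := by
        simp only [Pi.add_apply, mul_add, Finset.sum_add_distrib]
        push_cast; ring
      simp only [hG]
      rw [h1, Complex.exp_add, Complex.exp_int_mul_two_pi_mul_I, mul_one, hp z hz]
    have hGg : ∀ (y : P) (x : ι → ℝ),
        (Complex.exp (2 * Real.pi * ∑ i, (n i : ℂ) * (y : ι → ℝ) i) • (mFourier (-n) * g y))
          (toTorus x) = G (cplx x y) := by
      intro y x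
      simp only [ContinuousMap.smul_apply, ContinuousMap.mul_apply, smul_eq_mul, mFourier_toTorus,
        hg, hG]
      rw [← mul_assoc, ← Complex.exp_add]
      congr 2
      simp only [cplx, mul_add, Finset.sum_add_distrib, Pi.neg_apply, Int.cast_neg, neg_mul,
        Finset.sum_neg_distrib]
      have : ∑ i, (n i : ℂ) * (Complex.I * (y : ι → ℝ) i) =
          Complex.I * ∑ i, (n i : ℂ) * (y : ι → ℝ) i := by
        rw [Finset.mul_sum]; exact Finset.sum_congr rfl fun i _ => by ring
      rw [this]
      linear_combination (2 * Real.pi * ∑ i, (n i : ℂ) * (y : ι → ℝ) i) * Complex.I_sq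
    have hint := integral_lift_eq hP hGd hPo hGp y.2 y'.2 (hGg y) (hGg y')
    have hval : ∀ y : P, ∫ θ, (Complex.exp (2 * Real.pi * ∑ i, (n i : ℂ) * (y : ι → ℝ) i) •
        (mFourier (-n) * g y)) θ ∂torusMeasure ι =
        mFourierCoeff (g y) n * Complex.exp (2 * Real.pi * ∑ i, (n i : ℂ) * (y : ι → ℝ) i) := by
      intro y
      simp only [ContinuousMap.smul_apply, smul_eq_mul]
      rw [integral_const_mul, mul_comm]
      rfl
    rwa [hval, hval] at hint
  have hsumm : ∀ y : P, Summable (mFourierCoeff (g y)) := by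
    intro y
    obtain ⟨r, hr, hball⟩ := Metric.isOpen_iff.1 hPo y y.2
    set C := Metric.closedBall (y : ι → ℝ) (r / 2) with hC
    have hCP : C ⊆ P := (Metric.closedBall_subset_ball (by linarith)).trans hball
    obtain ⟨K, hK⟩ := exists_bound_of_periodic hf.continuousOn hp (isCompact_closedBall _ _) hCP
    refine Summable.of_norm_bounded
      ((summable_exp_neg_sum_abs (ι := ι) (r := 2 * Real.pi * (r / 2)) (by positivity)).mul_left K)
      fun n => ?_
    -- Lowering the height by `r/2` in the sign pattern of `n` gains the factor `exp (-2π (r/2) ∑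
    -- |nᵢ|)`, while `f` stays uniformly bounded over the closed ball.
    set δ : ι → ℝ := fun i => (r / 2) * SignType.sign (n i : ℝ) with hδ
    have hyC : (y : ι → ℝ) - δ ∈ C := by
      rw [hC, Metric.mem_closedBall, dist_eq_norm, sub_sub_cancel_left, norm_neg,
        pi_norm_le_iff_of_nonneg (by linarith)]
      intro i
      rw [hδ, Real.norm_eq_abs, abs_mul, abs_of_pos (by linarith : 0 < r / 2)]
      refine mul_le_of_le_one_right (by linarith) ?_
      rcases SignType.sign (n i : ℝ) with _ | _ | _ <;> simp
    have hyP : (y : ι → ℝ) - δ ∈ P := hCP hyC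
    have h1 := hcoef y ⟨_, hyP⟩ n
    have h2 : mFourierCoeff (g y) n = mFourierCoeff (g ⟨_, hyP⟩) n *
        Complex.exp ((-(2 * Real.pi * (r / 2)) * ∑ i, |(n i : ℝ)| : ℝ)) := by
      apply mul_right_cancel₀ (Complex.exp_ne_zero
        (2 * Real.pi * ∑ i, (n i : ℂ) * (y : ι → ℝ) i))
      rw [h1, mul_assoc (mFourierCoeff _ _) (Complex.exp ((_ : ℝ) : ℂ)), ← Complex.exp_add]
      congr 2
      have h3 : ∑ i, (n i : ℂ) * (((y : ι → ℝ) - δ) i : ℝ) =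
          ∑ i, (n i : ℂ) * (y : ι → ℝ) i - (r / 2 : ℝ) * ((∑ i, |(n i : ℝ)| : ℝ) : ℂ) := by
        have h4 : ∀ i, (n i : ℝ) * ((y : ι → ℝ) - δ) i =
            (n i : ℝ) * (y : ι → ℝ) i - (r / 2) * |(n i : ℝ)| := by
          intro i
          rw [← self_mul_sign (n i : ℝ)]
          simp only [hδ, Pi.sub_apply]; ring
        have h5 := Finset.sum_congr rfl fun i (_ : i ∈ Finset.univ) => h4 i
        rw [Finset.sum_sub_distrib, ← Finset.mul_sum] at h5
        exact_mod_cast congrArg (Complex.ofReal) h5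
      rw [h3]
      push_cast; ring
    rw [h2, norm_mul, Complex.norm_exp, Complex.ofReal_re]
    refine mul_le_mul_of_nonneg_right ?_ (Real.exp_pos _).le
    have hb : ∀ θ, ‖mFourier (-n) θ • g ⟨_, hyP⟩ θ‖ ≤ K := by
      intro θ
      obtain ⟨x, rfl⟩ := isOpenQuotientMap_toTorus.surjective θ
      rw [norm_smul, norm_mFourier_apply, one_mul, hg]
      exact hK x _ hyC
    change ‖∫ θ, mFourier (-n) θ • g ⟨_, hyP⟩ θ ∂torusMeasure ι‖ ≤ K
    refine (norm_integral_le_of_norm_le_const (ae_of_all _ hb)).trans ?_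
    simp
  obtain ⟨y₀, hy₀⟩ := hPn
  refine ⟨fun n => mFourierCoeff (g ⟨y₀, hy₀⟩) n *
    Complex.exp (2 * Real.pi * ∑ i, (n i : ℂ) * y₀ i), fun z hz => ?_⟩
  have hz' : (fun i => (z i).im) ∈ P := hz
  have h1 := hasSum_mFourier_series_apply_of_summable (hsumm ⟨_, hz'⟩) (toTorus fun i => (z i).re)
  rw [hg, cplx_re_im] at h1
  convert h1 using 1
  ext n
  have h2 := hcoef ⟨y₀, hy₀⟩ ⟨_, hz'⟩ n
  simp only at h2 ⊢
  rw [h2, mul_assoc, smul_eq_mul, mFourier_toTorus, ← Complex.exp_add]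
  congr 2
  have h3 : ∑ i, (n i : ℂ) * z i =
      ∑ i, (n i : ℂ) * (z i).re + Complex.I * ∑ i, (n i : ℂ) * (z i).im := by
    rw [Finset.mul_sum, ← Finset.sum_add_distrib]
    refine Finset.sum_congr rfl fun i _ => ?_
    conv_lhs => rw [← Complex.re_add_im (z i)]
    ring
  rw [h3]
  linear_combination (2 * Real.pi * ∑ i, (n i : ℂ) * (z i).im) * Complex.I_sq

end Torus

/-! ### Absolutely convergent sums of exponentials -/

section ExpSum

variable {ι : Type*} [Fintype ι] {I : Type*}

/-- The character `e^{2πi ⟨ξ, z⟩}` of a real vector `ξ`. -/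
noncomputable def expo (ξ : ι → ℝ) (z : ι → ℂ) : ℂ :=
  Complex.exp (2 * Real.pi * Complex.I * ∑ j, (ξ j : ℂ) * z j)

/-- `f` is the sum of the series `∑ aᵢ e^{2πi ⟨ξᵢ, z⟩}` on the tube domain over `P`. -/
def IsExpSum (P : Set (ι → ℝ)) (ξ : I → ι → ℝ) (a : I → ℂ) (f : (ι → ℂ) → ℂ) : Prop :=
  ∀ z ∈ tube P, HasSum (fun i => a i * expo (ξ i) z) (f z)

theorem norm_expo (ξ : ι → ℝ) (z : ι → ℂ) :
    ‖expo ξ z‖ = Real.exp (-(2 * Real.pi * ∑ j, ξ j * (z j).im)) := by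
  rw [expo, Complex.norm_exp]
  congr 1
  have : (∑ j, (ξ j : ℂ) * z j).im = ∑ j, ξ j * (z j).im := by simp
  rw [← this]
  simp [Complex.mul_re]

theorem expo_cplx (ξ x y : ι → ℝ) : expo ξ (cplx x y) =
    (Real.exp (-(2 * Real.pi * ∑ j, ξ j * y j)) : ℂ) *
      Complex.exp (2 * Real.pi * Complex.I * ∑ j, (ξ j : ℂ) * x j) := by
  rw [expo, Complex.ofReal_exp, ← Complex.exp_add]
  congr 1
  simp only [cplx, mul_add, Finset.sum_add_distrib]
  have : ∑ i, (ξ i : ℂ) * (Complex.I * y i) = Complex.I * ∑ i, (ξ i : ℂ) * y i := by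
    rw [Finset.mul_sum]; exact Finset.sum_congr rfl fun i _ => by ring
  rw [this]
  push_cast
  linear_combination (2 * Real.pi * ∑ i, (ξ i : ℂ) * y i) * Complex.I_sq

theorem isOpen_tube {P : Set (ι → ℝ)} (hP : IsOpen P) : IsOpen (tube P) :=
  hP.preimage (by fun_prop)

variable {P : Set (ι → ℝ)} {ξ : I → ι → ℝ} {a : I → ℂ} {f : (ι → ℂ) → ℂ}

theorem IsExpSum.summable_norm (h : IsExpSum P ξ a f) {y : ι → ℝ} (hy : y ∈ P) :
    Summable fun i => ‖a i‖ * Real.exp (-(2 * Real.pi * ∑ j, ξ i j * y j)) := by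
  have h1 := (h _ (cplx_mem_tube 0 hy)).summable.norm
  simp only [norm_mul, norm_expo] at h1
  simpa [cplx] using h1

/-- Frequencies of a function that stays bounded in the direction of `v`. -/
theorem IsExpSum.nonneg_of_bounded (h : IsExpSum P ξ a f) (hξ : Function.Injective ξ) {d : ℝ}
    (hd0 : d ≠ 0) (hd : ∀ i j, ∃ n : ℤ, d * ξ i j = n) {v : ι → ℝ} {C T : ℝ}
    (hv : ∀ t : ℝ, T ≤ t → t • v ∈ P) (hb : ∀ t : ℝ, T ≤ t → ∀ x, ‖f (cplx x (t • v))‖ ≤ C) {i : I}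
    (hi : a i ≠ 0) : 0 ≤ ∑ j, ξ i j * v j := by
  by_contra! hlt
  choose m hm using hd
  have hminj : Function.Injective m := by
    intro i i' hii
    refine hξ (funext fun j => mul_left_cancel₀ hd0 ?_)
    rw [hm, hm, hii]
  have key : ∀ t : ℝ, T ≤ t →
      ‖a i‖ * Real.exp (-(2 * Real.pi * (t * ∑ j, ξ i j * v j))) ≤ C := by
    intro t ht
    have hsum : ∀ i, ∑ j, ξ i j * (t • v) j = t * ∑ j, ξ i j * v j := by
      intro i
      rw [Finset.mul_sum]
      exact Finset.sum_congr rfl fun j _ => by simp; ring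
    -- Scaling the real part by `d` makes the frequencies integral, so the coefficient at height `t
    -- v` is bounded by `C`. A negative pairing with `v` would make it grow exponentially in `t`.
    have h2 := norm_coeff_le_of_hasSum hminj
      (c := fun i => a i * (Real.exp (-(2 * Real.pi * (t * ∑ j, ξ i j * v j))) : ℂ))
      (φ := fun x => f (cplx (d • x) (t • v))) (C := C) (by
        have := h.summable_norm (hv t ht)
        simp only [hsum] at this
        simp only [norm_mul, Complex.norm_real, Real.norm_eq_abs, abs_of_pos (Real.exp_pos _)]
        exact this) (by
        intro x
        convert h _ (cplx_mem_tube (d • x) (hv t ht)) using 1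
        ext i
        have hx : ∑ j, (m i j : ℂ) * x j = ∑ j, (ξ i j : ℂ) * ((d • x) j : ℝ) := by
          refine Finset.sum_congr rfl fun j _ => ?_
          have := congrArg (Complex.ofReal) (hm i j)
          push_cast at this
          rw [← this, Pi.smul_apply, smul_eq_mul]; push_cast; ring
        rw [expo_cplx, hsum, hx, mul_assoc]) (fun x => hb t ht _) i
    simp only [norm_mul, Complex.norm_real, Real.norm_eq_abs, abs_of_pos (Real.exp_pos _)] at h2
    exact h2
  have hlim : Tendsto (fun t : ℝ => ‖a i‖ * Real.exp (-(2 * Real.pi * (t * ∑ j, ξ i j * v j))))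
      atTop atTop := by
    refine Tendsto.const_mul_atTop (norm_pos_iff.2 hi) (Real.tendsto_exp_atTop.comp ?_)
    have : (fun t : ℝ => -(2 * Real.pi * (t * ∑ j, ξ i j * v j))) =
        fun t => (-(2 * Real.pi * ∑ j, ξ i j * v j)) * t := by ext; ring
    rw [this]
    exact tendsto_id.const_mul_atTop (by have := Real.pi_pos; nlinarith)
  obtain ⟨t, ht1, ht2⟩ := ((eventually_ge_atTop T).and (hlim.eventually_gt_atTop C)).exists
  exact absurd (key t ht1) (not_le.2 ht2)

/-- Locally uniform domination of a series of exponentials and its derivative. -/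
theorem IsExpSum.exists_majorant (h : IsExpSum P ξ a f) (hP : IsOpen P) {y₀ : ι → ℝ} (hy₀ : y₀ ∈ P) :
    ∃ r > 0, Metric.ball y₀ r ⊆ P ∧ ∃ u : I → ℝ, Summable u ∧
      ∀ i, ∀ y ∈ Metric.ball y₀ r,
        ‖a i‖ * Real.exp (-(2 * Real.pi * ∑ j, ξ i j * y j)) * (2 * Real.pi * ∑ j, |ξ i j|) ≤ u i := by
  classical
  obtain ⟨ε, hε, hball⟩ := Metric.isOpen_iff.1 hP y₀ hy₀
  set r := ε / 3 with hr
  have hr0 : 0 < r := by positivity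
  -- The corners of a cube of half side `2 r`, still inside the ball of radius `ε = 3 r`. For each
  -- frequency the corner with opposite signs gains `exp (2π · 2 r A)`: one half pays for moving `y`
  -- within the ball, the other for the derivative factor.
  set s : (ι → Bool) → ι → ℝ := fun σ j => if σ j then 2 * r else -(2 * r) with hs
  have hsP : ∀ σ, y₀ + s σ ∈ P := by
    intro σ
    apply hball
    rw [Metric.mem_ball, dist_eq_norm, add_sub_cancel_left, pi_norm_lt_iff hε]
    intro j
    simp only [hs]
    split_ifs
    · rw [Real.norm_of_nonneg (by positivity)]; linarith
    · rw [norm_neg, Real.norm_of_nonneg (by positivity)]; linarith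
  refine ⟨r, hr0, (Metric.ball_subset_ball (by linarith)).trans hball,
    fun i => r⁻¹ * ∑ σ, ‖a i‖ * Real.exp (-(2 * Real.pi * ∑ j, ξ i j * (y₀ + s σ) j)),
    (summable_sum fun σ _ => h.summable_norm (hsP σ)).mul_left _, fun i y hy => ?_⟩
  set A := ∑ j, |ξ i j| with hA
  have hA0 : 0 ≤ A := Finset.sum_nonneg fun _ _ => abs_nonneg _
  set σ₀ : ι → Bool := fun j => decide (ξ i j < 0) with hσ₀
  have h1 : ∑ j, ξ i j * (y₀ + s σ₀) j = ∑ j, ξ i j * y₀ j - 2 * r * A := by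
    rw [hA, Finset.mul_sum, ← Finset.sum_sub_distrib]
    refine Finset.sum_congr rfl fun j _ => ?_
    simp only [Pi.add_apply, hs, hσ₀, decide_eq_true_eq]
    split_ifs with hneg
    · rw [abs_of_neg hneg]; ring
    · rw [abs_of_nonneg (not_lt.1 hneg)]; ring
  have h2 : -∑ j, ξ i j * y j ≤ -∑ j, ξ i j * y₀ j + r * A := by
    have : ∑ j, ξ i j * y₀ j - ∑ j, ξ i j * y j ≤ r * A := by
      rw [hA, Finset.mul_sum, ← Finset.sum_sub_distrib]
      refine Finset.sum_le_sum fun j _ => ?_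
      have hd : |y₀ j - y j| ≤ r := by
        rw [Metric.mem_ball, dist_comm] at hy
        exact (dist_le_pi_dist y₀ y j).trans hy.le
      calc ξ i j * y₀ j - ξ i j * y j = ξ i j * (y₀ j - y j) := by ring
        _ ≤ |ξ i j| * |y₀ j - y j| := (le_abs_self _).trans (abs_mul _ _).le
        _ ≤ r * |ξ i j| := by rw [mul_comm]; gcongr
    linarith
  have hle : ‖a i‖ * Real.exp (-(2 * Real.pi * ∑ j, ξ i j * (y₀ + s σ₀) j)) ≤
      ∑ σ, ‖a i‖ * Real.exp (-(2 * Real.pi * ∑ j, ξ i j * (y₀ + s σ) j)) :=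
    Finset.single_le_sum (f := fun σ => ‖a i‖ *
      Real.exp (-(2 * Real.pi * ∑ j, ξ i j * (y₀ + s σ) j))) (fun σ _ => by positivity)
      (Finset.mem_univ σ₀)
  -- The inequality `x ≤ eˣ` absorbs the factor `2π A` that differentiation brings down.
  have hx : r * (2 * Real.pi * A) ≤ Real.exp (2 * Real.pi * (r * A)) := by
    have := Real.add_one_le_exp (2 * Real.pi * (r * A))
    linarith
  have hpi := Real.pi_pos
  have hexp : Real.exp (-(2 * Real.pi * ∑ j, ξ i j * y j)) * Real.exp (2 * Real.pi * (r * A)) ≤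
      Real.exp (-(2 * Real.pi * ∑ j, ξ i j * (y₀ + s σ₀) j)) := by
    rw [← Real.exp_add, Real.exp_le_exp, h1]
    nlinarith
  change _ ≤ r⁻¹ * ∑ σ, ‖a i‖ * Real.exp (-(2 * Real.pi * ∑ j, ξ i j * (y₀ + s σ) j))
  rw [inv_mul_eq_div, le_div_iff₀ hr0]
  calc ‖a i‖ * Real.exp (-(2 * Real.pi * ∑ j, ξ i j * y j)) * (2 * Real.pi * A) * r
      = ‖a i‖ * (Real.exp (-(2 * Real.pi * ∑ j, ξ i j * y j)) * (r * (2 * Real.pi * A))) := by ring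
    _ ≤ ‖a i‖ * (Real.exp (-(2 * Real.pi * ∑ j, ξ i j * y j)) *
          Real.exp (2 * Real.pi * (r * A))) := by gcongr
    _ ≤ ‖a i‖ * Real.exp (-(2 * Real.pi * ∑ j, ξ i j * (y₀ + s σ₀) j)) := by gcongr
    _ ≤ _ := hle

/-- The linear form `⟨ξ, ·⟩`. -/
noncomputable def pairing (ξ : ι → ℝ) : (ι → ℂ) →L[ℂ] ℂ :=
  ∑ j, (ξ j : ℂ) • ContinuousLinearMap.proj j

theorem pairing_apply (ξ : ι → ℝ) (w : ι → ℂ) : pairing ξ w = ∑ j, (ξ j : ℂ) * w j := by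
  simp [pairing]

theorem norm_pairing_le (ξ : ι → ℝ) : ‖pairing ξ‖ ≤ ∑ j, |ξ j| := by
  refine ContinuousLinearMap.opNorm_le_bound _ (Finset.sum_nonneg fun _ _ => abs_nonneg _) fun w => ?_
  rw [pairing_apply, Finset.sum_mul]
  refine (norm_sum_le _ _).trans (Finset.sum_le_sum fun j _ => ?_)
  rw [norm_mul, Complex.norm_real, Real.norm_eq_abs]
  gcongr
  exact norm_le_pi_norm w j

theorem hasFDerivAt_expo (ξ : ι → ℝ) (z : ι → ℂ) :
    HasFDerivAt (expo ξ) ((2 * Real.pi * Complex.I * expo ξ z) • pairing ξ) z := by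
  have h1 : HasFDerivAt (fun z => 2 * Real.pi * Complex.I * pairing ξ z)
      ((2 * Real.pi * Complex.I) • pairing ξ) z := (pairing ξ).hasFDerivAt.const_mul _
  have h2 := h1.cexp
  have h3 : expo ξ = fun z => Complex.exp (2 * Real.pi * Complex.I * pairing ξ z) := by
    ext z; rw [expo, pairing_apply]
  rw [h3]
  rw [smul_smul, mul_comm (Complex.exp _)] at h2
  exact h2

/-- The majorant is uniform on a ball, which justifies differentiation term by term. The derivative
is again a sum over the same frequencies, so the argument iterates to all orders. -/
theorem IsExpSum.hasFDerivAt (h : IsExpSum P ξ a f) (hP : IsOpen P) {z : ι → ℂ} (hz : z ∈ tube P) :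
    DifferentiableAt ℂ f z ∧ ∀ w, HasSum
      (fun i => a i * (2 * Real.pi * Complex.I * ∑ j, (ξ i j : ℂ) * w j) * expo (ξ i) z)
      (fderiv ℂ f z w) := by
  obtain ⟨r, hr, hball, u, hu, hbound⟩ := h.exists_majorant hP hz
  set s := Metric.ball z r with hs
  have hsP : ∀ x ∈ s, (fun i => (x i).im) ∈ Metric.ball (fun i => (z i).im) r := by
    intro x hx
    rw [Metric.mem_ball, dist_pi_lt_iff hr] at hx ⊢
    intro j
    refine lt_of_le_of_lt ?_ (hx j)
    rw [Complex.dist_eq, Real.dist_eq, ← Complex.sub_im]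
    exact Complex.abs_im_le_norm _
  have hF : ∀ i, ∀ x ∈ s, HasFDerivAt (fun x => a i * expo (ξ i) x)
      ((a i * (2 * Real.pi * Complex.I * expo (ξ i) x)) • pairing (ξ i)) x := by
    intro i x _
    have := (hasFDerivAt_expo (ξ i) x).const_mul (a i)
    rwa [smul_smul] at this
  have hF' : ∀ i, ∀ x ∈ s,
      ‖(a i * (2 * Real.pi * Complex.I * expo (ξ i) x)) • pairing (ξ i)‖ ≤ u i := by
    intro i x hx
    refine le_trans ?_ (hbound i _ (hsP x hx))
    rw [norm_smul]
    refine (mul_le_mul_of_nonneg_left (norm_pairing_le _) (norm_nonneg _)).trans (le_of_eq ?_)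
    simp only [norm_mul, norm_expo, Complex.norm_I, Complex.norm_real, Real.norm_eq_abs,
      abs_of_pos Real.pi_pos, Complex.norm_ofNat]
    ring
  have hz0 : z ∈ s := Metric.mem_ball_self hr
  have hmain := hasFDerivAt_tsum_of_isPreconnected hu Metric.isOpen_ball
    (convex_ball z r).isPreconnected hF hF' hz0 (h z hz).summable hz0
  have heq : f =ᶠ[𝓝 z] fun x => ∑' i, a i * expo (ξ i) x := by
    filter_upwards [Metric.isOpen_ball.mem_nhds hz0] with x hx
    exact (h x (hball (hsP x hx))).tsum_eq.symm
  have hfd := hmain.congr_of_eventuallyEq heq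
  refine ⟨hfd.differentiableAt, fun w => ?_⟩
  rw [hfd.fderiv]
  have hsum : Summable fun i => (a i * (2 * Real.pi * Complex.I * expo (ξ i) z)) • pairing (ξ i) :=
    Summable.of_norm_bounded hu fun i => hF' i z hz0
  have := (ContinuousLinearMap.apply ℂ ℂ w).hasSum hsum.hasSum
  have h1 : (fun i => a i * (2 * Real.pi * Complex.I * ∑ j, (ξ i j : ℂ) * w j) * expo (ξ i) z) =
      fun i => ((a i * (2 * Real.pi * Complex.I * expo (ξ i) z)) • pairing (ξ i)) w := by
    funext i
    rw [FunLike.coe_smul, Pi.smul_apply, pairing_apply, smul_eq_mul]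
    ring
  rw [h1]
  exact this

theorem IsExpSum.deriv (h : IsExpSum P ξ a f) (hP : IsOpen P) (w : ι → ℂ) :
    IsExpSum P ξ (fun i => a i * (2 * Real.pi * Complex.I * ∑ j, (ξ i j : ℂ) * w j))
      (fun z => fderiv ℂ f z w) :=
  fun _ hz => (h.hasFDerivAt hP hz).2 w

theorem IsExpSum.contDiffOn (h : IsExpSum P ξ a f) (hP : IsOpen P) :
    ContDiffOn ℂ (⊤ : ℕ∞) f (tube P) := by
  rw [contDiffOn_infty]
  intro n
  induction n generalizing a f with
  | zero =>
    rw [Nat.cast_zero, contDiffOn_zero]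
    exact fun z hz => (h.hasFDerivAt hP hz).1.continuousAt.continuousWithinAt
  | succ n ih =>
    rw [Nat.cast_add, Nat.cast_one, contDiffOn_succ_iff_fderiv_of_isOpen (isOpen_tube hP)]
    refine ⟨fun z hz => (h.hasFDerivAt hP hz).1.differentiableWithinAt, fun hn => ?_, ?_⟩
    · exact absurd hn (by exact_mod_cast WithTop.coe_ne_top)
    · exact contDiffOn_clm_apply.2 fun w => ih (h.deriv hP w)

theorem IsExpSum.iteratedFDeriv (h : IsExpSum P ξ a f) (hP : IsOpen P) (n : ℕ) (w : Fin n → ι → ℂ) :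
    IsExpSum P ξ (fun i => a i * ∏ k, (2 * Real.pi * Complex.I * ∑ j, (ξ i j : ℂ) * w k j))
      (fun z => iteratedFDeriv ℂ n f z w) := by
  induction n with
  | zero => simpa using h
  | succ n ih =>
    have h1 := (ih (Fin.tail w)).deriv hP (w 0)
    intro z hz
    convert h1 z hz using 1
    · ext i
      dsimp only
      rw [Fin.prod_univ_succ]
      simp only [Fin.tail]; ring
    · dsimp only
      have hd : DifferentiableAt ℂ (_root_.iteratedFDeriv ℂ n f) z :=
        ((h.contDiffOn hP).contDiffAt ((isOpen_tube hP).mem_nhds hz)).differentiableAt_iteratedFDeriv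
          (by exact_mod_cast WithTop.coe_lt_top n)
      rw [iteratedFDeriv_succ_apply_left]
      have : (fun z => _root_.iteratedFDeriv ℂ n f z (Fin.tail w)) =
          fun z => (ContinuousMultilinearMap.apply ℂ (fun _ : Fin n => ι → ℂ) ℂ (Fin.tail w))
            (_root_.iteratedFDeriv ℂ n f z) := rfl
      rw [this, fderiv_fun_comp z (ContinuousLinearMap.differentiableAt _) hd]
      simp

theorem IsExpSum.const_mul (h : IsExpSum P ξ a f) (c : ℂ) :
    IsExpSum P ξ (fun i => c * a i) (fun z => c * f z) := by
  intro z hz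
  simpa only [mul_assoc] using (h z hz).mul_left c

theorem IsExpSum.sum {α : Type*} (s : Finset α) {a : α → I → ℂ} {f : α → (ι → ℂ) → ℂ}
    (h : ∀ k ∈ s, IsExpSum P ξ (a k) (f k)) :
    IsExpSum P ξ (fun i => ∑ k ∈ s, a k i) (fun z => ∑ k ∈ s, f k z) := by
  intro z hz
  simp only [Finset.sum_mul]
  exact hasSum_sum fun k hk => h k hk z hz

end ExpSum

/-! ### The pullback operator on sums of exponentials -/

section OperatorExpSum

variable {ι κ κ' : Type*} [Fintype ι] [DecidableEq ι] [Fintype κ] [DecidableEq κ] [Fintype κ']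
  [DecidableEq κ'] {S : Matrix ι ι ℤ} {L : Submodule ℤ (ι → ℤ)} (b : Basis κ ℤ L)
  (b' : Basis κ' ℤ (orthLattice S L)) {I : Type*}

theorem HasSum.congr_terms {u w : I → ℂ} {s : ℂ} (h : HasSum w s) (huw : ∀ i, u i = w i) :
    HasSum u s := by
  rwa [funext huw]

/-- The symbol of the Laplace operator along `L` at the character of frequency `ξ`. -/
noncomputable def laplacianSymbol (S : Matrix ι ι ℤ) {L : Submodule ℤ (ι → ℤ)} (b : Basis κ ℤ L)
    (ξ : ι → ℝ) : ℂ :=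
  1 / 2 * ∑ i, ∑ j, ((subGram S b).map (Int.cast : ℤ → ℂ))⁻¹ i j *
    ((2 * Real.pi * Complex.I * ∑ l, (ξ l : ℂ) * (embed b (Pi.single i 1) : ι → ℂ) l) *
      (2 * Real.pi * Complex.I * ∑ l, (ξ l : ℂ) * (embed b (Pi.single j 1) : ι → ℂ) l))

theorem IsExpSum.laplacian {P : Set (ι → ℝ)} {ξ : I → ι → ℝ} {a : I → ℂ} {f : (ι → ℂ) → ℂ}
    (h : IsExpSum P ξ a f) (hP : IsOpen P) :
    IsExpSum P ξ (fun i => a i * laplacianSymbol S b (ξ i)) (laplacian S b f) := by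
  have h1 := (IsExpSum.sum Finset.univ fun i _ => IsExpSum.sum Finset.univ fun j _ =>
    (h.iteratedFDeriv hP 2 ![embed b (Pi.single i 1), embed b (Pi.single j 1)]).const_mul
      (((subGram S b).map (Int.cast : ℤ → ℂ))⁻¹ i j)).const_mul (1 / 2)
  intro z hz
  refine HasSum.congr_terms (h1 z hz) fun i => ?_
  refine congrArg (· * expo (ξ i) z) ?_
  dsimp only
  rw [laplacianSymbol, mul_left_comm, Finset.mul_sum]
  congr 1
  refine Finset.sum_congr rfl fun j _ => ?_
  rw [Finset.mul_sum]
  refine Finset.sum_congr rfl fun l _ => ?_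
  rw [Fin.prod_univ_two]
  simp only [Matrix.cons_val_zero, Matrix.cons_val_one]
  ring

theorem IsExpSum.laplacian_iterate {P : Set (ι → ℝ)} {ξ : I → ι → ℝ} {a : I → ℂ}
    {f : (ι → ℂ) → ℂ} (h : IsExpSum P ξ a f) (hP : IsOpen P) (n : ℕ) :
    IsExpSum P ξ (fun i => a i * laplacianSymbol S b (ξ i) ^ n) ((HigherPullback.laplacian S b)^[n] f) := by
  induction n with
  | zero => simpa using h
  | succ n ih =>
    rw [Function.iterate_succ_apply']
    simpa only [pow_succ, mul_assoc] using ih.laplacian (S := S) b hP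

/-- The frequency pairs with the basis of `L` through `T x`, and `(T x)ᵀ T⁻¹ (T x) = 2 Q(x)`. The
component along `L^⊥` is invisible to the Laplacian. -/
theorem laplacianSymbol_freq (hS : S.IsSymm) (hd : (subGram S b).det ≠ 0) (x : κ → ℝ) (y : κ' → ℝ) :
    laplacianSymbol S b (freq b b' x y) =
      (2 * Real.pi * Complex.I) ^ 2 * ((quad (subGram S b) ℝ x : ℝ) : ℂ) := by
  set T := (subGram S b).map (Int.cast : ℤ → ℂ) with hT
  have hTd : IsUnit T.det := by
    rw [show T = (Int.castRingHom ℂ).mapMatrix (subGram S b) from rfl, ← RingHom.map_det]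
    simpa using hd
  set xc : κ → ℂ := fun i => (x i : ℂ) with hxc
  have h1 : ∀ i, ∑ l, (freq b b' x y l : ℂ) * (embed b (Pi.single i 1) : ι → ℂ) l =
      T.mulVec xc i := by
    intro i
    have := sum_freq_mul_embed b b' hS x y (Pi.single i 1) 0
    rw [embed_zero, add_zero, map_zero, add_zero] at this
    rw [this, form_comm (subGram_isSymm b hS), form_eq_dotProduct]
    simp [hT, hxc]
  simp only [laplacianSymbol, h1]
  have h2 : quad (subGram S b) ℂ xc = ((quad (subGram S b) ℝ x : ℝ) : ℂ) := quad_ofReal x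
  rw [← h2, quad_apply, form_eq_dotProduct, ← hT]
  have h3 : ∑ i, ∑ j, T⁻¹ i j * ((2 * Real.pi * Complex.I * T.mulVec xc i) *
      (2 * Real.pi * Complex.I * T.mulVec xc j)) =
      (2 * Real.pi * Complex.I) ^ 2 * dotProduct (T.mulVec xc) (T⁻¹.mulVec (T.mulVec xc)) := by
    generalize T.mulVec xc = u
    simp only [dotProduct, Matrix.mulVec, Finset.mul_sum]
    exact Finset.sum_congr rfl fun i _ => Finset.sum_congr rfl fun j _ => by ring
  rw [h3, Matrix.mulVec_mulVec, Matrix.nonsing_inv_mul _ hTd, Matrix.one_mulVec, dotProduct_comm]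
  ring

/-- Every monomial with `2 n₁ + n₂ = N` produces the same power `(2πi)^N`, which the normalization
removes. It is stated for arbitrary real frequencies because `F|_k M` with rational `M` has
frequencies outside the dual lattices. -/
theorem hasSum_pullbackOperator (hS : S.IsSymm) (hd : (subGram S b).det ≠ 0) {p : κ → ℝ}
    {X : I → κ → ℝ} {Y : I → κ' → ℝ} {a : I → ℂ} {f : (ι → ℂ) → ℂ}
    (h : IsExpSum (posCone S (embed b p)) (fun i => freq b b' (X i) (Y i)) a f) (k : ℤ) (N : ℕ)
    {z : κ → ℂ} (hz : z ∈ upperHalf (subGram S b) p) (v : Fin N → κ' → ℂ) :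
    HasSum (fun i => a i * gegenbauerForm ((k : ℂ) - (Fintype.card κ : ℂ) / 2) N
        (form (subGram S b') ℂ (fun j => (Y i j : ℂ)))
        ((-((quad (subGram S b) ℝ (X i) : ℝ) : ℂ) / 2) • form (subGram S b') ℂ) v *
        expChar (subGram S b) (X i) z) (pullbackOperator S b b' k N f z v) := by
  have hP := isOpen_posCone (S := S) (embed b p)
  have hz' : embed b z ∈ tube (posCone S (embed b p)) := embed_mem_upperHalf b hz
  set c := 2 * Real.pi * Complex.I with hc
  have hc0 : c ≠ 0 := by simp [hc, Real.pi_ne_zero]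
  have hexp : ∀ i, expo (freq b b' (X i) (Y i)) (embed b z) = expChar (subGram S b) (X i) z := by
    intro i
    have := sum_freq_mul_embed b b' hS (X i) (Y i) z 0
    rw [embed_zero, add_zero, map_zero, add_zero] at this
    rw [expo, expChar, this]
  have hdir : ∀ i w, ∑ l, (freq b b' (X i) (Y i) l : ℂ) * (embed b' w : ι → ℂ) l =
      form (subGram S b') ℂ (fun j => (Y i j : ℂ)) w := by
    intro i w
    have := sum_freq_mul_embed b b' hS (X i) (Y i) 0 w
    rwa [embed_zero, zero_add, map_zero, zero_add] at this
  simp only [pullbackOperator, gegenbauerForm, gegenbauerSum]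
  have key : ∀ n₁ n₂ (e : Fin n₂ ⊕ Fin n₁ × Fin 2 ≃ Fin N), 2 * n₁ + n₂ = N →
      HasSum (fun i => a i * (c ^ N * ((∏ k, form (subGram S b') ℂ (fun j => (Y i j : ℂ))
          (v (e (Sum.inl k)))) * ∏ j, ((-((quad (subGram S b) ℝ (X i) : ℝ) : ℂ) / 2) •
            form (subGram S b') ℂ) (v (e (Sum.inr (j, 0)))) (v (e (Sum.inr (j, 1)))))) *
          expChar (subGram S b) (X i) z)
        (iteratedFDeriv ℂ n₂ ((laplacian S b)^[n₁] f) (embed b z)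
          (fun i => embed b' (v (e (Sum.inl i)))) *
        ∏ j, (-(form (subGram S b') ℂ (v (e (Sum.inr (j, 0)))) (v (e (Sum.inr (j, 1))))) / 2)) := by
    intro n₁ n₂ e hn
    have h1 := (((h.laplacian_iterate (S := S) b hP n₁).iteratedFDeriv hP n₂
      (fun i => embed b' (v (e (Sum.inl i))))) _ hz').mul_right
      (∏ j, (-(form (subGram S b') ℂ (v (e (Sum.inr (j, 0)))) (v (e (Sum.inr (j, 1))))) / 2))
    refine HasSum.congr_terms h1 fun i => ?_
    simp only [hexp, hdir, laplacianSymbol_freq b b' hS hd, ← hc, LinearMap.smul_apply, smul_eq_mul,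
      Finset.prod_mul_distrib, Finset.prod_const, Finset.card_univ, Fintype.card_fin,
      div_eq_mul_inv, neg_mul, Finset.prod_neg]
    have hcN : c ^ N = (c ^ 2) ^ n₁ * c ^ n₂ := by rw [← hn]; ring_nf
    rw [hcN]
    ring_nf
  have hsum := (hasSum_sum fun (n : ℕ × ℕ) (hn : n ∈ (Finset.range (N + 1) ×ˢ
    Finset.range (N + 1)).filter (fun n => 2 * n.1 + n.2 = N)) =>
    ((hasSum_sum fun (e : Fin n.2 ⊕ Fin n.1 × Fin 2 ≃ Fin N) (_ : e ∈ Finset.univ) =>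
      key n.1 n.2 e (Finset.mem_filter.1 hn).2).mul_left (1 / (N.factorial : ℂ))).mul_left
      (gegenbauerCoeff ((k : ℂ) - (Fintype.card κ : ℂ) / 2) N n.1 n.2)).mul_left (c ^ (-(N : ℤ)))
  refine HasSum.congr_terms hsum fun i => ?_
  rw [Finset.mul_sum, Finset.mul_sum, Finset.sum_mul]
  refine Finset.sum_congr rfl fun n _ => ?_
  have hcN : c ^ (-(N : ℤ)) * c ^ N = 1 := by
    rw [zpow_neg, zpow_natCast, inv_mul_cancel₀ (pow_ne_zero _ hc0)]
  simp only [← Finset.sum_mul, ← Finset.mul_sum]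
  linear_combination (exp := 1) (-(a i * expChar (subGram S b) (X i) z *
    (gegenbauerCoeff ((k : ℂ) - (Fintype.card κ : ℂ) / 2) N n.1 n.2 * (1 / (N.factorial : ℂ) *
      ∑ e : Fin n.2 ⊕ Fin n.1 × Fin 2 ≃ Fin N,
        (∏ k, form (subGram S b') ℂ (fun j => (Y i j : ℂ)) (v (e (Sum.inl k)))) *
        ∏ j, ((-((quad (subGram S b) ℝ (X i) : ℝ) : ℂ) / 2) •
            form (subGram S b') ℂ) (v (e (Sum.inr (j, 0)))) (v (e (Sum.inr (j, 1)))))))) * hcN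

end OperatorExpSum

/-! ### Differential operators on smooth functions -/

section Smooth

variable {E : Type*} [NormedAddCommGroup E] [NormedSpace ℂ E]

open TopologicalSpace (Opens)

/-- Functions that are smooth on the open set `U` and vanish outside. -/
noncomputable def Smooth (U : Opens E) : Submodule ℂ (E → ℂ) where
  carrier := {f | ContDiffOn ℂ (⊤ : ℕ∞) f U ∧ ∀ x ∉ U, f x = 0}
  zero_mem' := ⟨contDiffOn_const, fun _ _ => rfl⟩
  add_mem' hf hg := ⟨hf.1.add hg.1, fun x hx => by simp [hf.2 x hx, hg.2 x hx]⟩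
  smul_mem' c _ hf := ⟨hf.1.const_smul c, fun x hx => by simp [hf.2 x hx]⟩

variable {U : Opens E}

theorem Smooth.ext_on {f g : Smooth U} (h : ∀ x ∈ U, (f : E → ℂ) x = (g : E → ℂ) x) : f = g := by
  refine Subtype.ext (funext fun x => ?_)
  by_cases hx : x ∈ U
  · exact h x hx
  · rw [f.2.2 x hx, g.2.2 x hx]

/-- The restriction of a smooth function to `U`. -/
noncomputable def Smooth.restrict (U : Opens E) (f : E → ℂ) (hf : ContDiffOn ℂ (⊤ : ℕ∞) f U) :
    Smooth U :=
  ⟨Set.indicator U f, hf.congr fun _ hx => Set.indicator_of_mem hx f,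
    fun _ hx => Set.indicator_of_notMem hx f⟩

theorem Smooth.restrict_apply {f : E → ℂ} (hf : ContDiffOn ℂ (⊤ : ℕ∞) f U) {x : E} (hx : x ∈ U) :
    (Smooth.restrict U f hf : E → ℂ) x = f x :=
  Set.indicator_of_mem hx f

theorem Smooth.contDiffAt (f : Smooth U) {x : E} (hx : x ∈ U) :
    ContDiffAt ℂ (⊤ : ℕ∞) (f : E → ℂ) x :=
  f.2.1.contDiffAt (U.isOpen.mem_nhds hx)

theorem Smooth.differentiableAt (f : Smooth U) {x : E} (hx : x ∈ U) :
    DifferentiableAt ℂ (f : E → ℂ) x :=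
  (Smooth.contDiffAt f hx).differentiableAt (by simp)

theorem Smooth.contDiffOn_fderiv (f : Smooth U) : ContDiffOn ℂ (⊤ : ℕ∞) (fderiv ℂ (f : E → ℂ)) U :=
  f.2.1.fderiv_of_isOpen U.isOpen (by simp)

theorem Smooth.differentiableAt_fderiv (f : Smooth U) {x : E} (hx : x ∈ U) :
    DifferentiableAt ℂ (fderiv ℂ (f : E → ℂ)) x :=
  ((Smooth.contDiffOn_fderiv f).contDiffAt (U.isOpen.mem_nhds hx)).differentiableAt (by simp)

/-- The derivative along a vector field. -/
noncomputable def lie (U : Opens E) (ξ : E → E) (hξ : ContDiff ℂ (⊤ : ℕ∞) ξ) :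
    Module.End ℂ (Smooth U) where
  toFun f := Smooth.restrict U (fun x => fderiv ℂ (f : E → ℂ) x (ξ x))
    ((Smooth.contDiffOn_fderiv f).clm_apply hξ.contDiffOn)
  map_add' f g := Smooth.ext_on fun x hx => by
    rw [Smooth.restrict_apply _ hx, Submodule.coe_add, Submodule.coe_add, Pi.add_apply,
      Smooth.restrict_apply _ hx, Smooth.restrict_apply _ hx,
      fderiv_add (Smooth.differentiableAt f hx) (Smooth.differentiableAt g hx), add_apply]
  map_smul' c f := Smooth.ext_on fun x hx => by
    rw [Smooth.restrict_apply _ hx, RingHom.id_apply, Submodule.coe_smul, Submodule.coe_smul,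
      Pi.smul_apply, Smooth.restrict_apply _ hx, fderiv_const_smul (Smooth.differentiableAt f hx),
      smul_apply]

theorem lie_apply {ξ : E → E} (hξ : ContDiff ℂ (⊤ : ℕ∞) ξ) (f : Smooth U) {x : E} (hx : x ∈ U) :
    (lie U ξ hξ f : E → ℂ) x = fderiv ℂ (f : E → ℂ) x (ξ x) :=
  Smooth.restrict_apply ((Smooth.contDiffOn_fderiv f).clm_apply hξ.contDiffOn) hx

/-- The directional derivative. -/
noncomputable def dirD (U : Opens E) (a : E) : Module.End ℂ (Smooth U) :=
  lie U (fun _ => a) contDiff_const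

/-- The derivative along a linear vector field. -/
noncomputable def linD (U : Opens E) (A : E →L[ℂ] E) : Module.End ℂ (Smooth U) :=
  lie U A A.contDiff

/-- Multiplication by a smooth function. -/
noncomputable def mulOp (U : Opens E) (g : E → ℂ) (hg : ContDiff ℂ (⊤ : ℕ∞) g) :
    Module.End ℂ (Smooth U) where
  toFun f := ⟨fun x => g x * (f : E → ℂ) x, hg.contDiffOn.mul f.2.1,
    fun x hx => by simp [f.2.2 x hx]⟩
  map_add' f h := Subtype.ext (funext fun x => mul_add _ _ _)
  map_smul' c f := Subtype.ext (funext fun x => mul_left_comm _ _ _)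

theorem mulOp_apply {g : E → ℂ} (hg : ContDiff ℂ (⊤ : ℕ∞) g) (f : Smooth U) (x : E) :
    (mulOp U g hg f : E → ℂ) x = g x * (f : E → ℂ) x := rfl

theorem dirD_apply (a : E) (f : Smooth U) {x : E} (hx : x ∈ U) :
    (dirD U a f : E → ℂ) x = fderiv ℂ (f : E → ℂ) x a :=
  lie_apply _ f hx

theorem linD_apply (A : E →L[ℂ] E) (f : Smooth U) {x : E} (hx : x ∈ U) :
    (linD U A f : E → ℂ) x = fderiv ℂ (f : E → ℂ) x (A x) :=
  lie_apply _ f hx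

theorem dirD_add (a c : E) : dirD U (a + c) = dirD U a + dirD U c := by
  refine LinearMap.ext fun f => Smooth.ext_on fun x hx => ?_
  rw [LinearMap.add_apply, Submodule.coe_add, Pi.add_apply, dirD_apply _ _ hx, dirD_apply _ _ hx,
    dirD_apply _ _ hx, map_add]

theorem dirD_smul (c : ℂ) (a : E) : dirD U (c • a) = c • dirD U a := by
  refine LinearMap.ext fun f => Smooth.ext_on fun x hx => ?_
  rw [LinearMap.smul_apply, Submodule.coe_smul, Pi.smul_apply, dirD_apply _ _ hx, dirD_apply _ _ hx,
    map_smul]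

theorem dirD_zero : dirD U (0 : E) = 0 := by
  rw [← zero_smul ℂ (0 : E), dirD_smul, zero_smul]

theorem dirD_sum {α : Type*} (s : Finset α) (w : α → E) :
    dirD U (∑ i ∈ s, w i) = ∑ i ∈ s, dirD U (w i) := by
  classical
  induction s using Finset.induction_on with
  | empty => simp [dirD_zero]
  | insert i s hi ih => rw [Finset.sum_insert hi, Finset.sum_insert hi, dirD_add, ih]

theorem linD_add (A C : E →L[ℂ] E) : linD U (A + C) = linD U A + linD U C := by
  refine LinearMap.ext fun f => Smooth.ext_on fun x hx => ?_
  rw [LinearMap.add_apply, Submodule.coe_add, Pi.add_apply, linD_apply _ _ hx, linD_apply _ _ hx,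
    linD_apply _ _ hx, add_apply, map_add]

theorem dirD_lie_apply (a : E) {ξ : E → E} (hξ : ContDiff ℂ (⊤ : ℕ∞) ξ) (f : Smooth U) {x : E}
    (hx : x ∈ U) : (dirD U a (lie U ξ hξ f) : E → ℂ) x =
      fderiv ℂ (fderiv ℂ (f : E → ℂ)) x a (ξ x) + fderiv ℂ (f : E → ℂ) x (fderiv ℂ ξ x a) := by
  rw [dirD_apply _ _ hx]
  have h1 : (lie U ξ hξ f : E → ℂ) =ᶠ[𝓝 x] fun y => fderiv ℂ (f : E → ℂ) y (ξ y) := by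
    filter_upwards [U.isOpen.mem_nhds hx] with y hy using lie_apply hξ f hy
  rw [h1.fderiv_eq, fderiv_clm_apply (Smooth.differentiableAt_fderiv f hx)
    ((hξ.contDiffAt).differentiableAt (by simp))]
  simp [add_comm]

theorem Smooth.fderiv_fderiv_comm (f : Smooth U) {x : E} (hx : x ∈ U) (a c : E) :
    fderiv ℂ (fderiv ℂ (f : E → ℂ)) x a c = fderiv ℂ (fderiv ℂ (f : E → ℂ)) x c a :=
  ((Smooth.contDiffAt f hx).isSymmSndFDerivAt (by
    rw [minSmoothness_of_isRCLikeNormedField]; exact WithTop.coe_le_coe.2 (le_top : (2 : ℕ∞) ≤ ⊤))) a c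

theorem dirD_comm (a c : E) : dirD U a * dirD U c = dirD U c * dirD U a := by
  refine LinearMap.ext fun f => Smooth.ext_on fun x hx => ?_
  rw [Module.End.mul_apply, Module.End.mul_apply]
  rw [show dirD U c f = lie U _ contDiff_const f from rfl, dirD_lie_apply _ _ _ hx,
    show dirD U a f = lie U _ contDiff_const f from rfl, dirD_lie_apply _ _ _ hx,
    Smooth.fderiv_fderiv_comm f hx]
  simp

/-- The second derivatives cancel by symmetry, and only the derivative of the linear vector field
remains. -/
theorem dirD_mul_linD (a : E) (A : E →L[ℂ] E) :
    dirD U a * linD U A = linD U A * dirD U a + dirD U (A a) := by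
  refine LinearMap.ext fun f => Smooth.ext_on fun x hx => ?_
  rw [LinearMap.add_apply, Submodule.coe_add, Pi.add_apply, Module.End.mul_apply,
    Module.End.mul_apply, linD_apply _ _ hx, dirD_apply (A a) _ hx, ← dirD_apply (A x) _ hx,
    show linD U A f = lie U _ A.contDiff f from rfl, dirD_lie_apply _ _ _ hx,
    show dirD U a f = lie U _ contDiff_const f from rfl, dirD_lie_apply _ _ _ hx,
    Smooth.fderiv_fderiv_comm f hx]
  simp

theorem dirD_mul_mulOp (a : E) {g g' : E → ℂ} (hg : ContDiff ℂ (⊤ : ℕ∞) g)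
    (hg' : ContDiff ℂ (⊤ : ℕ∞) g') (h : ∀ x, fderiv ℂ g x a = g' x) :
    dirD U a * mulOp U g hg = mulOp U g hg * dirD U a + mulOp U g' hg' := by
  refine LinearMap.ext fun f => Smooth.ext_on fun x hx => ?_
  rw [LinearMap.add_apply, Submodule.coe_add, Pi.add_apply, Module.End.mul_apply,
    Module.End.mul_apply, dirD_apply _ _ hx, mulOp_apply, mulOp_apply, dirD_apply _ _ hx, ← h x]
  rw [show (mulOp U g hg f : E → ℂ) = fun y => g y * (f : E → ℂ) y from rfl,
    fderiv_fun_mul ((hg.contDiffAt).differentiableAt (by simp)) (Smooth.differentiableAt f hx)]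
  simp [mul_comm]

theorem mulOp_const (c : ℂ) : mulOp U (fun _ => c) contDiff_const = c • 1 :=
  rfl

/-! ### Pulling back along affine maps -/

variable {E' : Type*} [NormedAddCommGroup E'] [NormedSpace ℂ E'] {U' : Opens E'}

theorem Smooth.contDiffOn_comp_affine (f : Smooth U) {A : E' →L[ℂ] E} {c : E}
    (h : ∀ x ∈ U', A x + c ∈ U) :
    ContDiffOn ℂ (⊤ : ℕ∞) (fun x => (f : E → ℂ) (A x + c)) U' :=
  f.2.1.comp (f := fun x => A x + c) (A.contDiff.add contDiff_const).contDiffOn fun x hx => h x hx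

/-- Pulling back along `x ↦ A x + c`. -/
noncomputable def pullAffine (A : E' →L[ℂ] E) (c : E) (h : ∀ x ∈ U', A x + c ∈ U) :
    Smooth U →ₗ[ℂ] Smooth U' where
  toFun f := Smooth.restrict U' _ (Smooth.contDiffOn_comp_affine f h)
  map_add' f g := Smooth.ext_on fun x hx => by
    simp only [Submodule.coe_add, Pi.add_apply, Smooth.restrict_apply _ hx]
  map_smul' d f := Smooth.ext_on fun x hx => by
    simp only [Submodule.coe_smul, Pi.smul_apply, Smooth.restrict_apply _ hx, RingHom.id_apply]

theorem pullAffine_apply {A : E' →L[ℂ] E} {c : E} (h : ∀ x ∈ U', A x + c ∈ U) (f : Smooth U)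
    {x : E'} (hx : x ∈ U') : (pullAffine A c h f : E' → ℂ) x = (f : E → ℂ) (A x + c) :=
  Smooth.restrict_apply (Smooth.contDiffOn_comp_affine f h) hx

theorem dirD_pullAffine {A : E' →L[ℂ] E} {c : E} (h : ∀ x ∈ U', A x + c ∈ U) (a : E')
    (f : Smooth U) : dirD U' a (pullAffine A c h f) = pullAffine A c h (dirD U (A a) f) := by
  refine Smooth.ext_on fun x hx => ?_
  rw [pullAffine_apply _ _ hx, dirD_apply _ _ hx, dirD_apply _ _ (h x hx)]
  have h1 : HasFDerivAt (fun x => A x + c) A x := A.hasFDerivAt.add_const c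
  have h2 := (Smooth.differentiableAt f (h x hx)).hasFDerivAt.comp x h1
  have h3 : (pullAffine A c h f : E' → ℂ) =ᶠ[𝓝 x] (f : E → ℂ) ∘ fun x => A x + c := by
    filter_upwards [U'.isOpen.mem_nhds hx] with y hy using pullAffine_apply h f hy
  rw [h3.fderiv_eq, h2.fderiv]
  rfl

/-- Derivatives are computed along lines. -/
theorem dirD_apply_of_hasDerivAt {a x : E} (f : Smooth U) (hx : x ∈ U) {d : ℂ}
    (h : HasDerivAt (fun s : ℂ => (f : E → ℂ) (x + s • a)) d 0) : (dirD U a f : E → ℂ) x = d := by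
  rw [dirD_apply _ _ hx, ← (Smooth.differentiableAt f hx).lineDeriv_eq_fderiv]
  exact h.deriv

/-- The second order operator `½ ∑ Cᵢⱼ ∂_{wᵢ} ∂_{wⱼ}`. -/
noncomputable def secondOp (U : Opens E) {α : Type*} [Fintype α] (C : Matrix α α ℂ) (w : α → E) :
    Module.End ℂ (Smooth U) :=
  (1 / 2 : ℂ) • ∑ i, ∑ j, C i j • (dirD U (w i) * dirD U (w j))

theorem secondOp_pullAffine {A : E' →L[ℂ] E} {c : E} (h : ∀ x ∈ U', A x + c ∈ U) {α : Type*}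
    [Fintype α] (C : Matrix α α ℂ) (w : α → E') (f : Smooth U) :
    secondOp U' C w (pullAffine A c h f) =
      pullAffine A c h (secondOp U C (fun i => A (w i)) f) := by
  simp only [secondOp, LinearMap.smul_apply, LinearMap.sum_apply, Module.End.mul_apply,
    dirD_pullAffine, map_smul, map_sum]

theorem pow_pullAffine {A : E' →L[ℂ] E} {c : E} (h : ∀ x ∈ U', A x + c ∈ U)
    {P : Module.End ℂ (Smooth U)} {P' : Module.End ℂ (Smooth U')}
    (hP : ∀ f, P' (pullAffine A c h f) = pullAffine A c h (P f)) (n : ℕ) (f : Smooth U) :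
    (P' ^ n) (pullAffine A c h f) = pullAffine A c h ((P ^ n) f) := by
  induction n with
  | zero => rfl
  | succ n ih => rw [pow_succ', pow_succ', Module.End.mul_apply, Module.End.mul_apply, ih, hP]

theorem dirD_comm_secondOp {α : Type*} [Fintype α] (C : Matrix α α ℂ) (w : α → E) (a : E) :
    dirD U a * secondOp U C w = secondOp U C w * dirD U a := by
  simp only [secondOp, mul_smul_comm, smul_mul_assoc, Finset.mul_sum, Finset.sum_mul]
  congr 1
  refine Finset.sum_congr rfl fun i _ => Finset.sum_congr rfl fun j _ => ?_
  rw [← mul_assoc, dirD_comm a, mul_assoc, dirD_comm a, mul_assoc]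

end Smooth

/-! ### The Gegenbauer operator kills multiples of the quadratic form -/

section Weyl

variable {R : Type*} [Ring R] [Algebra ℂ R]

/-- The double commutator of `D` with `q` is the scalar `B`, so the expansion stops at second order.
Truncated exponents are harmless: their coefficients vanish for `n = 0` and `n = 1`. -/
theorem pow_mul_of_commutator {D m q : R} {B : ℂ} (hq : D * q = q * D + m)
    (hm : D * m = m * D + B • 1) (n : ℕ) :
    D ^ n * m = m * D ^ n + ((n : ℂ) * B) • D ^ (n - 1) ∧
    D ^ n * q = q * D ^ n + (n : ℂ) • (m * D ^ (n - 1)) +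
      ((n : ℂ) * (n - 1) / 2 * B) • D ^ (n - 2) := by
  have h1 : ∀ n : ℕ, D ^ n * m = m * D ^ n + ((n : ℂ) * B) • D ^ (n - 1) := by
    intro n
    induction n with
    | zero => simp
    | succ n ih =>
      rw [pow_succ', mul_assoc, ih, mul_add, ← mul_assoc, hm, mul_smul_comm, ← pow_succ', add_mul,
        mul_assoc, ← pow_succ', smul_mul_assoc, one_mul, add_assoc, Nat.add_sub_cancel]
      congr 1
      rcases n with _ | n
      · simp
      · rw [Nat.add_sub_cancel, ← add_smul]; push_cast; ring_nf
  refine ⟨h1 n, ?_⟩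
  induction n with
  | zero => simp
  | succ n ih =>
    rw [pow_succ, mul_assoc, hq, mul_add, ← mul_assoc, ih, h1]
    rcases n with _ | _ | n
    · simp
    · simp [add_mul, mul_assoc, pow_succ]
      module
    · simp only [Nat.add_sub_cancel, add_mul, smul_mul_assoc, mul_assoc, ← pow_succ,
        show n + 1 + 1 + 1 - 2 = n + 1 from rfl, show n + 1 + 1 - 2 = n from rfl,
        show n + 1 + 1 - 1 = n + 1 from rfl]
      push_cast
      module

/-- An `sl₂` computation. In the second relation `E` is kept to the right of the power of `X`, next
to the function on which the total Euler operator acts as a scalar. -/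
theorem pow_mul_of_commutator_euler {X q E : R} {c : ℂ} (hq : X * q = q * X + E + c • 1)
    (hE : X * E = E * X + (2 : ℂ) • X) (n : ℕ) :
    X ^ n * E = E * X ^ n + (2 * n : ℂ) • X ^ n ∧
    X ^ n * q = q * X ^ n + (n : ℂ) • (X ^ (n - 1) * E) +
      ((n : ℂ) * (c - n + 1)) • X ^ (n - 1) := by
  have h1 : ∀ n : ℕ, X ^ n * E = E * X ^ n + (2 * n : ℂ) • X ^ n := by
    intro n
    induction n with
    | zero => simp
    | succ n ih =>
      rw [pow_succ, mul_assoc, hE, mul_add, ← mul_assoc, ih, mul_smul_comm, add_mul, smul_mul_assoc,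
        mul_assoc, ← pow_succ]
      push_cast
      module
  refine ⟨h1 n, ?_⟩
  induction n with
  | zero => simp
  | succ n ih =>
    rw [pow_succ, mul_assoc, hq, mul_add, mul_add, ← mul_assoc, ih]
    rcases n with _ | n
    · simp
    · have h2 : X ^ n * E * X = X ^ (n + 1) * E - (2 : ℂ) • X ^ (n + 1) := by
        rw [pow_succ, mul_assoc, mul_assoc, hE, mul_add, mul_smul_comm]
        abel
      simp only [Nat.add_sub_cancel, add_mul, smul_mul_assoc, mul_assoc, ← pow_succ, mul_smul_comm,
        mul_one]
      rw [← mul_assoc, h2]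
      push_cast
      module

/-- Moving the quadratic form through `Dᵐ Δⁿ` and evaluating on the cone. -/
theorem eval_pow_mul_quad {D X q m EV EP : R} {B c e : ℂ} (φ : R →ₗ[ℂ] ℂ)
    (hXq : X * q = q * X + EV + c • 1) (hDq : D * q = q * D + m) (hDm : D * m = m * D + B • 1)
    (hXE : X * EV = EV * X + (2 : ℂ) • X) (hDX : D * X = X * D) (hDP : D * EP = EP * D + D)
    (hXP : X * EP = EP * X) (hφq : ∀ r, φ (q * r) = 0) (hφm : ∀ r, φ (m * r) = 0)
    (hφP : ∀ r, φ (EP * r) = 0) (hφE : ∀ r, φ (r * (EV + EP)) = e * φ r) (i n : ℕ) :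
    φ (D ^ i * X ^ n * q) = (i : ℂ) * (i - 1) / 2 * B * φ (D ^ (i - 2) * X ^ n) +
      n * (e - i + c - n + 1) * φ (D ^ i * X ^ (n - 1)) := by
  have hcomm : ∀ i, Commute (D ^ i) (X ^ n) := fun i => (Commute.pow_pow hDX i n)
  have hXPn : ∀ n, X ^ n * EP = EP * X ^ n := fun n => Commute.pow_left hXP n
  have hDPn : ∀ i : ℕ, D ^ i * EP = EP * D ^ i + (i : ℂ) • D ^ i := by
    intro i
    induction i with
    | zero => simp
    | succ i ih =>
      rw [pow_succ, mul_assoc, hDP, mul_add, ← mul_assoc, ih, add_mul, smul_mul_assoc, mul_assoc,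
        ← pow_succ]
      push_cast
      module
  -- Write `EV = (EV + EP) - EP`. The sum acts on the right as `e`; moving `EP` to the left, where
  -- `φ` kills it, costs `i` because it commutes with `X` and each `D` contributes one.
  have hEV : φ (D ^ i * (X ^ (n - 1) * EV)) = (e - i) * φ (D ^ i * X ^ (n - 1)) := by
    have h1 := hφE (D ^ i * X ^ (n - 1))
    rw [mul_add, map_add, mul_assoc, mul_assoc, hXPn, ← mul_assoc (D ^ i) EP, hDPn, add_mul, map_add,
      mul_assoc, hφP, zero_add, smul_mul_assoc, map_smul, smul_eq_mul] at h1
    linear_combination h1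
  rw [mul_assoc, (pow_mul_of_commutator_euler hXq hXE n).2, mul_add, mul_add, map_add, map_add,
    mul_smul_comm, mul_smul_comm, map_smul, map_smul, hEV, ← mul_assoc,
    (pow_mul_of_commutator hDq hDm i).2, add_mul, add_mul, map_add, map_add, mul_assoc, hφq,
    smul_mul_assoc, map_smul, mul_assoc, hφm, smul_mul_assoc, map_smul]
  simp only [smul_eq_mul]
  ring

/-- Passing from `(n, m + 2)` to `(n + 1, m)` lowers `n₁ + n₂` by one, so the Pochhammer product
loses exactly the factor `s + n + 1 + m`. The remaining factors come from the factorials and the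
sign. -/
theorem gegenbauerCoeff_succ (s : ℂ) (n m : ℕ) :
    gegenbauerCoeff s (2 * n + m + 2) (n + 1) m * ((n + 1) * (s + n + 1 + m)) =
      -(gegenbauerCoeff s (2 * n + m + 2) n (m + 2) * ((m + 2) * (m + 1))) := by
  have h1 : n + 1 + m - (2 * n + m + 2 + 1) / 2 + 1 = n + (m + 2) - (2 * n + m + 2 + 1) / 2 := by
    omega
  have h2 : ((n + 1 + m - (2 * n + m + 2 + 1) / 2 : ℕ) : ℂ) + ((2 * n + m + 2 + 1) / 2 : ℕ) =
      n + 1 + m := by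
    rw [← Nat.cast_add, Nat.sub_add_cancel (by omega)]; push_cast; ring
  rw [gegenbauerCoeff, gegenbauerCoeff, ← h1, ascPochhammer_succ_eval, Nat.factorial_succ n,
    Nat.factorial_succ (m + 1), Nat.factorial_succ m]
  have hn : (n.factorial : ℂ) ≠ 0 := Nat.cast_ne_zero.2 n.factorial_ne_zero
  have hm : (m.factorial : ℂ) ≠ 0 := Nat.cast_ne_zero.2 m.factorial_ne_zero
  have hn1 : (n + 1 : ℂ) ≠ 0 := by exact_mod_cast n.succ_ne_zero
  have hm1 : (m + 1 : ℂ) ≠ 0 := by exact_mod_cast m.succ_ne_zero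
  have hm2 : (m + 1 + 1 : ℂ) ≠ 0 := by exact_mod_cast (m + 1).succ_ne_zero
  have h3 : s + ((2 * n + m + 2 + 1) / 2 : ℕ) + ((n + 1 + m - (2 * n + m + 2 + 1) / 2 : ℕ) : ℂ) =
      s + n + 1 + m := by linear_combination h2
  rw [h3]
  push_cast
  field_simp
  ring

/-- Sums over `2 n₁ + n₂ = N` as sums over `n₁`. -/
theorem sum_filter_two_mul_add (N : ℕ) (g : ℕ → ℕ → ℂ) :
    ∑ n ∈ (Finset.range (N + 1) ×ˢ Finset.range (N + 1)).filter (fun n => 2 * n.1 + n.2 = N),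
      g n.1 n.2 = ∑ n ∈ Finset.range (N / 2 + 1), g n (N - 2 * n) := by
  symm
  refine Finset.sum_bij (fun n _ => (n, N - 2 * n)) (fun n hn => ?_) (fun n _ m _ h => ?_)
    (fun n hn => ?_) (fun n _ => rfl)
  · simp only [Finset.mem_range] at hn
    simp only [Finset.mem_filter, Finset.mem_product, Finset.mem_range]
    omega
  · exact congrArg Prod.fst h
  · simp only [Finset.mem_filter, Finset.mem_product, Finset.mem_range] at hn
    refine ⟨n.1, ?_, ?_⟩
    · simp only [Finset.mem_range]; omega
    · ext
      · rfl
      · simp only; omega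

/-- Each summand splits into a part `A n`, in which `D` has acted twice on `q`, and a part `C n`, in
which `X` has. The choice of `s` makes `A n` cancel `C (n + 1)` by the recursion of the
coefficients. -/
theorem eval_gegenbauer_mul_quad {D X q m EV EP : R} {B c e : ℂ} (φ : R →ₗ[ℂ] ℂ)
    (hXq : X * q = q * X + EV + c • 1) (hDq : D * q = q * D + m) (hDm : D * m = m * D + B • 1)
    (hXE : X * EV = EV * X + (2 : ℂ) • X) (hDX : D * X = X * D) (hDP : D * EP = EP * D + D)
    (hXP : X * EP = EP * X) (hφq : ∀ r, φ (q * r) = 0) (hφm : ∀ r, φ (m * r) = 0)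
    (hφP : ∀ r, φ (EP * r) = 0) (hφE : ∀ r, φ (r * (EV + EP)) = e * φ r) (N : ℕ) :
    ∑ n ∈ Finset.range (N / 2 + 1), gegenbauerCoeff (-(e + c + 1)) N n (N - 2 * n) *
      (-B / 2) ^ n * φ (D ^ (N - 2 * n) * X ^ n * q) = 0 := by
  set s := -(e + c + 1) with hs
  set A : ℕ → ℂ := fun n => gegenbauerCoeff s N n (N - 2 * n) * (-B / 2) ^ n *
    (((N - 2 * n : ℕ) : ℂ) * ((N - 2 * n : ℕ) - 1) / 2 * B * φ (D ^ (N - 2 * n - 2) * X ^ n)) with hA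
  set C : ℕ → ℂ := fun n => gegenbauerCoeff s N n (N - 2 * n) * (-B / 2) ^ n *
    (n * (e - (N - 2 * n : ℕ) + c - n + 1) * φ (D ^ (N - 2 * n) * X ^ (n - 1))) with hC
  have h1 : ∀ n, gegenbauerCoeff s N n (N - 2 * n) * (-B / 2) ^ n *
      φ (D ^ (N - 2 * n) * X ^ n * q) = A n + C n := by
    intro n
    rw [eval_pow_mul_quad φ hXq hDq hDm hXE hDX hDP hXP hφq hφm hφP hφE, mul_add]
  simp only [h1, Finset.sum_add_distrib]
  rw [Finset.sum_range_succ, Finset.sum_range_succ' C]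
  -- At the top index at most one `D` is left, so the factor `i (i - 1)` vanishes; at the bottom `C
  -- 0` has the factor `n = 0`.
  have h2 : A (N / 2) = 0 := by
    have : N - 2 * (N / 2) = 0 ∨ N - 2 * (N / 2) = 1 := by omega
    rcases this with h | h <;> simp [hA, h]
  have h3 : C 0 = 0 := by simp [hC]
  rw [h2, h3, add_zero, add_zero, ← Finset.sum_add_distrib]
  refine Finset.sum_eq_zero fun n hn => ?_
  rw [Finset.mem_range] at hn
  obtain ⟨i, rfl⟩ : ∃ i, N = 2 * n + i + 2 := ⟨N - 2 * n - 2, by omega⟩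
  have e1 : 2 * n + i + 2 - 2 * n = i + 2 := by omega
  have e2 : 2 * n + i + 2 - 2 * (n + 1) = i := by omega
  have h4 := gegenbauerCoeff_succ s n i
  simp only [hA, hC, e1, e2, Nat.add_sub_cancel]
  rw [pow_succ]
  push_cast
  have h5 : e - i + c - (n + 1) + 1 = -(s + n + 1 + i) := by rw [hs]; ring
  rw [h5]
  linear_combination (B / 2 * (-B / 2) ^ n * φ (D ^ i * X ^ n)) * h4

end Weyl

/-! ### The commutation relations for concrete differential operators -/

section Annihilation

open TopologicalSpace (Opens)

variable {E : Type*} [NormedAddCommGroup E] [NormedSpace ℂ E] {U : Opens E}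
  (β : E →L[ℂ] E →L[ℂ] ℂ)

theorem contDiff_half_form : ContDiff ℂ (⊤ : ℕ∞) fun x => 1 / 2 * β x x :=
  contDiff_const.mul (β.contDiff.clm_apply contDiff_id)

theorem fderiv_half_form (hβ : ∀ x y, β x y = β y x) (x a : E) :
    fderiv ℂ (fun x => 1 / 2 * β x x) x a = β a x := by
  have h1 : HasFDerivAt (fun x => β x x) (β.flip x + β x) x := by
    have := (β.hasFDerivAt (x := x)).clm_apply (hasFDerivAt_id x)
    refine this.congr_fderiv ?_
    ext a
    simp [add_comm]
  rw [(h1.const_mul (1 / 2)).fderiv]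
  simp only [smul_apply, add_apply, ContinuousLinearMap.flip_apply, smul_eq_mul]
  rw [hβ x a]; ring

variable {α : Type*} [Fintype α] [DecidableEq α] (C : Matrix α α ℂ) (w : α → E)

/-- The projection to the span of `w`, where `C` is the inverse Gram matrix of `w`. -/
noncomputable def spanProj : E →L[ℂ] E :=
  ∑ i, ∑ j, C i j • (β (w i)).smulRight (w j)

theorem spanProj_apply (x : E) : spanProj β C w x = ∑ i, ∑ j, (C i j * β (w i) x) • w j := by
  simp [spanProj, smul_smul]

theorem spanProj_eq_zero {x : E} (h : ∀ i, β (w i) x = 0) : spanProj β C w x = 0 := by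
  simp [spanProj_apply, h]

theorem spanProj_basis (hCw : ∀ j k, ∑ i, C i j * β (w i) (w k) = if j = k then 1 else 0) (k : α) :
    spanProj β C w (w k) = w k := by
  rw [spanProj_apply, Finset.sum_comm]
  simp only [← Finset.sum_smul, hCw, ite_smul, one_smul, zero_smul, Finset.sum_ite_eq',
    Finset.mem_univ, if_true]

theorem linD_spanProj : linD U (spanProj β C w) =
    ∑ i, ∑ j, C i j • (mulOp U (β (w i)) (β (w i)).contDiff * dirD U (w j)) := by
  refine LinearMap.ext fun f => Smooth.ext_on fun x hx => ?_
  rw [linD_apply _ _ hx, spanProj_apply]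
  simp only [map_sum, map_smul, LinearMap.sum_apply, LinearMap.smul_apply, Module.End.mul_apply,
    Submodule.coe_sum, Submodule.coe_smul, Finset.sum_apply, Pi.smul_apply, mulOp_apply,
    dirD_apply _ _ hx, smul_eq_mul, mul_assoc]

theorem secondOp_mul_linD (A : E →L[ℂ] E) :
    secondOp U C w * linD U A = linD U A * secondOp U C w +
      (1 / 2 : ℂ) • ∑ i, ∑ j, C i j • (dirD U (A (w i)) * dirD U (w j) +
        dirD U (w i) * dirD U (A (w j))) := by
  simp only [secondOp, mul_smul_comm, smul_mul_assoc, Finset.mul_sum, Finset.sum_mul]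
  rw [← smul_add, ← Finset.sum_add_distrib]
  congr 1
  refine Finset.sum_congr rfl fun i _ => ?_
  rw [← Finset.sum_add_distrib]
  refine Finset.sum_congr rfl fun j _ => ?_
  rw [← smul_add, mul_assoc, dirD_mul_linD, mul_add, ← mul_assoc, dirD_mul_linD, add_mul, mul_assoc]
  congr 1
  abel

/-- The Leibniz rule for the Laplacian: the mixed first-order terms assemble to the Euler field of
the span, and the second derivatives of `Q` to half the trace of an identity matrix. -/
theorem secondOp_mul_quad (hβ : ∀ x y, β x y = β y x) (hC : ∀ i j, C i j = C j i)
    (hCw : ∀ j k, ∑ i, C i j * β (w i) (w k) = if j = k then 1 else 0) :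
    secondOp U C w * mulOp U _ (contDiff_half_form β) =
      mulOp U _ (contDiff_half_form β) * secondOp U C w + linD U (spanProj β C w) +
        ((Fintype.card α : ℂ) / 2) • 1 := by
  set q := mulOp U _ (contDiff_half_form β) with hq
  set D := fun i => dirD U (w i) with hD
  set M := fun i => mulOp U (β (w i)) (β (w i)).contDiff with hM
  have h1 : ∀ i, D i * q = q * D i + M i := fun i =>
    dirD_mul_mulOp _ _ _ fun x => fderiv_half_form β hβ x _
  have h2 : ∀ i j, D i * M j = M j * D i + β (w i) (w j) • 1 := fun i j => by
    have := dirD_mul_mulOp (U := U) (w i) (β (w j)).contDiff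
      (contDiff_const (c := β (w i) (w j))) (fun x => by
        rw [ContinuousLinearMap.fderiv, hβ])
    rwa [mulOp_const] at this
  have h3 : ∀ i j, D i * D j * q = q * (D i * D j) + (M i * D j + M j * D i) +
      β (w i) (w j) • 1 := by
    intro i j
    rw [mul_assoc, h1, mul_add, ← mul_assoc, h1, h2, add_mul, mul_assoc]
    abel
  have h4 : ∑ i, ∑ j, C i j • (M j * D i) = ∑ i, ∑ j, C i j • (M i * D j) := by
    rw [Finset.sum_comm]
    exact Finset.sum_congr rfl fun i _ => Finset.sum_congr rfl fun j _ => by rw [hC]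
  have h5 : ∑ i, ∑ j, C i j * β (w i) (w j) = Fintype.card α := by
    rw [Finset.sum_comm]
    simp [hCw]
  rw [linD_spanProj]
  simp only [secondOp, mul_smul_comm, smul_mul_assoc, Finset.mul_sum, Finset.sum_mul]
  change (1 / 2 : ℂ) • ∑ i, ∑ j, C i j • (D i * D j * q) = (1 / 2 : ℂ) • ∑ i, ∑ j,
    C i j • (q * (D i * D j)) + ∑ i, ∑ j, C i j • (M i * D j) + _
  simp only [h3, smul_add, Finset.sum_add_distrib, h4, smul_smul, ← Finset.sum_smul, h5]
  module

/-- The Gegenbauer operator in a direction normal to the span of `w` kills `q Ψ` at points of the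
cone in that span, if `Ψ` is homogeneous of the right degree. -/
theorem gegenbauer_mul_quad_eq_zero (hβ : ∀ x y, β x y = β y x) (hC : ∀ i j, C i j = C j i)
    (hCw : ∀ j k, ∑ i, C i j * β (w i) (w k) = if j = k then 1 else 0) {v x₀ : E}
    (hx₀ : x₀ ∈ U) (hwv : ∀ i, β (w i) v = 0) (hq₀ : β x₀ x₀ = 0) (hv₀ : β v x₀ = 0)
    {A : E →L[ℂ] E} (hAw : ∀ i, A (w i) = w i) (hAv : A v = v)
    (hA₀ : A x₀ = spanProj β C w x₀) {Ψ : Smooth U} {e : ℂ} (hΨ : linD U A Ψ = e • Ψ) (N : ℕ) :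
    ∑ n ∈ Finset.range (N / 2 + 1),
      gegenbauerCoeff (-(e + (Fintype.card α : ℂ) / 2 + 1)) N n (N - 2 * n) * (-β v v / 2) ^ n *
        ((dirD U v ^ (N - 2 * n) * secondOp U C w ^ n) (mulOp U _ (contDiff_half_form β) Ψ) :
          E → ℂ) x₀ = 0 := by
  -- Apply an operator to `Ψ` and evaluate at `x₀`. At this point `Q`, the form `⟨v, ·⟩` and the
  -- vector field complementary to the span all vanish.
  let φ : Module.End ℂ (Smooth U) →ₗ[ℂ] ℂ :=
    { toFun := fun r => (r Ψ : E → ℂ) x₀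
      map_add' := fun _ _ => rfl
      map_smul' := fun _ _ => rfl }
  have hφ : ∀ r, φ r = (r Ψ : E → ℂ) x₀ := fun _ => rfl
  -- The field `A`, for which `Ψ` is homogeneous, splits into its part along the span and a
  -- complementary part that fixes `v`.
  have hEP : linD U (spanProj β C w) + linD U (A - spanProj β C w) = linD U A := by
    rw [← linD_add]; congr 1; abel
  have hPw : ∀ i, spanProj β C w (w i) = w i := spanProj_basis β C w hCw
  have hPv : spanProj β C w v = 0 := spanProj_eq_zero β C w hwv
  refine eval_gegenbauer_mul_quad (q := mulOp U _ (contDiff_half_form β))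
    (m := mulOp U (β v) (β v).contDiff) (EV := linD U (spanProj β C w))
    (EP := linD U (A - spanProj β C w)) φ
    (secondOp_mul_quad β C w hβ hC hCw)
    (dirD_mul_mulOp _ _ _ fun x => fderiv_half_form β hβ x _) ?_ ?_ (dirD_comm_secondOp C w v)
    ?_ ?_ ?_ ?_ ?_ ?_ N
  · have := dirD_mul_mulOp (U := U) v (β v).contDiff
      (contDiff_const (c := β v v)) (fun x => by rw [ContinuousLinearMap.fderiv])
    rwa [mulOp_const] at this
  · rw [secondOp_mul_linD]
    congr 1
    simp only [hPw, ← two_smul ℂ (dirD U (w _) * dirD U (w _))]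
    simp only [smul_comm _ (2 : ℂ), ← Finset.smul_sum]
    rw [secondOp, smul_comm]
  · rw [dirD_mul_linD, sub_apply, hAv, hPv, sub_zero]
  · rw [secondOp_mul_linD]
    simp [hPw, hAw, dirD_zero]
  · intro r
    rw [hφ, Module.End.mul_apply, mulOp_apply, hq₀, mul_zero, zero_mul]
  · intro r
    rw [hφ, Module.End.mul_apply, mulOp_apply, hv₀, zero_mul]
  · intro r
    rw [hφ, Module.End.mul_apply, linD_apply _ _ hx₀, sub_apply, hA₀, sub_self,
      map_zero]
  · intro r
    rw [hφ, Module.End.mul_apply, hEP, hΨ, map_smul]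
    rfl

end Annihilation

/-! ### The pullback operator through operators on smooth functions -/

section RawOperators

open TopologicalSpace (Opens)

variable {E : Type*} [NormedAddCommGroup E] [NormedSpace ℂ E] {U : Opens E}

theorem Smooth.eventuallyEq_of_eqOn {f : Smooth U} {g : E → ℂ} (h : ∀ x ∈ U, g x = (f : E → ℂ) x)
    {x : E} (hx : x ∈ U) : g =ᶠ[𝓝 x] (f : E → ℂ) := by
  filter_upwards [U.isOpen.mem_nhds hx] with y hy using h y hy

theorem iteratedFDeriv_two_eq_dirD {f : Smooth U} {g : E → ℂ} (h : ∀ x ∈ U, g x = (f : E → ℂ) x)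
    {x : E} (hx : x ∈ U) (a c : E) :
    iteratedFDeriv ℂ 2 g x ![a, c] = (dirD U a (dirD U c f) : E → ℂ) x := by
  rw [(EventuallyEq.iteratedFDeriv (𝕜 := ℂ) (Smooth.eventuallyEq_of_eqOn h hx) 2).eq_of_nhds, iteratedFDeriv_two_apply,
    show dirD U c f = lie U _ contDiff_const f from rfl, dirD_lie_apply _ _ _ hx]
  simp

theorem iteratedFDeriv_const_eq_dirD_pow {f : Smooth U} {g : E → ℂ}
    (h : ∀ x ∈ U, g x = (f : E → ℂ) x) {x : E} (hx : x ∈ U) (a : E) (n : ℕ) :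
    iteratedFDeriv ℂ n g x (fun _ => a) = ((dirD U a ^ n) f : E → ℂ) x := by
  have key : ∀ n, ∀ x ∈ U, iteratedFDeriv ℂ n (f : E → ℂ) x (fun _ => a) =
      ((dirD U a ^ n) f : E → ℂ) x := by
    intro n
    induction n with
    | zero => intro x _; simp
    | succ n ih =>
      intro x hx
      have hd : DifferentiableAt ℂ (iteratedFDeriv ℂ n (f : E → ℂ)) x :=
        (Smooth.contDiffAt f hx).differentiableAt_iteratedFDeriv
          (by exact_mod_cast WithTop.coe_lt_top n)
      rw [pow_succ', Module.End.mul_apply, dirD_apply _ _ hx, iteratedFDeriv_succ_apply_left]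
      have h1 : (((dirD U a ^ n) f : Smooth U) : E → ℂ) =ᶠ[𝓝 x]
          fun z => (ContinuousMultilinearMap.apply ℂ (fun _ : Fin n => E) ℂ (fun _ => a))
            (iteratedFDeriv ℂ n (f : E → ℂ) z) := by
        filter_upwards [U.isOpen.mem_nhds hx] with y hy using (ih y hy).symm
      rw [h1.fderiv_eq, fderiv_fun_comp x (ContinuousLinearMap.differentiableAt _) hd]
      simp
      rfl
  rw [(EventuallyEq.iteratedFDeriv (𝕜 := ℂ) (Smooth.eventuallyEq_of_eqOn h hx) n).eq_of_nhds, key n x hx]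

end RawOperators

/-! ### The pullback operator on equal arguments -/

section RawPullback

open TopologicalSpace (Opens)

variable {ι κ κ' : Type*} [Fintype ι] [DecidableEq ι] [Fintype κ] [DecidableEq κ] [Fintype κ']
  [DecidableEq κ'] {S : Matrix ι ι ℤ} {L : Submodule ℤ (ι → ℤ)} (b : Basis κ ℤ L)
  (b' : Basis κ' ℤ (orthLattice S L)) {U : Opens (ι → ℂ)}

/-- The Laplace operator along `L` on smooth functions. -/
noncomputable def lapOp (S : Matrix ι ι ℤ) {L : Submodule ℤ (ι → ℤ)} (b : Basis κ ℤ L)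
    (U : Opens (ι → ℂ)) : Module.End ℂ (Smooth U) :=
  secondOp U ((subGram S b).map (Int.cast : ℤ → ℂ))⁻¹ fun i => embed b (Pi.single i 1)

theorem laplacian_eq_lapOp {f : Smooth U} {g : (ι → ℂ) → ℂ}
    (h : ∀ x ∈ U, g x = (f : (ι → ℂ) → ℂ) x) {x : ι → ℂ} (hx : x ∈ U) :
    laplacian S b g x = (lapOp S b U f : (ι → ℂ) → ℂ) x := by
  rw [laplacian, lapOp, secondOp]
  simp only [LinearMap.sum_apply, LinearMap.smul_apply, Module.End.mul_apply,
    Submodule.coe_sum, Submodule.coe_smul, Finset.sum_apply, Pi.smul_apply, smul_eq_mul,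
    iteratedFDeriv_two_eq_dirD h hx]

theorem laplacian_iterate_eq_lapOp_pow {f : Smooth U} {g : (ι → ℂ) → ℂ}
    (h : ∀ x ∈ U, g x = (f : (ι → ℂ) → ℂ) x) (n : ℕ) :
    ∀ x ∈ U, (laplacian S b)^[n] g x = ((lapOp S b U ^ n) f : (ι → ℂ) → ℂ) x := by
  induction n with
  | zero => exact h
  | succ n ih =>
    intro x hx
    rw [Function.iterate_succ_apply', pow_succ', Module.End.mul_apply]
    exact laplacian_eq_lapOp b ih hx

theorem card_slots (N n m : ℕ) (h : 2 * n + m = N) :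
    Fintype.card (Fin m ⊕ Fin n × Fin 2 ≃ Fin N) = N.factorial := by
  have e : Fin N ≃ Fin m ⊕ Fin n × Fin 2 := Fintype.equivOfCardEq (by simp; omega)
  rw [Fintype.card_equiv e.symm]
  simp; congr 1; omega

/-- For equal arguments all `N!` assignments of slots give the same term, and their number cancels
the averaging factor. -/
theorem pullbackOperator_diag {f : Smooth U} {g : (ι → ℂ) → ℂ}
    (h : ∀ x ∈ U, g x = (f : (ι → ℂ) → ℂ) x) {z : κ → ℂ} (hz : embed b z ∈ U) (k : ℤ) (N : ℕ)
    (v : κ' → ℂ) :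
    pullbackOperator S b b' k N g z (fun _ => v) = (2 * Real.pi * Complex.I) ^ (-(N : ℤ)) *
      ∑ n ∈ Finset.range (N / 2 + 1),
        gegenbauerCoeff ((k : ℂ) - (Fintype.card κ : ℂ) / 2) N n (N - 2 * n) *
        (-form (subGram S b') ℂ v v / 2) ^ n *
        ((dirD U (embed b' v) ^ (N - 2 * n) * lapOp S b U ^ n) f : (ι → ℂ) → ℂ) (embed b z) := by
  rw [pullbackOperator, gegenbauerSum, ← sum_filter_two_mul_add N fun n m =>
    gegenbauerCoeff ((k : ℂ) - (Fintype.card κ : ℂ) / 2) N n m *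
        (-form (subGram S b') ℂ v v / 2) ^ n *
        ((dirD U (embed b' v) ^ m * lapOp S b U ^ n) f : (ι → ℂ) → ℂ) (embed b z)]
  congr 1
  refine Finset.sum_congr rfl fun n hn => ?_
  rw [mul_assoc]
  congr 1
  simp only [iteratedFDeriv_const_eq_dirD_pow (laplacian_iterate_eq_lapOp_pow b h n.1) hz,
    Finset.prod_const, Finset.sum_const, Finset.card_univ, Fintype.card_fin,
    card_slots N n.1 n.2 (Finset.mem_filter.1 hn).2, Module.End.mul_apply, nsmul_eq_mul]
  have : (N.factorial : ℂ) ≠ 0 := Nat.cast_ne_zero.2 N.factorial_ne_zero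
  field_simp

end RawPullback

/-! ### Slices of the cone -/

section Slice

open TopologicalSpace (Opens)

variable {ι κ κ' : Type*} [Fintype ι] [DecidableEq ι] [Fintype κ] [DecidableEq κ] [Fintype κ']
  [DecidableEq κ'] {S : Matrix ι ι ℤ} {L : Submodule ℤ (ι → ℤ)} (b : Basis κ ℤ L)

theorem extGram_inv {T : Matrix κ κ ℤ} (hT : (T.map (Int.cast : ℤ → ℂ)).det ≠ 0) :
    ((extGram T).map (Int.cast : ℤ → ℂ))⁻¹ = Matrix.of fun
      | Sum.inl _, Sum.inr (Sum.inr _) => 1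
      | Sum.inr (Sum.inl i), Sum.inr (Sum.inl j) => (T.map (Int.cast : ℤ → ℂ))⁻¹ i j
      | Sum.inr (Sum.inr _), Sum.inl _ => 1
      | _, _ => 0 := by
  refine Matrix.inv_eq_right_inv ?_
  have h1 := Matrix.mul_nonsing_inv _ (Ne.isUnit hT)
  ext (_ | i | _) (_ | j | _)
  any_goals simp [Matrix.mul_apply, Fintype.sum_sum_type, extGram, Matrix.one_apply]
  have := congrFun (congrFun h1 i) j
  rw [Matrix.mul_apply, Matrix.one_apply] at this
  simpa using this

/-- The Laplace operator along `L ⊕ II_{1,1}`. -/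
noncomputable def coneLap (S : Matrix ι ι ℤ) {L : Submodule ℤ (ι → ℤ)} (b : Basis κ ℤ L)
    (U : Opens (Ext ι → ℂ)) : Module.End ℂ (Smooth U) :=
  secondOp U ((extGram (subGram S b)).map (Int.cast : ℤ → ℂ))⁻¹
    fun i => ((extBasis b).map (Int.cast : ℤ → ℂ)).mulVec (Pi.single i 1)

theorem single_inl {K : Type*} [Field K] :
    (Pi.single (Sum.inl ()) 1 : Ext κ → K) = extVec 1 0 0 := by
  ext (_ | _ | _) <;> simp [extVec]

theorem single_mid {K : Type*} [Field K] (i : κ) :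
    (Pi.single (Sum.inr (Sum.inl i)) 1 : Ext κ → K) = extVec 0 (Pi.single i 1) 0 := by
  ext (_ | j | _)
  · simp
  · by_cases h : j = i
    · subst h; simp
    · simp [h]
  · simp

theorem single_inr {K : Type*} [Field K] :
    (Pi.single (Sum.inr (Sum.inr ())) 1 : Ext κ → K) = extVec 0 0 1 := by
  ext (_ | _ | _) <;> simp [extVec]

/-- The hyperbolic plane contributes `∂_c ∂_a`, which disappears on functions that do not depend on
`a`. -/
theorem coneLap_eq (hd : ((subGram S b).map (Int.cast : ℤ → ℂ)).det ≠ 0) (U : Opens (Ext ι → ℂ)) :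
    coneLap S b U = dirD U (extVec 0 0 1) * dirD U (extVec 1 0 0) +
      secondOp U ((subGram S b).map (Int.cast : ℤ → ℂ))⁻¹
        fun i => extVec 0 (embed b (Pi.single i 1)) 0 := by
  rw [coneLap, extGram_inv hd, secondOp, secondOp]
  simp only [Fintype.sum_sum_type, Finset.univ_unique, Finset.sum_singleton, PUnit.default_eq_unit,
    single_inl, single_mid, single_inr, extBasis_mulVec, embed_zero, Matrix.of_apply, zero_smul,
    one_smul, zero_add, add_zero, Finset.sum_const_zero]
  rw [dirD_comm (extVec 1 0 0)]
  module

/-- The embedding `u ↦ (0, u, 0)`. -/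
noncomputable def extIncl (ι : Type*) [Fintype ι] : (ι → ℂ) →L[ℂ] (Ext ι → ℂ) :=
  LinearMap.toContinuousLinearMap
    { toFun := fun u => extVec 0 u 0
      map_add' := fun u v => by ext (_ | _ | _) <;> simp [extVec]
      map_smul' := fun c u => by ext (_ | _ | _) <;> simp [extVec] }

theorem extIncl_apply (u : ι → ℂ) : extIncl ι u = extVec 0 u 0 := rfl

theorem pow_apply_of_semiconj {V W : Type*} [AddCommGroup V] [Module ℂ V] [AddCommGroup W]
    [Module ℂ W] {P : Module.End ℂ V} {P' : Module.End ℂ W} {A : V →ₗ[ℂ] W} {d : ℂ}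
    (h : ∀ g, P' (A g) = d • A (P g)) (n : ℕ) (g : V) :
    (P' ^ n) (A g) = d ^ n • A ((P ^ n) g) := by
  induction n with
  | zero => simp
  | succ n ih =>
    rw [pow_succ', Module.End.mul_apply, ih, map_smul, h, smul_smul, ← pow_succ, pow_succ' P,
      Module.End.mul_apply]

theorem secondOp_smul {E : Type*} [NormedAddCommGroup E] [NormedSpace ℂ E] {U : Opens E}
    {α : Type*} [Fintype α] (C : Matrix α α ℂ) (w : α → E) (c : ℂ) :
    secondOp U C (fun i => c • w i) = c ^ 2 • secondOp U C w := by
  simp only [secondOp, dirD_smul, smul_mul_assoc, mul_smul_comm, Finset.smul_sum, smul_smul]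
  refine Finset.sum_congr rfl fun i _ => Finset.sum_congr rfl fun j _ => ?_
  congr 1
  ring

/-- Restricting to the affine slice `u ↦ c (a, u, 1)` of the cone. -/
theorem slice_apply (hd : ((subGram S b).map (Int.cast : ℤ → ℂ)).det ≠ 0) {U : Opens (Ext ι → ℂ)}
    {U' : Opens (ι → ℂ)} {G : Smooth U} {f : Smooth U'} (hG : dirD U (extVec 1 0 0) G = 0)
    {a c d : ℂ} (h : ∀ u ∈ U', c • extVec a u 1 ∈ U)
    (hGf : ∀ u ∈ U', (G : (Ext ι → ℂ) → ℂ) (c • extVec a u 1) = d * (f : (ι → ℂ) → ℂ) u)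
    (v : ι → ℂ) (m n : ℕ) {u : ι → ℂ} (hu : u ∈ U') :
    c ^ (m + 2 * n) * ((dirD U (extVec 0 v 0) ^ m * coneLap S b U ^ n) G : (Ext ι → ℂ) → ℂ)
        (c • extVec a u 1) =
      d * ((dirD U' v ^ m * lapOp S b U' ^ n) f : (ι → ℂ) → ℂ) u := by
  set X := secondOp U ((subGram S b).map (Int.cast : ℤ → ℂ))⁻¹
    fun i => extVec 0 (embed b (Pi.single i 1)) 0 with hX
  have hcomm : ∀ n, dirD U (extVec 1 0 0) ((X ^ n) G) = 0 := by
    intro n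
    have : Commute (dirD U (extVec 1 0 0)) (X ^ n) := Commute.pow_right (dirD_comm_secondOp _ _ _) n
    rw [← Module.End.mul_apply, this.eq, Module.End.mul_apply, hG, map_zero]
  -- Independence of `a` is preserved by the operator `X`, so the hyperbolic term drops out at every
  -- step of the iteration.
  have hlap : ∀ n, (coneLap S b U ^ n) G = (X ^ n) G := by
    intro n
    induction n with
    | zero => rfl
    | succ n ih =>
      rw [pow_succ', Module.End.mul_apply, ih, coneLap_eq b hd, LinearMap.add_apply,
        Module.End.mul_apply, hcomm, map_zero, zero_add, pow_succ', Module.End.mul_apply]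
  have hpt : ∀ u, (c • extIncl ι) u + c • extVec a 0 1 = c • extVec a u 1 := by
    intro u
    rw [smul_apply, extIncl_apply, ← smul_add]
    congr 1
    ext (_ | _ | _) <;> simp [extVec]
  have h' : ∀ u ∈ U', (c • extIncl ι) u + c • extVec a 0 1 ∈ U := fun u hu => by
    rw [hpt]; exact h u hu
  set A := pullAffine (c • extIncl ι) (c • extVec a 0 1) h' with hA
  have hAG : A G = d • f := by
    refine Smooth.ext_on fun u hu => ?_
    rw [pullAffine_apply _ _ hu, hpt, hGf u hu]
    rfl
  -- By the chain rule along `u ↦ c (a, u, 1)` every first derivative brings one factor `c`, hence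
  -- the Laplacian brings `c²`.
  have h1 : ∀ g, dirD U' v (A g) = c • A (dirD U (extVec 0 v 0) g) := by
    intro g
    rw [dirD_pullAffine, smul_apply, extIncl_apply, dirD_smul, LinearMap.smul_apply, map_smul]
  have h2 : ∀ g, lapOp S b U' (A g) = c ^ 2 • A (X g) := by
    intro g
    have : secondOp U ((subGram S b).map (Int.cast : ℤ → ℂ))⁻¹
        (fun i => (c • extIncl ι) (embed b (Pi.single i 1))) = c ^ 2 • X :=
      secondOp_smul _ (fun i => extVec 0 (embed b (Pi.single i 1)) 0) c
    rw [lapOp, secondOp_pullAffine, this, LinearMap.smul_apply, map_smul]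
  have h3 : (dirD U' v ^ m * lapOp S b U' ^ n) (A G) =
      c ^ (m + 2 * n) • A ((dirD U (extVec 0 v 0) ^ m * coneLap S b U ^ n) G) := by
    rw [Module.End.mul_apply, Module.End.mul_apply, hlap, pow_apply_of_semiconj h2, map_smul,
      pow_apply_of_semiconj h1, smul_smul]
    congr 1; ring
  rw [hAG, map_smul] at h3
  have h4 := congrArg (fun g : Smooth U' => (g : (ι → ℂ) → ℂ) u) h3
  simp only [Submodule.coe_smul, Pi.smul_apply, smul_eq_mul, hA,
    pullAffine_apply _ _ hu, hpt] at h4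
  exact h4.symm

end Slice

/-! ### Functions on the cone -/

section Cone

open TopologicalSpace (Opens)

variable {ι : Type*} [Fintype ι] [DecidableEq ι] {S : Matrix ι ι ℤ}

theorem contDiffOn_zpow {E : Type*} [NormedAddCommGroup E] [NormedSpace ℂ E] {g : E → ℂ} {s : Set E}
    (hg : ContDiffOn ℂ (⊤ : ℕ∞) g s) (h0 : ∀ x ∈ s, g x ≠ 0) (k : ℤ) :
    ContDiffOn ℂ (⊤ : ℕ∞) (fun x => g x ^ k) s := by
  cases k with
  | ofNat n => simpa using hg.pow n
  | negSucc n =>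
    simp only [zpow_negSucc]
    exact (hg.pow (n + 1)).inv fun x hx => pow_ne_zero _ (h0 x hx)

/-- The vectors `(a, z, c)` with `c ≠ 0` and `z / c` in the upper half-space. -/
def coneDom (S : Matrix ι ι ℤ) (p : ι → ℝ) : Opens (Ext ι → ℂ) where
  carrier := {Z | Z (Sum.inr (Sum.inr ())) ≠ 0 ∧
    (fun i => (Z (Sum.inr (Sum.inr ())))⁻¹ * Z (Sum.inr (Sum.inl i))) ∈ upperHalf S p}
  is_open' := by
    have h1 : IsOpen {Z : Ext ι → ℂ | Z (Sum.inr (Sum.inr ())) ≠ 0} :=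
      isOpen_ne.preimage (continuous_apply _)
    refine ContinuousOn.isOpen_inter_preimage (f := fun Z : Ext ι → ℂ =>
      fun i => (Z (Sum.inr (Sum.inr ())))⁻¹ * Z (Sum.inr (Sum.inl i))) ?_ h1 (isOpen_upperHalf p)
    refine continuousOn_pi.2 fun i => ContinuousOn.mul ?_ (by fun_prop)
    exact ContinuousOn.inv₀ (by fun_prop) fun Z hZ => hZ

/-- The homogeneous function `(a, z, c) ↦ c^{-k} F(z / c)`. -/
noncomputable def coneFun (k : ℤ) (F : (ι → ℂ) → ℂ) (Z : Ext ι → ℂ) : ℂ :=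
  Z (Sum.inr (Sum.inr ())) ^ (-k) *
    F fun i => (Z (Sum.inr (Sum.inr ())))⁻¹ * Z (Sum.inr (Sum.inl i))

theorem contDiffOn_coneFun {p : ι → ℝ} (k : ℤ) {F : (ι → ℂ) → ℂ}
    (hF : ContDiffOn ℂ (⊤ : ℕ∞) F (upperHalf S p)) :
    ContDiffOn ℂ (⊤ : ℕ∞) (coneFun k F) (coneDom S p) := by
  have h1 : ContDiffOn ℂ (⊤ : ℕ∞) (fun Z : Ext ι → ℂ => Z (Sum.inr (Sum.inr ()))) (coneDom S p) :=
    (contDiff_apply ℂ ℂ _).contDiffOn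
  refine (contDiffOn_zpow h1 (fun Z hZ => hZ.1) (-k)).mul (hF.comp (t := upperHalf S p)
    (f := fun (Z : Ext ι → ℂ) i => (Z (Sum.inr (Sum.inr ())))⁻¹ * Z (Sum.inr (Sum.inl i))) ?_ fun Z hZ => hZ.2)
  exact contDiffOn_pi.2 fun i => (h1.inv fun Z hZ => hZ.1).mul (contDiff_apply ℂ ℂ _).contDiffOn

theorem smul_mem_coneDom {p : ι → ℝ} {Z : Ext ι → ℂ} (hZ : Z ∈ coneDom S p) {c : ℂ} (hc : c ≠ 0) :
    c • Z ∈ coneDom S p := by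
  refine ⟨mul_ne_zero hc hZ.1, ?_⟩
  convert hZ.2 using 2 with i
  simp only [Pi.smul_apply, smul_eq_mul]
  field_simp

theorem coneFun_smul (k : ℤ) (F : (ι → ℂ) → ℂ) {Z : Ext ι → ℂ} {c : ℂ} (hc : c ≠ 0) :
    coneFun k F (c • Z) = c ^ (-k) * coneFun k F Z := by
  have : (fun i => ((c • Z) (Sum.inr (Sum.inr ())))⁻¹ * (c • Z) (Sum.inr (Sum.inl i))) =
      fun i => (Z (Sum.inr (Sum.inr ())))⁻¹ * Z (Sum.inr (Sum.inl i)) := by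
    ext i
    simp only [Pi.smul_apply, smul_eq_mul, mul_inv]
    field_simp
  rw [coneFun, coneFun, this, Pi.smul_apply, smul_eq_mul, mul_zpow, mul_assoc]

theorem coneFun_add_smul (k : ℤ) (F : (ι → ℂ) → ℂ) (Z : Ext ι → ℂ) (s : ℂ) :
    coneFun k F (Z + s • extVec 1 0 0) = coneFun k F Z := by
  simp [coneFun]

theorem coneFun_smul_extVec (k : ℤ) (F : (ι → ℂ) → ℂ) {c : ℂ} (hc : c ≠ 0) (a : ℂ) (u : ι → ℂ) :
    coneFun k F (c • extVec a u 1) = c ^ (-k) * F u := by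
  rw [coneFun_smul k F hc]; simp [coneFun]

theorem smul_extVec_mem_coneDom {p : ι → ℝ} {c : ℂ} (hc : c ≠ 0) (a : ℂ) {u : ι → ℂ}
    (hu : u ∈ upperHalf S p) : c • extVec a u 1 ∈ coneDom S p := by
  refine smul_mem_coneDom ⟨one_ne_zero, ?_⟩ hc
  simpa using hu

theorem moved_mem_coneDom (hS : S.IsSymm) (hΛ : IsLorentzian S) {p : ι → ℝ}
    {M : Matrix (Ext ι) (Ext ι) ℝ} (hM : M ∈ orthGroup S) {z : ι → ℂ} (hz : z ∈ upperHalf S p) :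
    moved S M z ∈ coneDom S p :=
  ⟨autFactor_ne_zero hS hΛ (orthGroup_subset hM) (upperHalf_quad_pos hz),
    moebius_mem_upperHalf hS hΛ hM hz⟩

theorem contDiffOn_slash (hS : S.IsSymm) (hΛ : IsLorentzian S) {p : ι → ℝ} (k : ℤ)
    {F : (ι → ℂ) → ℂ} (hF : ContDiffOn ℂ (⊤ : ℕ∞) F (upperHalf S p))
    {M : Matrix (Ext ι) (Ext ι) ℝ} (hM : M ∈ orthGroup S) :
    ContDiffOn ℂ (⊤ : ℕ∞) (slash S k F M) (upperHalf S p) :=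
  (contDiffOn_coneFun k hF).comp (t := coneDom S p)
    (contDiff_pi.2 fun i => contDiff_moved M i).contDiffOn
    fun _ hz => moved_mem_coneDom hS hΛ hM hz

/-- The upper half-space as an open set. -/
def upperOpens (S : Matrix ι ι ℤ) (p : ι → ℝ) : Opens (ι → ℂ) := ⟨upperHalf S p, isOpen_upperHalf p⟩

/-- A smooth function on the upper half-space. -/
noncomputable def toSmooth {p : ι → ℝ} {F : (ι → ℂ) → ℂ}
    (hF : ContDiffOn ℂ (⊤ : ℕ∞) F (upperHalf S p)) : Smooth (upperOpens S p) :=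
  Smooth.restrict (upperOpens S p) F hF

theorem toSmooth_apply {p : ι → ℝ} {F : (ι → ℂ) → ℂ}
    (hF : ContDiffOn ℂ (⊤ : ℕ∞) F (upperHalf S p)) {u : ι → ℂ} (hu : u ∈ upperOpens S p) :
    (toSmooth hF : (ι → ℂ) → ℂ) u = F u :=
  Smooth.restrict_apply _ hu

theorem dirD_restrict_apply {E : Type*} [NormedAddCommGroup E] [NormedSpace ℂ E] {U : Opens E}
    {g : E → ℂ} (hg : ContDiffOn ℂ (⊤ : ℕ∞) g U) {a x : E} (hx : x ∈ U) {d : ℂ}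
    (h : HasDerivAt (fun s : ℂ => g (x + s • a)) d 0) :
    (dirD U a (Smooth.restrict U g hg) : E → ℂ) x = d := by
  refine dirD_apply_of_hasDerivAt _ hx (h.congr_of_eventuallyEq ?_)
  have hc : ContinuousAt (fun s : ℂ => x + s • a) 0 := by fun_prop
  have hx' : x + (0 : ℂ) • a ∈ U := by simpa using hx
  filter_upwards [hc.eventually (U.isOpen.mem_nhds hx')] with s hs
  exact Smooth.restrict_apply hg hs

theorem dirD_coneFun {p : ι → ℝ} (k : ℤ) {F : (ι → ℂ) → ℂ}
    (hF : ContDiffOn ℂ (⊤ : ℕ∞) F (upperHalf S p)) :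
    dirD (coneDom S p) (extVec 1 0 0) (Smooth.restrict _ _ (contDiffOn_coneFun k hF)) = 0 := by
  refine Smooth.ext_on fun Z hZ => dirD_restrict_apply _ hZ ?_
  simp only [coneFun_add_smul]
  exact hasDerivAt_const _ _

/-- Differentiating the homogeneity relation along `Z ↦ c Z` lowers the degree by one. -/
theorem dirD_coneFun_smul {p : ι → ℝ} (k : ℤ) {F : (ι → ℂ) → ℂ}
    (hF : ContDiffOn ℂ (⊤ : ℕ∞) F (upperHalf S p)) (a : Ext ι → ℂ) {Z : Ext ι → ℂ}
    (hZ : Z ∈ coneDom S p) {c : ℂ} (hc : c ≠ 0) :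
    (dirD (coneDom S p) a (Smooth.restrict _ _ (contDiffOn_coneFun k hF)) : (Ext ι → ℂ) → ℂ) (c • Z) =
      c ^ (-k - 1) * (dirD (coneDom S p) a (Smooth.restrict _ _ (contDiffOn_coneFun k hF)) :
        (Ext ι → ℂ) → ℂ) Z := by
  set Φ := Smooth.restrict _ _ (contDiffOn_coneFun k hF) with hΦ
  have h : ∀ Z ∈ coneDom S p, (c • ContinuousLinearMap.id ℂ (Ext ι → ℂ)) Z + 0 ∈ coneDom S p :=
    fun Z hZ => by simpa using smul_mem_coneDom hZ hc
  have h1 : pullAffine _ _ h Φ = c ^ (-k) • Φ := by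
    refine Smooth.ext_on fun Z hZ => ?_
    rw [pullAffine_apply _ _ hZ, hΦ, Smooth.restrict_apply _ (h Z hZ), Submodule.coe_smul,
      Pi.smul_apply, Smooth.restrict_apply _ hZ, smul_eq_mul, ← coneFun_smul k F hc]
    simp
  have h2 := congrArg (fun g : Smooth (coneDom S p) => (g : (Ext ι → ℂ) → ℂ) Z)
    (dirD_pullAffine h a Φ)
  simp only [h1, map_smul, pullAffine_apply _ _ hZ, smul_apply, ContinuousLinearMap.id_apply,
    dirD_smul, LinearMap.smul_apply, Submodule.coe_smul, Pi.smul_apply, smul_eq_mul, add_zero] at h2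
  rw [zpow_sub_one₀ hc]
  field_simp
  linear_combination -h2

end Cone

/-! ### The deformation along the cone -/

section Deformation

open TopologicalSpace (Opens)

variable {ι : Type*} [Fintype ι] [DecidableEq ι] (S : Matrix ι ι ℤ)

/-- The bilinear form of `Λ ⊕ II_{1,1}`, extended by zero to a further variable. -/
noncomputable def stdForm : (ℂ × (Ext ι → ℂ)) →L[ℂ] (ℂ × (Ext ι → ℂ)) →L[ℂ] ℂ :=
  LinearMap.toContinuousBilinearMap ((form (extGram S) ℂ).compl₁₂ (LinearMap.snd ℂ ℂ (Ext ι → ℂ))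
    (LinearMap.snd ℂ ℂ (Ext ι → ℂ)))

theorem stdForm_apply (x y : ℂ × (Ext ι → ℂ)) :
    stdForm S x y = form (extGram S) ℂ x.2 y.2 := rfl

/-- The vector `Z - (1 - τ) (Q(Z) / c) (1, 0, 0)` for `Z = (a, z, c)`. For `τ = 1` this is `Z`, and
for `τ = 0` it is a vector of norm zero. -/
noncomputable def shear (x : ℂ × (Ext ι → ℂ)) : Ext ι → ℂ :=
  x.2 - ((1 - x.1) * (1 / 2 * stdForm S x x) * (x.2 (Sum.inr (Sum.inr ())))⁻¹) • extVec 1 0 0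

theorem contDiffOn_shear : ContDiffOn ℂ (⊤ : ℕ∞) (shear S)
    {x | x.2 (Sum.inr (Sum.inr ())) ≠ 0} := by
  have h1 : ContDiff ℂ (⊤ : ℕ∞) fun x : ℂ × (Ext ι → ℂ) => x.2 (Sum.inr (Sum.inr ())) :=
    (contDiff_apply ℂ ℂ _).comp contDiff_snd
  have h2 : ContDiffOn ℂ (⊤ : ℕ∞) (fun x : ℂ × (Ext ι → ℂ) => (1 - x.1) *
      (1 / 2 * stdForm S x x) * (x.2 (Sum.inr (Sum.inr ())))⁻¹)
      {x | x.2 (Sum.inr (Sum.inr ())) ≠ 0} := ContDiffOn.mul ?_ ?_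
  · exact contDiff_snd.contDiffOn.sub (h2.smul contDiffOn_const)
  · exact ((contDiff_const.sub contDiff_fst).mul (contDiff_half_form (stdForm S))).contDiffOn
  · exact h1.contDiffOn.inv fun x hx => hx

theorem shear_one (Z : Ext ι → ℂ) : shear S (1, Z) = Z := by
  simp [shear]

theorem shear_of_norm_zero {τ : ℂ} {Z : Ext ι → ℂ} (h : form (extGram S) ℂ Z Z = 0) :
    shear S (τ, Z) = Z := by
  simp [shear, stdForm_apply, h]

theorem shear_zero_extVec (a : ℂ) (u : ι → ℂ) :
    shear S (0, extVec a u 1) = extVec (-quad S ℂ u) u 1 := by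
  have : 1 / 2 * stdForm S (0, extVec a u 1) (0, extVec a u 1) = a + quad S ℂ u := by
    rw [stdForm_apply, form_extVec, quad_apply]; ring
  rw [shear, this]
  ext (_ | _ | _) <;> simp

/-- For `τ = 0` the first coordinate is replaced by the one that makes the vector null, so its old
value does not matter. -/
theorem shear_zero_add_smul (hS : S.IsSymm) {Z : Ext ι → ℂ} (hZ : Z (Sum.inr (Sum.inr ())) ≠ 0)
    (s : ℂ) : shear S (0, Z + s • extVec 1 0 0) = shear S (0, Z) := by
  have h1 : 1 / 2 * stdForm S (0, Z + s • extVec 1 0 0) (0, Z + s • extVec 1 0 0) =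
      1 / 2 * stdForm S (0, Z) (0, Z) + s * Z (Sum.inr (Sum.inr ())) := by
    rw [stdForm_apply, stdForm_apply]
    simp only [map_add, map_smul, LinearMap.add_apply, LinearMap.smul_apply, smul_eq_mul]
    rw [form_comm (extGram_isSymm hS) Z (extVec 1 0 0)]
    have h2 : form (extGram S) ℂ (extVec 1 0 0) Z = Z (Sum.inr (Sum.inr ())) := by
      rw [form_extGram, show (fun i : ι => (extVec 1 0 0 : Ext ι → ℂ) (Sum.inr (Sum.inl i))) = 0
        from rfl]
      simp
    rw [h2, form_extVec]
    simp
    ring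
  rw [shear, shear, h1]
  ext (_ | _ | _)
  · simp; field_simp; ring
  · simp
  · simp

theorem shear_add_smul (τ s : ℂ) (Z : Ext ι → ℂ) :
    shear S ((τ, Z) + s • (1, 0)) = shear S (τ, Z) +
      s • ((1 / 2 * stdForm S (τ, Z) (τ, Z)) * (Z (Sum.inr (Sum.inr ())))⁻¹) • extVec 1 0 0 := by
  have h : (τ, Z) + s • ((1, 0) : ℂ × (Ext ι → ℂ)) = (τ + s, Z) := by ext <;> simp
  rw [h]
  simp only [shear, stdForm_apply]
  module

theorem shear_smul (τ : ℂ) (Z : Ext ι → ℂ) {c : ℂ} (hc : c ≠ 0) :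
    shear S (τ, c • Z) = c • shear S (τ, Z) := by
  simp only [shear, stdForm_apply, map_smul, LinearMap.smul_apply, smul_eq_mul, Pi.smul_apply,
    smul_sub, smul_smul, mul_inv]
  congr 2
  field_simp

variable {S} (p : ι → ℝ) (M : (Ext ι → ℂ) →L[ℂ] (Ext ι → ℂ))

/-- The domain of the deformation. -/
def shearDom (S : Matrix ι ι ℤ) (p : ι → ℝ) (M : (Ext ι → ℂ) →L[ℂ] (Ext ι → ℂ)) :
    Opens (ℂ × (Ext ι → ℂ)) where
  carrier := {x | x.2 (Sum.inr (Sum.inr ())) ≠ 0 ∧ M (shear S x) ∈ coneDom S p}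
  is_open' := by
    have h1 : IsOpen {x : ℂ × (Ext ι → ℂ) | x.2 (Sum.inr (Sum.inr ())) ≠ 0} :=
      isOpen_ne.preimage ((continuous_apply _).comp continuous_snd)
    exact (M.continuous.comp_continuousOn (contDiffOn_shear S).continuousOn).isOpen_inter_preimage
      h1 (coneDom S p).isOpen

variable {p} {M} {k : ℤ} {F : (ι → ℂ) → ℂ} (hF : ContDiffOn ℂ (⊤ : ℕ∞) F (upperHalf S p))

theorem contDiffOn_comp_shear (f : Smooth (coneDom S p)) : ContDiffOn ℂ (⊤ : ℕ∞)
    (fun x => (f : (Ext ι → ℂ) → ℂ) (M (shear S x))) (shearDom S p M) :=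
  f.2.1.comp (f := fun x => M (shear S x))
    (M.contDiff.comp_contDiffOn ((contDiffOn_shear S).mono fun _ hx => hx.1)) fun _ hx => hx.2

/-- The deformation of a function on the cone. -/
noncomputable def deform (M : (Ext ι → ℂ) →L[ℂ] (Ext ι → ℂ)) (f : Smooth (coneDom S p)) :
    Smooth (shearDom S p M) :=
  Smooth.restrict _ _ (contDiffOn_comp_shear (M := M) f)

theorem deform_apply (f : Smooth (coneDom S p)) {x : ℂ × (Ext ι → ℂ)} (hx : x ∈ shearDom S p M) :
    (deform M f : ℂ × (Ext ι → ℂ) → ℂ) x = (f : (Ext ι → ℂ) → ℂ) (M (shear S x)) :=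
  Smooth.restrict_apply (contDiffOn_comp_shear f) hx

theorem contDiffOn_deformDeriv (f : Smooth (coneDom S p)) : ContDiffOn ℂ (⊤ : ℕ∞)
    (fun x => (x.2 (Sum.inr (Sum.inr ())))⁻¹ *
      (dirD _ (M (extVec 1 0 0)) f : (Ext ι → ℂ) → ℂ) (M (shear S x))) (shearDom S p M) := by
  have h1 : ContDiffOn ℂ (⊤ : ℕ∞) (fun x : ℂ × (Ext ι → ℂ) => x.2 (Sum.inr (Sum.inr ())))
    (shearDom S p M) := ((contDiff_apply ℂ ℂ _).comp contDiff_snd).contDiffOn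
  exact (h1.inv fun _ hx => hx.1).mul (contDiffOn_comp_shear _)

/-- The derivative of the deformation, divided by the quadratic form. -/
noncomputable def deformDeriv (M : (Ext ι → ℂ) →L[ℂ] (Ext ι → ℂ)) (f : Smooth (coneDom S p)) :
    Smooth (shearDom S p M) :=
  Smooth.restrict _ _ (contDiffOn_deformDeriv (M := M) f)

/-- The deformation is affine in `τ` with velocity `(Q(Z)/c) (1, 0, 0)`, so the factor `Q` appears
explicitly and no quotient has to be extended over the null cone. -/
theorem dirD_deform (f : Smooth (coneDom S p)) :
    dirD (shearDom S p M) (1, 0) (deform M f) =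
      mulOp _ _ (contDiff_half_form (stdForm S)) (deformDeriv M f) := by
  refine Smooth.ext_on fun x hx => dirD_restrict_apply _ hx ?_
  rw [mulOp_apply, deformDeriv, Smooth.restrict_apply _ hx, dirD_apply _ _ hx.2]
  obtain ⟨τ, Z⟩ := x
  simp only [shear_add_smul, map_add, map_smul]
  set q := 1 / 2 * stdForm S (τ, Z) (τ, Z)
  have h1 : HasDerivAt (fun s : ℂ => M (shear S (τ, Z)) +
      s • (q * (Z (Sum.inr (Sum.inr ())))⁻¹) • M (extVec 1 0 0))
      ((q * (Z (Sum.inr (Sum.inr ())))⁻¹) • M (extVec 1 0 0)) 0 := by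
    have := ((hasDerivAt_id (0 : ℂ)).smul_const
      ((q * (Z (Sum.inr (Sum.inr ())))⁻¹) • M (extVec 1 0 0))).const_add (M (shear S (τ, Z)))
    simpa using this
  have h2 : HasFDerivAt (f : (Ext ι → ℂ) → ℂ)
      (fderiv ℂ (f : (Ext ι → ℂ) → ℂ) (M (shear S (τ, Z)))) (M (shear S (τ, Z)) +
        (0 : ℂ) • (q * (Z (Sum.inr (Sum.inr ())))⁻¹) • M (extVec 1 0 0)) := by
    rw [zero_smul, add_zero]
    exact (Smooth.differentiableAt f hx.2).hasFDerivAt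
  have h3 := h2.comp_hasDerivAt 0 h1
  rw [map_smul, smul_eq_mul, mul_assoc q] at h3
  exact h3

/-- The derivative of the lift has degree `-k - 1`, and the factor `c⁻¹` lowers it once more. The
field used is the Euler field in `Z` alone; `τ` is a parameter. -/
theorem linD_deformDeriv :
    linD (shearDom S p M) ((ContinuousLinearMap.inr ℂ ℂ (Ext ι → ℂ)).comp
      (ContinuousLinearMap.snd ℂ ℂ (Ext ι → ℂ)))
        (deformDeriv M (Smooth.restrict _ _ (contDiffOn_coneFun k hF))) =
      (-(k : ℂ) - 2) • deformDeriv M (Smooth.restrict _ _ (contDiffOn_coneFun k hF)) := by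
  set Φ := Smooth.restrict _ _ (contDiffOn_coneFun k hF) with hΦ
  refine Smooth.ext_on fun x hx => ?_
  rw [linD_apply _ _ hx, ← dirD_apply _ _ hx]
  refine dirD_restrict_apply _ hx ?_
  obtain ⟨τ, Z⟩ := x
  set K := (Z (Sum.inr (Sum.inr ())))⁻¹ *
      (dirD _ (M (extVec 1 0 0)) Φ : (Ext ι → ℂ) → ℂ) (M (shear S (τ, Z))) with hK
  have h1 : HasDerivAt (fun s : ℂ => (1 + s) ^ (-k - 2) * K) ((-(k : ℂ) - 2) * K) 0 := by
    have h := ((hasDerivAt_zpow (-k - 2) (1 + 0 : ℂ) (Or.inl (by simp))).comp (0 : ℂ)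
      ((hasDerivAt_id (0 : ℂ)).const_add 1)).mul_const K
    simpa using h
  have hne : ∀ᶠ s in 𝓝 (0 : ℂ), 1 + s ≠ 0 := by
    have : ContinuousAt (fun s : ℂ => 1 + s) 0 := by fun_prop
    exact this.eventually_ne (by simp)
  have hval : (deformDeriv M Φ : ℂ × (Ext ι → ℂ) → ℂ) (τ, Z) = K := Smooth.restrict_apply _ hx
  rw [Submodule.coe_smul, Pi.smul_apply, hval, smul_eq_mul]
  refine h1.congr_of_eventuallyEq ?_
  filter_upwards [hne] with s hs
  have h2 : (τ, Z) + s • ((ContinuousLinearMap.inr ℂ ℂ (Ext ι → ℂ)).comp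
      (ContinuousLinearMap.snd ℂ ℂ (Ext ι → ℂ))) (τ, Z) = (τ, (1 + s) • Z) := by
    ext
    · simp
    · simp; ring
  rw [h2, shear_smul S τ Z hs, map_smul, dirD_coneFun_smul k hF _ hx.2 hs, hK]
  simp only [Pi.smul_apply, smul_eq_mul, mul_inv]
  rw [show -k - 2 = -k - 1 - 1 by ring, zpow_sub_one₀ hs (-k - 1)]
  ring

end Deformation

/-! ### Covariance of the pullback operator -/

section LinearChange

open TopologicalSpace (Opens)

variable {E E' : Type*} [NormedAddCommGroup E] [NormedSpace ℂ E] [NormedAddCommGroup E']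
  [NormedSpace ℂ E'] {U : Opens E} {U' : Opens E'} {α : Type*} [Fintype α]

theorem secondOp_linear_change (C R : Matrix α α ℂ) (w : α → E) :
    secondOp U C (fun i => ∑ k, R k i • w k) = secondOp U (R * C * R.transpose) w := by
  have h1 : ∀ i j, C i j • (dirD U (∑ k, R k i • w k) * dirD U (∑ k, R k j • w k)) =
      ∑ k, ∑ l, (R k i * C i j * R l j) • (dirD U (w k) * dirD U (w l)) := by
    intro i j
    simp only [dirD_sum, dirD_smul, Finset.sum_mul, Finset.mul_sum, smul_mul_assoc, mul_smul_comm,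
      Finset.smul_sum, smul_smul]
    rw [Finset.sum_comm]
    refine Finset.sum_congr rfl fun k _ => Finset.sum_congr rfl fun l _ => ?_
    congr 1; ring
  have h2 : ∀ k l, (R * C * R.transpose) k l = ∑ i, ∑ j, R k i * C i j * R l j := by
    intro k l
    simp only [Matrix.mul_apply, Matrix.transpose_apply, Finset.sum_mul]
    rw [Finset.sum_comm]
  simp only [secondOp, h1, h2, Finset.sum_smul]
  congr 1
  have h3 : ∀ i, ∑ j, ∑ k, ∑ l, (R k i * C i j * R l j) • (dirD U (w k) * dirD U (w l)) =
      ∑ k, ∑ l, ∑ j, (R k i * C i j * R l j) • (dirD U (w k) * dirD U (w l)) := by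
    intro i
    rw [Finset.sum_comm]
    exact Finset.sum_congr rfl fun k _ => Finset.sum_comm
  simp only [h3]
  rw [Finset.sum_comm]
  exact Finset.sum_congr rfl fun k _ => Finset.sum_comm

theorem pow_mul_pow_pullAffine {A : E' →L[ℂ] E} {c : E} (h : ∀ x ∈ U', A x + c ∈ U) (a : E')
    (C : Matrix α α ℂ) (w : α → E') (m n : ℕ) (f : Smooth U) :
    (dirD U' a ^ m * secondOp U' C w ^ n) (pullAffine A c h f) =
      pullAffine A c h ((dirD U (A a) ^ m * secondOp U C (fun i => A (w i)) ^ n) f) := by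
  rw [Module.End.mul_apply, Module.End.mul_apply, pow_pullAffine h (secondOp_pullAffine h C w) n,
    pow_pullAffine h (dirD_pullAffine h a) m]

end LinearChange

/-! ### Constancy of the Gegenbauer expression along the deformation -/

section Covariance

open TopologicalSpace (Opens)

variable {ι κ κ' : Type*} [Fintype ι] [DecidableEq ι] [Fintype κ] [DecidableEq κ] [Fintype κ']
  [DecidableEq κ'] {S : Matrix ι ι ℤ} {L : Submodule ℤ (ι → ℤ)} (b : Basis κ ℤ L)
  (b' : Basis κ' ℤ (orthLattice S L))

/-- A complex matrix as a continuous linear map. -/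
noncomputable def mulVecCLM {α β : Type*} [Fintype α] [Fintype β] (M : Matrix α β ℂ) :
    (β → ℂ) →L[ℂ] (α → ℂ) :=
  LinearMap.toContinuousLinearMap M.mulVecLin

theorem mulVecCLM_apply {α β : Type*} [Fintype α] [Fintype β] (M : Matrix α β ℂ) (x : β → ℂ) :
    mulVecCLM M x = M.mulVec x := rfl

/-- The operator `∂_vᵐ Δⁿ` on functions of a parameter and a vector, where `Δ` is the Laplace operator
along `L ⊕ II_{1,1}`. -/
noncomputable def paramOp (S : Matrix ι ι ℤ) {L : Submodule ℤ (ι → ℤ)} (b : Basis κ ℤ L)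
    (U : Opens (ℂ × (Ext ι → ℂ))) (v : ι → ℂ) (m n : ℕ) : Module.End ℂ (Smooth U) :=
  dirD U ((0 : ℂ), extVec 0 v 0) ^ m *
    secondOp U ((extGram (subGram S b)).map (Int.cast : ℤ → ℂ))⁻¹
      (fun i => ((0 : ℂ), ((extBasis b).map (Int.cast : ℤ → ℂ)).mulVec (Pi.single i 1))) ^ n

variable (hS : S.IsSymm) (hL : IsLorentzian (subGram S b))

include hS hL

theorem mul_inv_extGram_mul {M : Matrix (Ext κ) (Ext κ) ℝ} (hM : M ∈ orthSet (subGram S b)) :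
    M.map ((↑) : ℝ → ℂ) * ((extGram (subGram S b)).map (Int.cast : ℤ → ℂ))⁻¹ *
      (M.map ((↑) : ℝ → ℂ)).transpose = ((extGram (subGram S b)).map (Int.cast : ℤ → ℂ))⁻¹ := by
  set G := (extGram (subGram S b)).map (Int.cast : ℤ → ℂ) with hG
  set N := M.map ((↑) : ℝ → ℂ) with hN
  have hd : IsUnit G.det := Ne.isUnit (det_extGram_subGram b hS hL ℂ)
  have h1 : N.transpose * G * N = G := by
    have h2 : (M.transpose * (extGram (subGram S b)).map (Int.cast : ℤ → ℝ) * M).map Complex.ofRealHom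
        = ((extGram (subGram S b)).map (Int.cast : ℤ → ℝ)).map Complex.ofRealHom := by rw [hM]
    have h3 : ((extGram (subGram S b)).map (Int.cast : ℤ → ℝ)).map Complex.ofRealHom = G := by
      ext; simp [hG]
    rw [Matrix.map_mul, Matrix.map_mul, h3, Matrix.transpose_map] at h2
    exact h2
  have h4 : G⁻¹ * N.transpose * G * N = 1 := by
    rw [Matrix.mul_assoc G⁻¹, Matrix.mul_assoc G⁻¹, h1, Matrix.nonsing_inv_mul _ hd]
  have h5 : N * (G⁻¹ * N.transpose * G) = 1 := mul_eq_one_comm.1 h4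
  calc N * G⁻¹ * N.transpose = N * (G⁻¹ * N.transpose * G) * G⁻¹ := by
        simp only [Matrix.mul_assoc, Matrix.mul_nonsing_inv _ hd, Matrix.mul_one]
    _ = G⁻¹ := by rw [h5, Matrix.one_mul]

/-- An isometry preserves the inverse Gram matrix, hence the Laplacian of `L ⊕ II_{1,1}`. -/
theorem secondOp_extend {M : Matrix (Ext κ) (Ext κ) ℝ} (hM : M ∈ orthSet (subGram S b))
    (U : Opens (Ext ι → ℂ)) :
    secondOp U ((extGram (subGram S b)).map (Int.cast : ℤ → ℂ))⁻¹
      (fun i => mulVecCLM ((extend S b M).map ((↑) : ℝ → ℂ))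
        (((extBasis b).map (Int.cast : ℤ → ℂ)).mulVec (Pi.single i 1))) = coneLap S b U := by
  have h1 : ∀ i, mulVecCLM ((extend S b M).map ((↑) : ℝ → ℂ))
      (((extBasis b).map (Int.cast : ℤ → ℂ)).mulVec (Pi.single i 1)) =
      ∑ k, (M.map ((↑) : ℝ → ℂ)) k i •
        ((extBasis b).map (Int.cast : ℤ → ℂ)).mulVec (Pi.single k 1) := by
    intro i
    rw [mulVecCLM_apply, Matrix.mulVec_mulVec, extend_map b hS hL, extend_mul_extBasis b hS hL,
      ← Matrix.mulVec_mulVec]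
    have : (M.map ((↑) : ℝ → ℂ)).mulVec (Pi.single i 1) =
        ∑ k, (M.map ((↑) : ℝ → ℂ)) k i • (Pi.single k 1 : Ext κ → ℂ) := by
      ext j
      simp [Finset.sum_apply, Pi.single_apply]
    rw [this, Matrix.mulVec_sum]
    simp only [Matrix.mulVec_smul]
  simp only [h1]
  rw [secondOp_linear_change, mul_inv_extGram_mul b hS hL hM, coneLap]

variable (hΛ : IsLorentzian S)

include hΛ

/-- At a null vector of `L ⊕ II_{1,1}` the `τ`-derivative of the Gegenbauer expression is the
Gegenbauer operator applied to a multiple of `Q`, hence zero. The shear fixes null vectors, so the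
base point is in the domain for every `τ`. -/
theorem sum_deform_eq {p : κ → ℝ} {k : ℤ} {F : (ι → ℂ) → ℂ}
    (hF : ContDiffOn ℂ (⊤ : ℕ∞) F (upperHalf S (embed b p))) {M : Matrix (Ext κ) (Ext κ) ℝ}
    (hM : M ∈ orthGroup (subGram S b)) {z : κ → ℂ} (hz : z ∈ upperHalf (subGram S b) p)
    (v : κ' → ℂ) (N : ℕ) (τ : ℂ) :
    (∀ τ, (τ, extVec (-quad S ℂ (embed b z)) (embed b z) 1) ∈
      shearDom S (embed b p) (mulVecCLM ((extend S b M).map ((↑) : ℝ → ℂ)))) ∧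
    ∑ n ∈ Finset.range (N / 2 + 1),
      gegenbauerCoeff ((k : ℂ) - (Fintype.card κ : ℂ) / 2) N n (N - 2 * n) *
        (-form (subGram S b') ℂ v v / 2) ^ n *
        (paramOp S b _ (embed b' v) (N - 2 * n) n
          (deform (mulVecCLM ((extend S b M).map ((↑) : ℝ → ℂ)))
            (Smooth.restrict _ _ (contDiffOn_coneFun k hF))) : ℂ × (Ext ι → ℂ) → ℂ)
          (τ, extVec (-quad S ℂ (embed b z)) (embed b z) 1) =
    ∑ n ∈ Finset.range (N / 2 + 1),
      gegenbauerCoeff ((k : ℂ) - (Fintype.card κ : ℂ) / 2) N n (N - 2 * n) *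
        (-form (subGram S b') ℂ v v / 2) ^ n *
        (paramOp S b _ (embed b' v) (N - 2 * n) n
          (deform (mulVecCLM ((extend S b M).map ((↑) : ℝ → ℂ)))
            (Smooth.restrict _ _ (contDiffOn_coneFun k hF))) : ℂ × (Ext ι → ℂ) → ℂ)
          (0, extVec (-quad S ℂ (embed b z)) (embed b z) 1) := by
  set Mc := mulVecCLM ((extend S b M).map ((↑) : ℝ → ℂ)) with hMc
  set Z₀ := extVec (-quad S ℂ (embed b z)) (embed b z) 1 with hZ₀
  set B := (extBasis b).map (Int.cast : ℤ → ℂ) with hB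
  set G := (extGram (subGram S b)).map (Int.cast : ℤ → ℂ) with hG
  set U := shearDom S (embed b p) Mc with hU
  set Φ := Smooth.restrict _ _ (contDiffOn_coneFun k hF) with hΦ
  set w : Ext κ → ℂ × (Ext ι → ℂ) := fun i => (0, B.mulVec (Pi.single i 1)) with hw
  set vv : ℂ × (Ext ι → ℂ) := (0, extVec 0 (embed b' v) 0) with hvv
  have hd : IsUnit G.det := Ne.isUnit (det_extGram_subGram b hS hL ℂ)
  have hZ₀q : form (extGram S) ℂ Z₀ Z₀ = 0 := by
    rw [hZ₀, form_extVec, quad_apply]; ring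
  have hZ₀B : Z₀ = B.mulVec (extVec (-quad S ℂ (embed b z)) z 1) := by
    rw [hB, extBasis_mulVec]
  have hmem : ∀ τ, (τ, Z₀) ∈ U := by
    intro τ
    refine ⟨one_ne_zero, ?_⟩
    rw [shear_of_norm_zero S hZ₀q]
    exact moved_mem_coneDom hS hΛ (extend_mem_orthGroup b hS hL hM) (embed_mem_upperHalf b hz)
  refine ⟨hmem, ?_⟩
  have hGs : G.transpose = G := by
    rw [hG, ← Matrix.transpose_map, (extGram_isSymm (subGram_isSymm b hS)).eq]
  have hCs : ∀ i j, G⁻¹ i j = G⁻¹ j i := by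
    intro i j
    conv_lhs => rw [← hGs, ← Matrix.transpose_nonsing_inv, Matrix.transpose_apply]
  have hGr : ∀ i j, stdForm S (w i) (w j) = G i j := by
    intro i j
    rw [stdForm_apply, form_extBasis, form_eq_dotProduct]
    simp [hG]
  have hβ : ∀ x y, stdForm S x y = stdForm S y x := fun x y => form_comm (extGram_isSymm hS) _ _
  have hCw : ∀ j l, ∑ i, G⁻¹ i j * stdForm S (w i) (w l) = if j = l then 1 else 0 := by
    intro j l
    have := congrFun (congrFun (Matrix.nonsing_inv_mul _ hd) j) l
    rw [Matrix.mul_apply, Matrix.one_apply] at this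
    rw [← this]
    exact Finset.sum_congr rfl fun i _ => by rw [hGr, hCs]
  have horth : ∀ Z : Ext κ → ℂ, form (extGram S) ℂ (B.mulVec Z) (extVec 0 (embed b' v) 0) = 0 := by
    intro Z
    rw [← extVec_eta Z, hB, extBasis_mulVec, form_extVec, form_embed_orth b b' hS]
    simp
  have hwv : ∀ i, stdForm S (w i) vv = 0 := fun i => horth _
  have hbb : stdForm S vv vv = form (subGram S b') ℂ v v := by
    rw [stdForm_apply, form_extVec, form_embed]; simp
  set A := (ContinuousLinearMap.inr ℂ ℂ (Ext ι → ℂ)).comp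
      (ContinuousLinearMap.snd ℂ ℂ (Ext ι → ℂ)) with hA
  -- The point `Z₀` lies in the span of `w`, and both maps kill the parameter direction.
  have hA0 : ∀ τ, A (τ, Z₀) = spanProj (stdForm S) G⁻¹ w (τ, Z₀) := by
    intro τ
    have h1 : (τ, Z₀) = (τ, (0 : Ext ι → ℂ)) +
        ∑ i, (extVec (-quad S ℂ (embed b z)) z 1 : Ext κ → ℂ) i • w i := by
      set c := (extVec (-quad S ℂ (embed b z)) z 1 : Ext κ → ℂ)
      have h2 : ∑ i, c i • w i = (0, Z₀) := by
        rw [hZ₀B]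
        conv_rhs => rw [← Finset.univ_sum_single c, Matrix.mulVec_sum]
        ext1
        · simp [Prod.fst_sum, hw]
        · simp only [Prod.snd_sum, hw, Prod.smul_snd, ← Matrix.mulVec_smul]
          refine Finset.sum_congr rfl fun i _ => ?_
          rw [← Pi.single_smul, smul_eq_mul, mul_one]
      rw [h2]; simp
    have h3 : spanProj (stdForm S) G⁻¹ w (τ, (0 : Ext ι → ℂ)) = 0 :=
      spanProj_eq_zero _ _ _ fun i => by rw [stdForm_apply, map_zero]
    have h4 : A (τ, (0 : Ext ι → ℂ)) = 0 := rfl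
    rw [h1, map_add, map_add, h3, h4, map_sum, map_sum]
    congr 1
    refine Finset.sum_congr rfl fun i _ => ?_
    rw [map_smul, map_smul, spanProj_basis _ _ _ hCw]
    rfl
  have hconst : ∀ τ : ℂ, HasDerivAt (fun τ => ∑ n ∈ Finset.range (N / 2 + 1),
      gegenbauerCoeff ((k : ℂ) - (Fintype.card κ : ℂ) / 2) N n (N - 2 * n) *
        (-form (subGram S b') ℂ v v / 2) ^ n *
        ((dirD U vv ^ (N - 2 * n) * secondOp U G⁻¹ w ^ n) (deform Mc Φ) : ℂ × (Ext ι → ℂ) → ℂ)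
          (τ, Z₀)) 0 τ := by
    intro τ
    have h0 := gegenbauer_mul_quad_eq_zero (stdForm S) G⁻¹ w hβ hCs hCw (hmem τ) hwv hZ₀q
      (show stdForm S vv (τ, Z₀) = 0 by rw [hβ, stdForm_apply, hZ₀B]; exact horth _)
      (fun i => rfl) rfl (hA0 τ) (linD_deformDeriv (M := Mc) (k := k) hF) N
    rw [hbb] at h0
    -- Degree `-k - 2` and `dim L + 2` variables give exactly the parameter `k - dim L / 2`.
    have hs : -(-(k : ℂ) - 2 + (Fintype.card (Ext κ) : ℂ) / 2 + 1) =
        (k : ℂ) - (Fintype.card κ : ℂ) / 2 := by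
      simp only [Fintype.card_sum, Fintype.card_unit]; push_cast; ring
    rw [hs] at h0
    rw [← h0]
    refine HasDerivAt.fun_sum fun n _ => HasDerivAt.const_mul _ ?_
    set R := dirD U vv ^ (N - 2 * n) * secondOp U G⁻¹ w ^ n 
    -- Constant-coefficient operators commute, so differentiating the expression in `τ` amounts to
    -- applying it to the `τ`-derivative.
    have hcomm : dirD U (1, 0) * R = R * dirD U (1, 0) := by
      have h1 : Commute (dirD U ((1, 0) : ℂ × (Ext ι → ℂ))) (dirD U vv ^ (N - 2 * n)) :=
        Commute.pow_right (dirD_comm _ _) _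
      have h2 : Commute (dirD U ((1, 0) : ℂ × (Ext ι → ℂ))) (secondOp U G⁻¹ w ^ n) :=
        Commute.pow_right (dirD_comm_secondOp _ _ _) _
      exact (h1.mul_right h2).eq
    have hval : R (mulOp U _ (contDiff_half_form (stdForm S)) (deformDeriv Mc Φ)) =
        dirD U (1, 0) (R (deform Mc Φ)) := by
      rw [← dirD_deform, ← Module.End.mul_apply, ← hcomm, Module.End.mul_apply]
    rw [hval, dirD_apply _ _ (hmem τ)]
    have h1 : HasDerivAt (fun τ : ℂ => (τ, Z₀)) ((1 : ℂ), (0 : Ext ι → ℂ)) τ :=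
      (hasDerivAt_id τ).prodMk (hasDerivAt_const τ Z₀)
    exact (Smooth.differentiableAt (R (deform Mc Φ)) (hmem τ)).hasFDerivAt.comp_hasDerivAt τ h1
  exact is_const_of_deriv_eq_zero (fun τ => (hconst τ).differentiableAt) (fun τ => (hconst τ).deriv)
    τ 0

end Covariance

/-! ### The two ends of the deformation -/

section DiagonalCovariance

open TopologicalSpace (Opens)

variable {ι κ κ' : Type*} [Fintype ι] [DecidableEq ι] [Fintype κ] [DecidableEq κ] [Fintype κ']
  [DecidableEq κ'] {S : Matrix ι ι ℤ} {L : Submodule ℤ (ι → ℤ)} (b : Basis κ ℤ L)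
  (b' : Basis κ' ℤ (orthLattice S L)) (hS : S.IsSymm) (hΛ : IsLorentzian S)
  (hL : IsLorentzian (subGram S b))

include hS hL

theorem det_subGram_complex_ne_zero : ((subGram S b).map (Int.cast : ℤ → ℂ)).det ≠ 0 := by
  rw [show (subGram S b).map (Int.cast : ℤ → ℂ) = (Int.castRingHom ℂ).mapMatrix (subGram S b) from
    rfl, ← RingHom.map_det]
  simpa using hL.isUnit_det (subGram_isSymm b hS)

include hΛ

/-- For `τ = 0` the deformed function does not depend on `a` and restricts to the slashed function
on the slice `(a, u, 1)`, so `slice_apply` applies with scale 1. -/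
theorem paramOp_zero {p : κ → ℝ} {k : ℤ} {F : (ι → ℂ) → ℂ}
    (hF : ContDiffOn ℂ (⊤ : ℕ∞) F (upperHalf S (embed b p))) {M : Matrix (Ext ι) (Ext ι) ℝ}
    (hM : M ∈ orthGroup S) {u : ι → ℂ} (hu : u ∈ upperHalf S (embed b p)) (a : ℂ)
    (ha : (0, extVec a u 1) ∈ shearDom S (embed b p) (mulVecCLM (M.map ((↑) : ℝ → ℂ))))
    (v : ι → ℂ) (m n : ℕ) :
    (paramOp S b _ v m n (deform (mulVecCLM (M.map ((↑) : ℝ → ℂ)))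
      (Smooth.restrict _ _ (contDiffOn_coneFun k hF))) : ℂ × (Ext ι → ℂ) → ℂ) (0, extVec a u 1) =
    ((dirD (upperOpens S (embed b p)) v ^ m * lapOp S b (upperOpens S (embed b p)) ^ n)
      (toSmooth (contDiffOn_slash hS hΛ k hF hM)) : (ι → ℂ) → ℂ) u := by
  set Mc := mulVecCLM (M.map ((↑) : ℝ → ℂ)) with hMc
  set Φ := Smooth.restrict _ _ (contDiffOn_coneFun k hF) with hΦ
  set U := shearDom S (embed b p) Mc with hU
  have hA : ∀ Z : Ext ι → ℂ, ContinuousLinearMap.inr ℂ ℂ (Ext ι → ℂ) Z + (0, 0) = (0, Z) := by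
    intro Z; simp
  let U₀ : Opens (Ext ι → ℂ) := ⟨{Z | ((0 : ℂ), Z) ∈ U}, U.isOpen.preimage (by fun_prop)⟩
  have h0 : ∀ Z ∈ U₀, ContinuousLinearMap.inr ℂ ℂ (Ext ι → ℂ) Z + (0, 0) ∈ U := by
    intro Z hZ; rw [hA]; exact hZ
  set G := pullAffine _ _ h0 (deform Mc Φ) with hG
  have hGval : ∀ Z ∈ U₀, (G : (Ext ι → ℂ) → ℂ) Z =
      (Φ : (Ext ι → ℂ) → ℂ) (Mc (shear S (0, Z))) := by
    intro Z hZ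
    rw [hG, pullAffine_apply _ _ hZ, hA]
    exact deform_apply _ hZ
  have hG1 : dirD U₀ (extVec 1 0 0) G = 0 := by
    refine Smooth.ext_on fun Z hZ => dirD_apply_of_hasDerivAt _ hZ ?_
    have h1 : ∀ s : ℂ, (G : (Ext ι → ℂ) → ℂ) (Z + s • extVec 1 0 0) =
        (G : (Ext ι → ℂ) → ℂ) Z := by
      intro s
      have h2 : Z + s • extVec 1 0 0 ∈ U₀ := by
        refine ⟨?_, ?_⟩
        · simpa using hZ.1
        · rw [shear_zero_add_smul S hS hZ.1]; exact hZ.2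
      rw [hGval _ h2, hGval _ hZ, shear_zero_add_smul S hS hZ.1]
    simp only [h1]
    exact hasDerivAt_const _ _
  have hmv : ∀ (c : ℂ) (u : ι → ℂ), Mc (shear S (0, extVec c u 1)) = moved S M u := by
    intro c u
    rw [shear_zero_extVec]
    rfl
  have hin : ∀ u ∈ upperOpens S (embed b p), (1 : ℂ) • extVec a u 1 ∈ U₀ := by
    intro u hu
    rw [one_smul]
    refine ⟨one_ne_zero, ?_⟩
    rw [hmv]
    exact moved_mem_coneDom hS hΛ hM hu
  have hsl := slice_apply b (det_subGram_complex_ne_zero b hS hL) hG1 (f := toSmooth (contDiffOn_slash hS hΛ k hF hM)) hin (d := 1) (by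
      intro u hu
      rw [hGval _ (hin u hu), one_smul, hmv, one_mul, toSmooth_apply _ hu,
        Smooth.restrict_apply _ (moved_mem_coneDom hS hΛ hM hu)]
      rfl) v m n hu
  rw [one_pow, one_mul, one_mul, one_smul] at hsl
  rw [← hsl, hG]
  have h3 := pow_mul_pow_pullAffine h0 (extVec 0 v 0)
    ((extGram (subGram S b)).map (Int.cast : ℤ → ℂ))⁻¹
    (fun i => ((extBasis b).map (Int.cast : ℤ → ℂ)).mulVec (Pi.single i 1)) m n (deform Mc Φ)
  rw [coneLap, h3, pullAffine_apply _ _ (show extVec a u 1 ∈ U₀ from ha), hA]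
  rfl

/-- For `τ = 1` the function is the lift composed with `M`. As `M` fixes the normal vector and
preserves the Laplacian, the operators act on the lift itself at `j (-Q(M z), M z, 1)`; scaling out
`j` gives one power for the weight and one per derivative. -/
theorem paramOp_one {p : κ → ℝ} {k : ℤ} {F : (ι → ℂ) → ℂ}
    (hF : ContDiffOn ℂ (⊤ : ℕ∞) F (upperHalf S (embed b p))) {M : Matrix (Ext κ) (Ext κ) ℝ}
    (hM : M ∈ orthGroup (subGram S b)) {z : κ → ℂ} (hz : z ∈ upperHalf (subGram S b) p)
    (v : κ' → ℂ) (m n : ℕ)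
    (ha : (1, extVec (-quad S ℂ (embed b z)) (embed b z) 1) ∈
      shearDom S (embed b p) (mulVecCLM ((extend S b M).map ((↑) : ℝ → ℂ)))) :
    (paramOp S b _ (embed b' v) m n (deform (mulVecCLM ((extend S b M).map ((↑) : ℝ → ℂ)))
      (Smooth.restrict _ _ (contDiffOn_coneFun k hF))) : ℂ × (Ext ι → ℂ) → ℂ)
        (1, extVec (-quad S ℂ (embed b z)) (embed b z) 1) =
    autFactor (subGram S b) M z ^ (-(k + ((m + 2 * n : ℕ) : ℤ))) *
      ((dirD (upperOpens S (embed b p)) (embed b' v) ^ m * lapOp S b (upperOpens S (embed b p)) ^ n)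
        (toSmooth hF) : (ι → ℂ) → ℂ)
          (embed b (moebius (subGram S b) M z)) := by
  set N := extend S b M with hN
  set Mc := mulVecCLM (N.map ((↑) : ℝ → ℂ)) with hMc
  set Φ := Smooth.restrict _ _ (contDiffOn_coneFun k hF) with hΦ
  set U := shearDom S (embed b p) Mc with hU
  have hNo : N ∈ orthGroup S := extend_mem_orthGroup b hS hL hM
  set j := autFactor (subGram S b) M z with hj
  have hj0 : j ≠ 0 := autFactor_ne_zero (subGram_isSymm b hS) hL (orthGroup_subset hM)
    (upperHalf_quad_pos hz)
  have hjN : autFactor S N (embed b z) = j := autFactor_extend b hS hL M z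
  have hA : ∀ Z : Ext ι → ℂ, ContinuousLinearMap.inr ℂ ℂ (Ext ι → ℂ) Z + (1, 0) = (1, Z) := by
    intro Z; simp
  let U₁ : Opens (Ext ι → ℂ) := ⟨{Z | ((1 : ℂ), Z) ∈ U}, U.isOpen.preimage (by fun_prop)⟩
  have h1 : ∀ Z ∈ U₁, ContinuousLinearMap.inr ℂ ℂ (Ext ι → ℂ) Z + (1, 0) ∈ U := by
    intro Z hZ; rw [hA]; exact hZ
  have h2 : ∀ Z ∈ U₁, Mc Z + 0 ∈ coneDom S (embed b p) := by
    intro Z hZ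
    have := hZ.2
    rw [shear_one] at this
    rwa [add_zero]
  have h3 : pullAffine _ _ h1 (deform Mc Φ) = pullAffine _ _ h2 Φ := by
    refine Smooth.ext_on fun Z hZ => ?_
    rw [pullAffine_apply _ _ hZ, pullAffine_apply _ _ hZ, hA, add_zero]
    refine (deform_apply _ (show ((1 : ℂ), Z) ∈ U from hZ)).trans ?_
    rw [shear_one]
  have h4 := congrArg (fun g : Smooth U₁ => ((dirD U₁ (extVec 0 (embed b' v) 0) ^ m *
    secondOp U₁ ((extGram (subGram S b)).map (Int.cast : ℤ → ℂ))⁻¹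
    (fun i => ((extBasis b).map (Int.cast : ℤ → ℂ)).mulVec (Pi.single i 1)) ^ n) g :
      (Ext ι → ℂ) → ℂ) (extVec (-quad S ℂ (embed b z)) (embed b z) 1)) h3
  have hmemU : extVec (-quad S ℂ (embed b z)) (embed b z) 1 ∈ U₁ := ha
  have hfix : Mc (extVec 0 (embed b' v) 0) = extVec 0 (embed b' v) 0 := by
    rw [hMc, mulVecCLM_apply, hN, extend_map b hS hL]
    exact extend_mulVec_of_orth b hS hL _ fun z => form_embed_orth b b' hS z v
  rw [pow_mul_pow_pullAffine, pow_mul_pow_pullAffine, hfix,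
    secondOp_extend b hS hL (orthGroup_subset hM), pullAffine_apply _ _ hmemU,
    pullAffine_apply _ _ hmemU, hA, add_zero] at h4
  refine Eq.trans (by rfl) (h4.trans ?_)
  have hmv : Mc (extVec (-quad S ℂ (embed b z)) (embed b z) 1) =
      j • extVec (-quad S ℂ (embed b (moebius (subGram S b) M z)))
        (embed b (moebius (subGram S b) M z)) 1 := by
    have := moved_eq_smul (orthGroup_subset hNo) (z := embed b z) (by rw [hjN]; exact hj0)
    rw [hjN, moebius_extend b hS hL] at this
    exact this
  have hmem : embed b (moebius (subGram S b) M z) ∈ upperOpens S (embed b p) :=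
    embed_mem_upperHalf b (moebius_mem_upperHalf (subGram_isSymm b hS) hL hM hz)
  have hsl := slice_apply b (det_subGram_complex_ne_zero b hS hL) (dirD_coneFun k hF)
    (f := toSmooth hF)
    (a := -quad S ℂ (embed b (moebius (subGram S b) M z)))
    (fun u hu => smul_extVec_mem_coneDom hj0 _ hu) (d := j ^ (-k)) (by
      intro u hu
      rw [Smooth.restrict_apply _ (smul_extVec_mem_coneDom hj0 _ hu), toSmooth_apply _ hu,
        coneFun_smul_extVec k F hj0]) (embed b' v) m n hmem
  rw [hmv, neg_add, zpow_add₀ hj0, mul_right_comm, ← hsl, mul_right_comm, zpow_neg j _, zpow_natCast,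
    mul_inv_cancel₀ (pow_ne_zero _ hj0), one_mul]

/-- The pullback operator intertwines the slash operators in weights `k` and `k + N`. -/
theorem pullbackOperator_slash_diag {p : κ → ℝ} {k : ℤ} {F : (ι → ℂ) → ℂ}
    (hF : ContDiffOn ℂ (⊤ : ℕ∞) F (upperHalf S (embed b p))) {M : Matrix (Ext κ) (Ext κ) ℝ}
    (hM : M ∈ orthGroup (subGram S b)) {z : κ → ℂ} (hz : z ∈ upperHalf (subGram S b) p) (N : ℕ)
    (v : κ' → ℂ) :
    pullbackOperator S b b' k N (slash S k F (extend S b M)) z (fun _ => v) =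
      autFactor (subGram S b) M z ^ (-(k + (N : ℤ))) *
        pullbackOperator S b b' k N F (moebius (subGram S b) M z) (fun _ => v) := by
  have hNo : extend S b M ∈ orthGroup S := extend_mem_orthGroup b hS hL hM
  have hz' : embed b z ∈ upperOpens S (embed b p) := embed_mem_upperHalf b hz
  have hmem : embed b (moebius (subGram S b) M z) ∈ upperOpens S (embed b p) :=
    embed_mem_upperHalf b (moebius_mem_upperHalf (subGram_isSymm b hS) hL hM hz)
  have hdef := sum_deform_eq b b' hS hL hΛ (k := k) hF hM hz v N 1
  rw [pullbackOperator_diag b b' (f := toSmooth (contDiffOn_slash hS hΛ k hF hNo))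
    (fun x hx => (toSmooth_apply _ hx).symm) hz',
    pullbackOperator_diag b b' (f := toSmooth hF)
      (fun x hx => (toSmooth_apply _ hx).symm) hmem, mul_left_comm]
  congr 1
  rw [Finset.mul_sum]
  have h0 := hdef.2
  simp only [paramOp_zero b hS hΛ hL hF hNo hz' _ (hdef.1 0)] at h0
  rw [← h0]
  refine Finset.sum_congr rfl fun n hn => ?_
  rw [paramOp_one b b' hS hΛ hL hF hM hz v _ _ (hdef.1 1)]
  have : N - 2 * n + 2 * n = N := by rw [Finset.mem_range] at hn; omega
  rw [this]
  ring

end DiagonalCovariance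

/-! ### Multilinearity and symmetry -/

section Multilinear

/-- Polarization: by symmetry the `N`-th derivative of the diagonal restriction is `N!` times the
form. -/
theorem MultilinearMap.eq_zero_of_diag {V : Type*} [NormedAddCommGroup V] [NormedSpace ℂ V] {N : ℕ}
    (f : MultilinearMap ℂ (fun _ : Fin N => V) ℂ) (hc : Continuous f)
    (hs : ∀ (v : Fin N → V) (σ : Equiv.Perm (Fin N)), f (fun i => v (σ i)) = f v)
    (hd : ∀ v, f (fun _ => v) = 0) (v : Fin N → V) : f v = 0 := by
  let g : ContinuousMultilinearMap ℂ (fun _ : Fin N => V) ℂ := ⟨f, hc⟩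
  have h1 := g.iteratedFDeriv_comp_diagonal 0 v
  have h2 : (fun x => g fun _ => x) = fun _ => (0 : ℂ) := funext hd
  have h3 : ∀ σ : Equiv.Perm (Fin N), g (fun i => v (σ i)) = f v := hs v
  rw [h2] at h1
  simp only [h3, Finset.sum_const, Finset.card_univ, Fintype.card_perm, Fintype.card_fin,
    nsmul_eq_mul] at h1
  have h4 : iteratedFDeriv ℂ N (fun _ : V => (0 : ℂ)) 0 = 0 := by
    rw [iteratedFDeriv_fun_zero]; rfl
  rw [h4] at h1
  simpa [Nat.factorial_ne_zero] using h1.symm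

/-- Additivity and homogeneity in each argument. -/
def IsMultilinear {V : Type*} [AddCommGroup V] [Module ℂ V] {N : ℕ} (f : (Fin N → V) → ℂ) : Prop :=
  ∀ (v : Fin N → V) (i : Fin N), IsLinearMap ℂ fun x => f (Function.update v i x)

variable {V : Type*} [AddCommGroup V] [Module ℂ V] {N : ℕ}

/-- A multilinear map from its defining property. -/
def IsMultilinear.toMultilinearMap {f : (Fin N → V) → ℂ} (h : IsMultilinear f) :
    MultilinearMap ℂ (fun _ : Fin N => V) ℂ where
  toFun := f
  map_update_add' v i x y := by
    convert (h v i).map_add x y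
  map_update_smul' v i c x := by
    convert (h v i).map_smul c x

theorem IsMultilinear.const_mul {f : (Fin N → V) → ℂ} (h : IsMultilinear f) (c : ℂ) :
    IsMultilinear fun v => c * f v := fun v i =>
  ⟨fun x y => by
    change c * f _ = c * f _ + c * f _
    rw [show f _ = f _ + f _ from (h v i).map_add x y, mul_add], fun d x => by
    change c * f _ = d * (c * f _)
    rw [show f _ = d * f _ from (h v i).map_smul d x, mul_left_comm]⟩

theorem IsMultilinear.sum {α : Type*} (s : Finset α) {f : α → (Fin N → V) → ℂ}
    (h : ∀ a ∈ s, IsMultilinear (f a)) : IsMultilinear fun v => ∑ a ∈ s, f a v := fun v i =>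
  ⟨fun x y => by
    rw [← Finset.sum_add_distrib]; exact Finset.sum_congr rfl fun a ha => (h a ha v i).map_add x y,
  fun d x => by
    rw [Finset.smul_sum]; exact Finset.sum_congr rfl fun a ha => (h a ha v i).map_smul d x⟩

/-- Each argument fills exactly one slot, either of the multilinear factor or of one bilinear
factor. -/
theorem isMultilinear_slots {n m : ℕ} (e : Fin m ⊕ Fin n × Fin 2 ≃ Fin N)
    (f : MultilinearMap ℂ (fun _ : Fin m => V) ℂ) (β : V →ₗ[ℂ] V →ₗ[ℂ] ℂ) :
    IsMultilinear fun v : Fin N → V => f (fun i => v (e (Sum.inl i))) *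
      ∏ j, β (v (e (Sum.inr (j, 0)))) (v (e (Sum.inr (j, 1)))) := by
  intro v i
  obtain ⟨s, rfl⟩ := e.surjective i
  have hu : ∀ x t, t ≠ s → Function.update v (e s) x (e t) = v (e t) := fun x t ht =>
    Function.update_of_ne (fun h => ht (e.injective h)) _ _
  have hu' : ∀ x, Function.update v (e s) x (e s) = x := fun x => Function.update_self _ _ _
  rcases s with i | ⟨j, c⟩
  · have h1 : ∀ x, (fun k => Function.update v (e (Sum.inl i)) x (e (Sum.inl k))) =
        Function.update (fun k => v (e (Sum.inl k))) i x := by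
      intro x
      ext1 k
      by_cases hk : k = i
      · subst hk; rw [hu', Function.update_self]
      · rw [hu _ _ (by simpa using hk), Function.update_of_ne hk]
    have h2 : ∀ x j c, Function.update v (e (Sum.inl i)) x (e (Sum.inr (j, c))) =
        v (e (Sum.inr (j, c))) := fun x j c => hu _ _ (by simp)
    simp only [h1, h2]
    exact ⟨fun x y => by rw [MultilinearMap.map_update_add, add_mul], fun d x => by
      rw [MultilinearMap.map_update_smul, smul_eq_mul, smul_eq_mul, mul_assoc]⟩
  · have h1 : ∀ x, (fun k => Function.update v (e (Sum.inr (j, c))) x (e (Sum.inl k))) =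
        fun k => v (e (Sum.inl k)) := fun x => funext fun k => hu _ _ (by simp)
    have h2 : ∀ x, ∀ l ∈ Finset.univ.erase j, ∀ c',
        Function.update v (e (Sum.inr (j, c))) x (e (Sum.inr (l, c'))) =
        v (e (Sum.inr (l, c'))) := fun x l hl c' =>
      hu _ _ fun h => (Finset.ne_of_mem_erase hl) (congrArg Prod.fst (Sum.inr_injective h))
    have h3 : ∀ x, ∏ l, β (Function.update v (e (Sum.inr (j, c))) x (e (Sum.inr (l, 0))))
        (Function.update v (e (Sum.inr (j, c))) x (e (Sum.inr (l, 1)))) =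
        β (Function.update v (e (Sum.inr (j, c))) x (e (Sum.inr (j, 0))))
          (Function.update v (e (Sum.inr (j, c))) x (e (Sum.inr (j, 1)))) *
        ∏ l ∈ Finset.univ.erase j, β (v (e (Sum.inr (l, 0)))) (v (e (Sum.inr (l, 1)))) := by
      intro x
      rw [← Finset.mul_prod_erase _ _ (Finset.mem_univ j)]
      congr 1
      exact Finset.prod_congr rfl fun l hl => by rw [h2 x l hl, h2 x l hl]
    simp only [h1, h3]
    have h01 : ((Sum.inr (j, 1)) : Fin m ⊕ Fin n × Fin 2) ≠ Sum.inr (j, 0) := by simp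
    fin_cases c
    · simp only [Fin.zero_eta, hu', hu _ _ h01] at *
      exact ⟨fun x y => by simp only [map_add, LinearMap.add_apply]; ring,
        fun d x => by simp only [map_smul, LinearMap.smul_apply, smul_eq_mul]; ring⟩
    · simp only [Fin.mk_one, hu', hu _ _ h01.symm] at *
      exact ⟨fun x y => by simp only [map_add]; ring,
        fun d x => by simp only [map_smul, smul_eq_mul]; ring⟩

end Multilinear

/-! ### Polarization of the pullback operator -/

section OperatorMultilinear

variable {ι κ κ' : Type*} [Fintype ι] [DecidableEq ι] [Fintype κ] [DecidableEq κ] [Fintype κ']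
  [DecidableEq κ'] (S : Matrix ι ι ℤ) {L : Submodule ℤ (ι → ℤ)} (b : Basis κ ℤ L)
  (b' : Basis κ' ℤ (orthLattice S L)) (k : ℤ) (N : ℕ) (F : (ι → ℂ) → ℂ) (z : κ → ℂ)

theorem isMultilinear_pullbackOperator : IsMultilinear (pullbackOperator S b b' k N F z) := by
  refine IsMultilinear.const_mul (f := fun v => _) (IsMultilinear.sum _ fun n _ =>
    IsMultilinear.const_mul (f := fun v => _) (IsMultilinear.const_mul (f := fun v => _)
      (IsMultilinear.sum _ fun e _ => ?_) _) _) _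
  have := isMultilinear_slots e ((iteratedFDeriv ℂ n.2 ((laplacian S b)^[n.1] F)
    (embed b z)).toMultilinearMap.compLinearMap fun _ => embedLin b' ℂ)
    ((-(1 / 2 : ℂ)) • form (subGram S b') ℂ)
  convert this using 6
  · simp only [MultilinearMap.compLinearMap_apply, embedLin_apply]
    rfl
  · rw [LinearMap.smul_apply, LinearMap.smul_apply, smul_eq_mul]
    ring

theorem continuous_pullbackOperator : Continuous (pullbackOperator S b b' k N F z) := by
  refine continuous_const.mul (continuous_finsetSum _ fun n _ => continuous_const.mul
    (continuous_const.mul (continuous_finsetSum _ fun e _ => Continuous.mul ?_ ?_)))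
  · refine (iteratedFDeriv ℂ n.2 ((laplacian S b)^[n.1] F) (embed b z)).coe_continuous.comp ?_
    exact continuous_pi fun i => (continuous_embed b').comp (continuous_apply _)
  · simp only [form_apply]
    fun_prop

/-- Permuting the arguments only reindexes the sum over assignments of slots. -/
theorem pullbackOperator_symm (v : Fin N → κ' → ℂ) (σ : Equiv.Perm (Fin N)) :
    pullbackOperator S b b' k N F z (fun i => v (σ i)) = pullbackOperator S b b' k N F z v := by
  rw [pullbackOperator, pullbackOperator, gegenbauerSum, gegenbauerSum]
  congr 1
  refine Finset.sum_congr rfl fun n _ => ?_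
  congr 2
  exact Fintype.sum_equiv ((Equiv.refl _).equivCongr σ) _ _ fun e => rfl

/-- The values of the pullback operator as multilinear maps. -/
noncomputable def pullbackMap : MultilinearMap ℂ (fun _ : Fin N => κ' → ℂ) ℂ :=
  (isMultilinear_pullbackOperator S b b' k N F z).toMultilinearMap

variable {S k F z}

theorem pullbackOperator_slash (hS : S.IsSymm) (hΛ : IsLorentzian S)
    (hL : IsLorentzian (subGram S b)) {p : κ → ℝ}
    (hF : ContDiffOn ℂ (⊤ : ℕ∞) F (upperHalf S (embed b p))) {M : Matrix (Ext κ) (Ext κ) ℝ}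
    (hM : M ∈ orthGroup (subGram S b)) (hz : z ∈ upperHalf (subGram S b) p) (v : Fin N → κ' → ℂ) :
    pullbackOperator S b b' k N (slash S k F (extend S b M)) z v =
      slash (subGram S b) (k + N) (fun z => pullbackOperator S b b' k N F z v) M z := by
  rw [slash, ← sub_eq_zero]
  set c := autFactor (subGram S b) M z ^ (-(k + (N : ℤ)))
  refine MultilinearMap.eq_zero_of_diag (pullbackMap S b b' k N (slash S k F (extend S b M)) z -
    c • pullbackMap S b b' k N F (moebius (subGram S b) M z)) ?_ (fun v σ => ?_) (fun v => ?_) v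
  · exact (continuous_pullbackOperator S b b' k N _ z).sub
      (continuous_const.mul (continuous_pullbackOperator S b b' k N _ _))
  · change pullbackOperator S b b' k N _ z (fun i => v (σ i)) -
      c * pullbackOperator S b b' k N _ _ (fun i => v (σ i)) = _
    rw [pullbackOperator_symm, pullbackOperator_symm]
    rfl
  · exact sub_eq_zero.2 (pullbackOperator_slash_diag b b' hS hΛ hL hF hM hz N v)

end OperatorMultilinear

/-! ### Growth of sums of exponentials -/

section Growth

variable {ι : Type*} [Fintype ι] {I : Type*} {P : Set (ι → ℝ)} {ξ : I → ι → ℝ} {a : I → ℂ}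
  {f : (ι → ℂ) → ℂ}

theorem IsExpSum.norm_le (h : IsExpSum P ξ a f) {y y₀ : ι → ℝ} (hy : y ∈ P) (hy₀ : y₀ ∈ P)
    (hle : ∀ i, a i ≠ 0 → ∑ j, ξ i j * y₀ j ≤ ∑ j, ξ i j * y j) (x : ι → ℝ) :
    ‖f (cplx x y)‖ ≤ ∑' i, ‖a i‖ * Real.exp (-(2 * Real.pi * ∑ j, ξ i j * y₀ j)) := by
  rw [← (h _ (cplx_mem_tube x hy)).tsum_eq]
  refine tsum_of_norm_bounded (h.summable_norm hy₀).hasSum fun i => ?_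
  rw [norm_mul, norm_expo]
  have him : ∀ j, (cplx x y j).im = y j := congrFun (cplx_im x y)
  simp only [him]
  by_cases hi : a i = 0
  · simp [hi]
  · have := hle i hi
    gcongr

theorem IsExpSum.bounded (h : IsExpSum P ξ a f) {v : ι → ℝ} (hv : ∀ t : ℝ, 0 < t → t • v ∈ P)
    (hnn : ∀ i, a i ≠ 0 → 0 ≤ ∑ j, ξ i j * v j) :
    ∃ C : ℝ, ∀ t : ℝ, 1 ≤ t → ∀ x, ‖f (cplx x (t • v))‖ ≤ C := by
  refine ⟨_, fun t ht x => h.norm_le (hv t (by linarith)) (hv 1 one_pos) (fun i hi => ?_) x⟩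
  have hs : ∀ s : ℝ, ∑ j, ξ i j * (s • v) j = s * ∑ j, ξ i j * v j := fun s => by
    rw [Finset.mul_sum]
    exact Finset.sum_congr rfl fun j _ => by rw [Pi.smul_apply, smul_eq_mul]; ring
  rw [hs, hs]
  exact mul_le_mul_of_nonneg_right ht (hnn i hi)

/-- Dominated convergence: every surviving term decays, and the series at `z` dominates those at `z
+ i t v` for `t ≥ 0`. -/
theorem IsExpSum.tendsto_zero (h : IsExpSum P ξ a f) {z : ι → ℂ} (hz : z ∈ tube P) {v : ι → ℝ}
    (hv : ∀ t : ℝ, 0 < t → (fun i => z i + Complex.I * t * v i) ∈ tube P)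
    (hpos : ∀ i, a i ≠ 0 → 0 < ∑ j, ξ i j * v j) :
    Tendsto (fun t : ℝ => f (fun i => z i + Complex.I * t * v i)) atTop (𝓝 0) := by
  have him : ∀ i (t : ℝ), ∑ j, ξ i j * (z j + Complex.I * t * v j).im =
      ∑ j, ξ i j * (z j).im + t * ∑ j, ξ i j * v j := fun i t => by
    rw [Finset.mul_sum, ← Finset.sum_add_distrib]
    refine Finset.sum_congr rfl fun j _ => ?_
    have : (z j + Complex.I * t * v j).im = (z j).im + t * v j := by simp
    rw [this]
    ring
  have hnorm : ∀ i (t : ℝ), ‖a i * expo (ξ i) (fun j => z j + Complex.I * t * v j)‖ =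
      ‖a i‖ * Real.exp (-(2 * Real.pi * (∑ j, ξ i j * (z j).im + t * ∑ j, ξ i j * v j))) :=
    fun i t => by rw [norm_mul, norm_expo, him]
  have key : Tendsto (fun t : ℝ => ∑' i, a i * expo (ξ i) (fun j => z j + Complex.I * t * v j))
      atTop (𝓝 (∑' _ : I, (0 : ℂ))) := by
    refine tendsto_tsum_of_dominated_convergence (h.summable_norm hz) (fun i => ?_) ?_
    · by_cases hi : a i = 0
      · simp [hi]
      rw [tendsto_zero_iff_norm_tendsto_zero]
      simp only [hnorm]
      rw [← mul_zero ‖a i‖]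
      refine Tendsto.const_mul _ (Real.tendsto_exp_neg_atTop_nhds_zero.comp ?_)
      refine Tendsto.const_mul_atTop (by positivity) ?_
      exact tendsto_atTop_add_const_left _ _ (Tendsto.atTop_mul_const (hpos i hi) tendsto_id)
    · filter_upwards [eventually_ge_atTop 0] with t ht i
      rw [hnorm]
      by_cases hi : a i = 0
      · simp [hi]
      have := mul_nonneg ht (hpos i hi).le
      gcongr
      linarith
  rw [tsum_zero] at key
  refine key.congr' ?_
  filter_upwards [eventually_gt_atTop 0] with t ht
  exact (h _ (hv t ht)).tsum_eq

end Growth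

/-! ### Expansions of periodic functions along a sublattice -/

section Expansion

variable {ι κ κ' : Type*} [Fintype ι] [DecidableEq ι] [Fintype κ] [DecidableEq κ] [Fintype κ']
  [DecidableEq κ'] {S : Matrix ι ι ℤ} {L : Submodule ℤ (ι → ℤ)} (b : Basis κ ℤ L)
  (b' : Basis κ' ℤ (orthLattice S L))

theorem expChar_eq_expo (T : Matrix κ κ ℤ) (x : κ → ℝ) (z : κ → ℂ) :
    expChar T x z = expo (fun j => form T ℝ x (Pi.single j 1)) z := by
  rw [expChar, expo]
  congr 2
  conv_lhs => rw [← Finset.univ_sum_single z]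
  rw [map_sum]
  refine Finset.sum_congr rfl fun j _ => ?_
  rw [← form_ofReal, mul_comm, ← smul_eq_mul, ← map_smul]
  congr 1
  ext i
  by_cases hi : i = j
  · subst hi; simp
  · simp [hi]

theorem sum_form_single (T : Matrix κ κ ℤ) (x y : κ → ℝ) :
    ∑ j, form T ℝ x (Pi.single j 1) * y j = form T ℝ x y := by
  conv_rhs => rw [← Finset.univ_sum_single y]
  rw [map_sum]
  refine Finset.sum_congr rfl fun j _ => ?_
  rw [mul_comm, ← smul_eq_mul, ← map_smul]
  congr 1
  ext i
  by_cases hi : i = j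
  · subst hi; simp
  · simp [hi]

theorem freq_smul (c : ℝ) (x : κ → ℝ) (y : κ' → ℝ) :
    freq b b' (c • x) (c • y) = c • freq b b' x y := by
  ext i
  rw [freq, embed_smul, embed_smul, ← smul_add, map_smul, LinearMap.smul_apply]
  rfl

theorem expo_freq (hS : S.IsSymm) (x : κ → ℝ) (y : κ' → ℝ) (z : κ → ℂ) (w : κ' → ℂ) :
    expo (freq b b' x y) (embed b z + embed b' w) =
      expChar (subGram S b) x z * expChar (subGram S b') y w := by
  rw [expo, sum_freq_mul_embed b b' hS, expChar, expChar, ← Complex.exp_add, mul_add]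

/-- Boundedness makes the frequency nonnegative on the cone of `Λ`. Self-duality of that cone gives
the inequality of norms, and restriction to the cone of `L` gives the sign of the component along
`L`. -/
theorem IsExpSum.quad_nonneg_of_bounded {I : Type*} (hS : S.IsSymm) {p : κ → ℝ}
    (hp : 0 < quad (subGram S b) ℝ p) {X : I → κ → ℝ} {Y : I → κ' → ℝ} {a : I → ℂ}
    {f : (ι → ℂ) → ℂ}
    (h : IsExpSum (posCone S (embed b p)) (fun i => freq b b' (X i) (Y i)) a f)
    (hinj : Function.Injective fun i => freq b b' (X i) (Y i)) {d : ℝ} (hd0 : d ≠ 0)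
    (hd : ∀ i j, ∃ n : ℤ, d * freq b b' (X i) (Y i) j = n)
    (hb : ∀ v ∈ posCone S (embed b p), ∃ C T : ℝ, ∀ t : ℝ, T ≤ t → ∀ x : ι → ℝ,
      ‖f (fun i => (x i : ℂ) + Complex.I * t * v i)‖ ≤ C) {i : I} (hi : a i ≠ 0) :
    0 ≤ quad (subGram S b) ℝ (X i) + quad (subGram S b') ℝ (Y i) ∧
      ∀ v ∈ posCone (subGram S b) p, 0 ≤ form (subGram S b) ℝ (X i) v := by
  have key : ∀ v ∈ posCone S (embed b p), 0 ≤ form S ℝ (embed b (X i) + embed b' (Y i)) v := by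
    intro v hv
    obtain ⟨C, T, hC⟩ := hb v hv
    have := h.nonneg_of_bounded hinj hd0 hd (v := v) (C := C) (T := max T 1)
      (fun t ht => smul_mem_posCone hS hv (lt_of_lt_of_le one_pos ((le_max_right _ _).trans ht)))
      (fun t ht x => by
        have := hC t ((le_max_left _ _).trans ht) x
        have he : cplx x (t • v) = fun i => (x i : ℂ) + Complex.I * t * v i := by
          ext i; simp only [cplx, Pi.smul_apply, smul_eq_mul]; push_cast; ring
        rwa [he]) hi
    rwa [sum_freq_mul] at this
  refine ⟨?_, fun v hv => ?_⟩
  · have := quad_nonneg_of_form_nonneg hS (p := embed b p) (by rwa [quad_embed]) key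
    rwa [quad_add hS, quad_embed, quad_embed, form_embed_orth b b' hS, add_zero] at this
  · have := key _ (embed_mem_posCone b hv)
    rwa [map_add, LinearMap.add_apply, form_embed, form_embed_orth' b b' hS, add_zero] at this

/-- Rescaling by `h` reduces to integral periods. The frequencies are then indexed by the integral
linear forms, divided by `h`. -/
theorem exists_isExpSum_of_periodic (hS : S.IsSymm) (hΛ : IsLorentzian S)
    (hL : IsLorentzian (subGram S b)) {p : κ → ℝ} (hp : 0 < quad (subGram S b) ℝ p)
    {f : (ι → ℂ) → ℂ} (hf : DifferentiableOn ℂ f (upperHalf S (embed b p))) {h : ℝ} (hh : 0 < h)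
    (hper : ∀ z ∈ upperHalf S (embed b p), ∀ n : ι → ℤ,
      f (z + fun i => ((h * n i : ℝ) : ℂ)) = f z) :
    ∃ (X : (ι → ℤ) → κ → ℝ) (Y : (ι → ℤ) → κ' → ℝ) (a : (ι → ℤ) → ℂ),
      (∀ n, X n ∈ dualLattice (subGram S b)) ∧ (∀ n, Y n ∈ dualLattice (subGram S b')) ∧
      (∀ n i, freq b b' (X n) (Y n) i = n i) ∧
      IsExpSum (posCone S (embed b p)) (fun n => freq b b' (h⁻¹ • X n) (h⁻¹ • Y n)) a f := by
  choose X hX Y hY hXY using exists_dual_of_int b b' hS hΛ hL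
  have hfreq : ∀ n i, freq b b' (X n) (Y n) i = n i := fun n i => by
    rw [freq, hXY]
    simp [Pi.single_apply]
  have hsc : ∀ {c : ℝ}, 0 < c → ∀ z ∈ tube (posCone S (embed b p)),
      (c : ℂ) • z ∈ tube (posCone S (embed b p)) := by
    intro c hc z hz
    have := smul_mem_posCone hS (x := fun i => (z i).im) hz hc
    have he : (fun i => (((c : ℂ) • z) i).im) = c • fun i => (z i).im := by
      ext i; simp
    change (fun i => (((c : ℂ) • z) i).im) ∈ posCone S (embed b p)
    rwa [he]
  obtain ⟨a, ha⟩ := exists_fourier_expansion (f := fun z => f ((h : ℂ) • z))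
    (convex_posCone hS hΛ (embed b p)) (isOpen_posCone _)
    ⟨_, mem_posCone_self (by rwa [quad_embed])⟩
    (hf.comp (by fun_prop) fun z hz => hsc hh z hz) (fun z hz n => by
      rw [← hper _ (hsc hh z hz) n, smul_add]
      congr 2
      ext i
      simp)
  refine ⟨X, Y, a, hX, hY, hfreq, fun z hz => ?_⟩
  have h1 := ha _ (hsc (inv_pos.2 hh) z hz)
  have hh' : (h : ℂ) ≠ 0 := by exact_mod_cast hh.ne'
  rw [smul_smul, Complex.ofReal_inv, mul_inv_cancel₀ hh', one_smul] at h1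
  refine HasSum.congr_terms h1 fun n => ?_
  dsimp only
  rw [freq_smul, expo]
  congr 4
  refine funext fun i => ?_
  simp only [Pi.smul_apply, smul_eq_mul, hfreq]
  push_cast
  ring

end Expansion

/-! ### Pullbacks of modular forms -/

section Pullback

variable {ι κ κ' : Type*} [Fintype ι] [DecidableEq ι] [Fintype κ] [DecidableEq κ] [Fintype κ']
  [DecidableEq κ'] {S : Matrix ι ι ℤ} {L : Submodule ℤ (ι → ℤ)} {b : Basis κ ℤ L}
  {b' : Basis κ' ℤ (orthLattice S L)} {p : κ → ℝ} {k : ℤ} {F : (ι → ℂ) → ℂ}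
  {c : dualLattice (subGram S b) → dualLattice (subGram S b') → ℂ}

theorem IsFourierExpansion.isExpSum (hS : S.IsSymm) (hL : IsLorentzian (subGram S b))
    (h : IsFourierExpansion S b b' (embed b p) F c) :
    IsExpSum (posCone S (embed b p))
      (fun xy : dualLattice (subGram S b) × dualLattice (subGram S b') => freq b b' xy.1 xy.2)
      (fun xy => c xy.1 xy.2) F := by
  intro u hu
  obtain ⟨z, w, rfl⟩ := exists_embed_add_embed b b' hS (hL.isUnit_det (subGram_isSymm b hS)) u
  exact HasSum.congr_terms (h z w hu) fun xy => by rw [expo_freq b b' hS, mul_assoc]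

theorem IsModularForm.exists_isFourierExpansion (hS : IsEven S) (hΛ : IsLorentzian S)
    (hL : IsLorentzian (subGram S b)) (hp : 0 < quad (subGram S b) ℝ p)
    (hF : IsModularForm S (embed b p) k F) :
    ∃ c, IsFourierExpansion S b b' (embed b p) F c := by
  obtain ⟨X, Y, a, hX, hY, hXY, ha⟩ := exists_isExpSum_of_periodic b b' hS.1 hΛ hL hp
    hF.holomorphic one_pos fun z hz n => by
      have := slash_add_of_conj_mem hS.1 hΛ hF one_mem_orthGroup (trans_mem_modGroup hS hΛ n) hz
      rw [slash_one, slash_one] at this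
      simpa using this
  let g : (ι → ℤ) → dualLattice (subGram S b) × dualLattice (subGram S b') :=
    fun n => (⟨X n, hX n⟩, ⟨Y n, hY n⟩)
  have hg : Function.Injective g := by
    intro n m hnm
    have h1 : X n = X m := congrArg (fun q => (q.1 : κ → ℝ)) hnm
    have h2 : Y n = Y m := congrArg (fun q => (q.2 : κ' → ℝ)) hnm
    ext i
    have := hXY n i
    rw [h1, h2, hXY m i] at this
    exact_mod_cast this.symm
  -- Pairs of dual vectors that do not come from an integral form on the whole lattice receive the
  -- coefficient zero.
  refine ⟨fun x y => Function.extend g a 0 (x, y), fun z w hzw => ?_⟩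
  refine (hg.hasSum_iff fun xy hxy => ?_).1 (HasSum.congr_terms (ha _ hzw) fun n => ?_)
  · dsimp only
    rw [Prod.mk.eta, Function.extend_apply' _ _ _ (by simpa using hxy)]
    simp
  · dsimp only [Function.comp]
    rw [Prod.mk.eta, hg.extend_apply, inv_one, one_smul, one_smul, expo_freq b b' hS.1, mul_assoc]

theorem IsFourierExpansion.quad_nonneg (hS : S.IsSymm) (hΛ : IsLorentzian S)
    (hL : IsLorentzian (subGram S b)) (hp : 0 < quad (subGram S b) ℝ p)
    (hF : IsModularForm S (embed b p) k F) (hc : IsFourierExpansion S b b' (embed b p) F c)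
    {x : dualLattice (subGram S b)} {y : dualLattice (subGram S b')} (h : c x y ≠ 0) :
    0 ≤ quad (subGram S b) ℝ (x : κ → ℝ) + quad (subGram S b') ℝ (y : κ' → ℝ) := by
  have hdet : ((subGram S b).det : ℝ) ≠ 0 :=
    Int.cast_ne_zero.2 (hL.isUnit_det (subGram_isSymm b hS))
  refine ((hc.isExpSum hS hL).quad_nonneg_of_bounded b b' hS hp (fun q q' hq => ?_) hdet
    (fun q j => freq_integral b b' hS q.1.2 q.2.2 j) (fun v hv => ?_) (i := (x, y)) h).1
  · obtain ⟨h1, h2⟩ := freq_injective b b' hS hΛ hL hp hq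
    exact Prod.ext (Subtype.ext h1) (Subtype.ext h2)
  · have h1 : (1 : Matrix (Ext ι) (Ext ι) ℝ) ∈ ratOrthGroup S := ⟨one_mem_orthGroup, 1, by simp⟩
    simpa only [slash_one] using hF.bounded 1 h1 v hv

/-- Nonzero coefficients need `Q(μ) ≥ -Q(λ)`, and `L^⊥` is negative definite. -/
theorem IsFourierExpansion.finite_support (hS : S.IsSymm) (hΛ : IsLorentzian S)
    (hL : IsLorentzian (subGram S b)) (hp : 0 < quad (subGram S b) ℝ p)
    (hF : IsModularForm S (embed b p) k F) (hc : IsFourierExpansion S b b' (embed b p) F c)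
    (x : dualLattice (subGram S b)) : {y | c x y ≠ 0}.Finite :=
  (finite_dual_of_neg (subGram_isSymm b' hS) (fun _ hw => quad_subGram_orth_neg b b' hS hΛ hp hw)
    (-quad (subGram S b) ℝ (x : κ → ℝ))).subset fun y hy => by
      have := hc.quad_nonneg hS hΛ hL hp hF hy
      exact neg_le_iff_add_nonneg'.2 this

theorem IsFourierExpansion.hasSum_pullbackCoeff (hS : S.IsSymm) (hΛ : IsLorentzian S)
    (hL : IsLorentzian (subGram S b)) (hp : 0 < quad (subGram S b) ℝ p)
    (hF : IsModularForm S (embed b p) k F) (hc : IsFourierExpansion S b b' (embed b p) F c) (N : ℕ)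
    {z : κ → ℂ} (hz : z ∈ upperHalf (subGram S b) p) (v : Fin N → κ' → ℂ) :
    HasSum (fun x : dualLattice (subGram S b) =>
      pullbackCoeff S b b' k N c x v * expChar (subGram S b) x z)
      (pullbackOperator S b b' k N F z v) := by
  have h1 := hasSum_pullbackOperator b b' hS (hL.isUnit_det (subGram_isSymm b hS))
    (X := fun xy : dualLattice (subGram S b) × dualLattice (subGram S b') => (xy.1 : κ → ℝ))
    (Y := fun xy => (xy.2 : κ' → ℝ)) (hc.isExpSum hS hL) k N hz v
  -- The double series converges unconditionally, so it may be summed first over the finitely many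
  -- `μ` belonging to each `λ`.
  refine HasSum.prod_fiberwise h1 fun x => ?_
  rw [pullbackCoeff]
  refine HasSum.mul_right (expChar (subGram S b) x z) (Summable.hasSum ?_)
  refine summable_of_hasFiniteSupport ((hc.finite_support hS hΛ hL hp hF x).subset ?_)
  exact fun y hy => left_ne_zero_of_mul hy

theorem gegenbauerForm_zero {V : Type*} [AddCommGroup V] [Module ℂ V] (s : ℂ) {N : ℕ} (hN : 1 ≤ N)
    (v : Fin N → V) : gegenbauerForm s N (0 : V →ₗ[ℂ] ℂ) 0 v = 0 := by
  rw [gegenbauerForm, gegenbauerSum]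
  refine Finset.sum_eq_zero fun n hn => ?_
  rw [Finset.sum_eq_zero, mul_zero, mul_zero]
  intro e _
  have hn := (Finset.mem_filter.1 hn).2
  rcases Nat.eq_zero_or_pos n.2 with h2 | h2
  · rw [mul_eq_zero]
    exact Or.inr (Finset.prod_eq_zero (Finset.mem_univ ⟨0, by omega⟩) rfl)
  · rw [mul_eq_zero]
    exact Or.inl (Finset.prod_eq_zero (Finset.mem_univ ⟨0, h2⟩) rfl)

theorem IsModularForm.contDiffOn (hS : IsEven S) (hΛ : IsLorentzian S)
    (hL : IsLorentzian (subGram S b)) (hp : 0 < quad (subGram S b) ℝ p)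
    (hF : IsModularForm S (embed b p) k F) (b' : Basis κ' ℤ (orthLattice S L)) :
    ContDiffOn ℂ (⊤ : ℕ∞) F (upperHalf S (embed b p)) := by
  obtain ⟨c, hc⟩ := hF.exists_isFourierExpansion (b' := b') hS hΛ hL hp
  exact (hc.isExpSum hS.1 hL).contDiffOn (isOpen_posCone _)

/-- By covariance the slash of the pullback is the pullback of a slash of `F`. That function is
periodic for a multiple of the lattice and bounded, so its expansion controls the behaviour at every
cusp. -/
theorem IsModularForm.exists_isExpSum_slash_pullbackOperator (hS : IsEven S) (hΛ : IsLorentzian S)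
    (hL : IsLorentzian (subGram S b)) (hp : 0 < quad (subGram S b) ℝ p)
    (hF : IsModularForm S (embed b p) k F) {M : Matrix (Ext κ) (Ext κ) ℝ}
    (hM : M ∈ ratOrthGroup (subGram S b)) (N : ℕ) (v : Fin N → κ' → ℂ) :
    ∃ (X : (ι → ℤ) → κ → ℝ) (A : (ι → ℤ) → ℂ),
      IsExpSum (posCone (subGram S b) p) (fun n j => form (subGram S b) ℝ (X n) (Pi.single j 1)) A
        (slash (subGram S b) (k + N) (fun z => pullbackOperator S b b' k N F z v) M) ∧
      ∀ n, A n ≠ 0 → (∀ w ∈ posCone (subGram S b) p, 0 ≤ form (subGram S b) ℝ (X n) w) ∧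
        (1 ≤ N → 0 < quad (subGram S b) ℝ (X n)) := by
  have hM' := extend_mem_ratOrthGroup b hS.1 hL hM
  obtain ⟨h, hh, hper⟩ := exists_conj_trans_mem_modGroup hS hΛ hM'
  have hh' : (0 : ℝ) < h := by exact_mod_cast hh
  obtain ⟨X, Y, a, hX, hY, hXY, ha⟩ := exists_isExpSum_of_periodic b b' hS.1 hΛ hL hp
    (differentiableOn_slash hS.1 hΛ k hF.holomorphic hM'.1) hh' fun z hz n =>
      slash_add_of_conj_mem hS.1 hΛ hF hM'.1 (hper n) hz
  have hfr : ∀ n i, freq b b' ((h : ℝ)⁻¹ • X n) ((h : ℝ)⁻¹ • Y n) i = (h : ℝ)⁻¹ * n i :=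
    fun n i => by rw [freq_smul, Pi.smul_apply, hXY, smul_eq_mul]
  have hnn := fun n (hn : a n ≠ 0) => ha.quad_nonneg_of_bounded b b' hS.1 hp
    (fun n m hnm => by
      ext i
      have : freq b b' _ _ i = freq b b' _ _ i := congrFun hnm i
      rw [hfr, hfr] at this
      exact_mod_cast mul_left_cancel₀ (inv_ne_zero hh'.ne') this) hh'.ne'
    (fun n j => ⟨n j, by rw [hfr, mul_inv_cancel_left₀ hh'.ne']⟩) (hF.bounded _ hM') hn
  refine ⟨fun n => (h : ℝ)⁻¹ • X n, fun n => a n *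
    gegenbauerForm ((k : ℂ) - (Fintype.card κ : ℂ) / 2) N
      (form (subGram S b') ℂ (fun j => (((h : ℝ)⁻¹ • Y n) j : ℂ)))
      ((-((quad (subGram S b) ℝ ((h : ℝ)⁻¹ • X n) : ℝ) : ℂ) / 2) • form (subGram S b') ℂ) v,
    fun z hz => ?_, fun n hn => ?_⟩
  · rw [← pullbackOperator_slash b b' N hS.1 hΛ hL (hF.contDiffOn hS hΛ hL hp b') hM.1 hz]
    refine HasSum.congr_terms (hasSum_pullbackOperator b b' hS.1
      (hL.isUnit_det (subGram_isSymm b hS.1)) ha k N hz v) fun n => ?_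
    rw [expChar_eq_expo]
  · have ha0 := left_ne_zero_of_mul hn
    refine ⟨(hnn n ha0).2, fun hN => ?_⟩
    by_contra! hq
    refine right_ne_zero_of_mul hn ?_
    -- If `Q(X) ≤ 0` then `Q(Y) ≥ -Q(X) ≥ 0`, so `Y = 0` by definiteness. Then `Q(X) = 0` as well,
    -- and a Gegenbauer form of positive order with both entries zero vanishes.
    have hY0 : (h : ℝ)⁻¹ • Y n = 0 := by
      by_contra hne
      have := quad_subGram_orth_neg b b' hS.1 hΛ hp hne
      linarith [(hnn n ha0).1]
    have h0 := (hnn n ha0).1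
    rw [hY0, map_zero, add_zero] at h0
    rw [hY0, le_antisymm hq h0]
    convert gegenbauerForm_zero _ hN v using 2
    · convert map_zero (form (subGram S b') ℂ)
      simp
    · simp

/-- Invariance is known only on the upper half-space. Functions equal there have the same expansion,
hence the same pullback. -/
theorem pullbackOperator_congr (hS : S.IsSymm) (hd : (subGram S b).det ≠ 0) {I : Type*}
    {X : I → κ → ℝ} {Y : I → κ' → ℝ} {a : I → ℂ} {f g : (ι → ℂ) → ℂ}
    (h : IsExpSum (posCone S (embed b p)) (fun i => freq b b' (X i) (Y i)) a f)
    (hfg : ∀ u ∈ upperHalf S (embed b p), g u = f u) {N : ℕ} {z : κ → ℂ}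
    (hz : z ∈ upperHalf (subGram S b) p) (v : Fin N → κ' → ℂ) :
    pullbackOperator S b b' k N g z v = pullbackOperator S b b' k N f z v := by
  have h' : IsExpSum (posCone S (embed b p)) (fun i => freq b b' (X i) (Y i)) a g := fun u hu => by
    rw [hfg u hu]
    exact h u hu
  exact (hasSum_pullbackOperator b b' hS hd h' k N hz v).unique
    (hasSum_pullbackOperator b b' hS hd h k N hz v)

theorem IsModularForm.differentiableOn_pullbackOperator (hS : IsEven S) (hΛ : IsLorentzian S)
    (hL : IsLorentzian (subGram S b)) (hp : 0 < quad (subGram S b) ℝ p)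
    (hF : IsModularForm S (embed b p) k F) (b' : Basis κ' ℤ (orthLattice S L)) (N : ℕ)
    (v : Fin N → κ' → ℂ) :
    DifferentiableOn ℂ (fun z => pullbackOperator S b b' k N F z v)
      (upperHalf (subGram S b) p) := by
  have h1 : (1 : Matrix (Ext κ) (Ext κ) ℝ) ∈ ratOrthGroup (subGram S b) :=
    ⟨one_mem_orthGroup, 1, by simp⟩
  obtain ⟨X, A, hA, -⟩ :=
    hF.exists_isExpSum_slash_pullbackOperator (b' := b') hS hΛ hL hp h1 N v
  rw [show slash (subGram S b) (k + N) (fun z => pullbackOperator S b b' k N F z v) 1 =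
    fun z => pullbackOperator S b b' k N F z v from funext fun z => slash_one _ _ z] at hA
  exact (hA.contDiffOn (isOpen_posCone p)).differentiableOn (by simp)

theorem IsModularForm.slash_pullbackOperator (hS : IsEven S) (hΛ : IsLorentzian S)
    (hL : IsLorentzian (subGram S b)) (hp : 0 < quad (subGram S b) ℝ p)
    (hF : IsModularForm S (embed b p) k F) (b' : Basis κ' ℤ (orthLattice S L)) (N : ℕ)
    (v : Fin N → κ' → ℂ) {M : Matrix (Ext κ) (Ext κ) ℝ} (hM : M ∈ modGroup (subGram S b))
    {z : κ → ℂ} (hz : z ∈ upperHalf (subGram S b) p) :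
    slash (subGram S b) (k + N) (fun z => pullbackOperator S b b' k N F z v) M z =
      pullbackOperator S b b' k N F z v := by
  rw [← pullbackOperator_slash b b' N hS.1 hΛ hL (hF.contDiffOn hS hΛ hL hp b') hM.1 hz]
  obtain ⟨c, hc⟩ := hF.exists_isFourierExpansion (b' := b') hS hΛ hL hp
  refine pullbackOperator_congr hS.1 (hL.isUnit_det (subGram_isSymm b hS.1))
    (X := fun xy : dualLattice (subGram S b) × dualLattice (subGram S b') => (xy.1 : κ → ℝ))
    (Y := fun xy => (xy.2 : κ' → ℝ)) (hc.isExpSum hS.1 hL) (fun u hu => ?_) hz v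
  exact hF.invariant _ (extend_mem_modGroup b hS.1 hL hM) u hu

theorem IsModularForm.slash_pullbackOperator_bounded (hS : IsEven S) (hΛ : IsLorentzian S)
    (hL : IsLorentzian (subGram S b)) (hp : 0 < quad (subGram S b) ℝ p)
    (hF : IsModularForm S (embed b p) k F) (b' : Basis κ' ℤ (orthLattice S L)) (N : ℕ)
    (v : Fin N → κ' → ℂ) {M : Matrix (Ext κ) (Ext κ) ℝ} (hM : M ∈ ratOrthGroup (subGram S b))
    {w : κ → ℝ} (hw : w ∈ posCone (subGram S b) p) :
    ∃ C T : ℝ, ∀ t : ℝ, T ≤ t → ∀ x : κ → ℝ,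
      ‖slash (subGram S b) (k + N) (fun z => pullbackOperator S b b' k N F z v) M
        (fun i => (x i : ℂ) + Complex.I * t * w i)‖ ≤ C := by
  obtain ⟨X, A, hA, hA'⟩ :=
    hF.exists_isExpSum_slash_pullbackOperator (b' := b') hS hΛ hL hp hM N v
  obtain ⟨C, hC⟩ := hA.bounded (fun t ht => smul_mem_posCone (subGram_isSymm b hS.1) hw ht)
    fun n hn => by rw [sum_form_single]; exact (hA' n hn).1 w hw
  refine ⟨C, 1, fun t ht x => ?_⟩
  have he : cplx x (t • w) = fun i => (x i : ℂ) + Complex.I * t * w i := by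
    ext i; simp only [cplx, Pi.smul_apply, smul_eq_mul]; push_cast; ring
  rw [← he]
  exact hC t ht x

theorem IsModularForm.isModularForm_pullback (hS : IsEven S) (hΛ : IsLorentzian S)
    (hL : IsLorentzian (subGram S b)) (hp : 0 < quad (subGram S b) ℝ p)
    (hF : IsModularForm S (embed b p) k F) (b' : Basis κ' ℤ (orthLattice S L)) (N : ℕ)
    (v : Fin N → κ' → ℂ) :
    IsModularForm (subGram S b) p (k + N) fun z => pullbackOperator S b b' k N F z v where
  holomorphic := hF.differentiableOn_pullbackOperator hS hΛ hL hp b' N v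
  invariant _ hM _ hz := hF.slash_pullbackOperator hS hΛ hL hp b' N v hM hz
  bounded _ hM _ hw := hF.slash_pullbackOperator_bounded hS hΛ hL hp b' N v hM hw

theorem IsModularForm.isCuspForm_pullback (hS : IsEven S) (hΛ : IsLorentzian S)
    (hL : IsLorentzian (subGram S b)) (hp : 0 < quad (subGram S b) ℝ p)
    (hF : IsModularForm S (embed b p) k F) (b' : Basis κ' ℤ (orthLattice S L)) {N : ℕ} (hN : 1 ≤ N)
    (v : Fin N → κ' → ℂ) :
    IsCuspForm (subGram S b) p (k + N) fun z => pullbackOperator S b b' k N F z v where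
  toIsModularForm := hF.isModularForm_pullback hS hΛ hL hp b' N v
  vanishing M hM w hw hw0 z hz := by
    have hT := subGram_isSymm b hS.1
    obtain ⟨X, A, hA, hA'⟩ :=
      hF.exists_isExpSum_slash_pullbackOperator (b' := b') hS hΛ hL hp hM N v
    refine hA.tendsto_zero hz (fun t ht => ?_) fun n hn => ?_
    · have hcl : t • w ∈ closure (posCone (subGram S b) p) :=
        map_mem_closure (continuous_const_smul t) hw fun y hy => smul_mem_posCone hT hy ht
      have := add_mem_posCone_of_closure hT hL hz hcl
      have he : (fun i => (z i + Complex.I * t * w i).im) = (fun i => (z i).im) + t • w := by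
        ext i; simp
      change (fun i => (z i + Complex.I * t * w i).im) ∈ posCone (subGram S b) p
      rwa [he]
    · rw [sum_form_single]
      -- The pairing with the closed cone is nonnegative; a zero pairing would give norm at most
      -- zero, while surviving frequencies have positive norm for `N ≥ 1`.
      refine lt_of_le_of_ne (form_nonneg_of_mem_closure (hA' n hn).1 hw) fun h0 => ?_
      exact absurd (quad_nonpos_of_orthogonal_closure hT hL hw hw0 h0.symm)
        (not_le.2 ((hA' n hn).2 hN))

end Pullback
end HigherPullback

open HigherPullback
theorem theorem4p1 {ι κ κ' : Type*} [Fintype ι] [DecidableEq ι] [Fintype κ] [DecidableEq κ]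
    [Fintype κ'] [DecidableEq κ']
    (S : Matrix ι ι ℤ) (hS : IsEven S) (hΛ : IsLorentzian S)
    (L : Submodule ℤ (ι → ℤ)) (b : Basis κ ℤ L) (hL : IsLorentzian (subGram S b))
    (b' : Basis κ' ℤ (orthLattice S L))
    (p : κ → ℝ) (hp : 0 < quad (subGram S b) ℝ p)
    (k : ℤ) (F : (ι → ℂ) → ℂ) (hF : IsModularForm S (embed b p) k F) :
    (∃ c, IsFourierExpansion S b b' (embed b p) F c) ∧
    ∀ c, IsFourierExpansion S b b' (embed b p) F c →
      (∀ x, {y | c x y ≠ 0}.Finite) ∧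
      ∀ N : ℕ, ∃ P : (κ → ℂ) → MultilinearMap ℂ (fun _ : Fin N => κ' → ℂ) ℂ,
        (∀ z ∈ upperHalf (subGram S b) p, ∀ v : Fin N → κ' → ℂ,
          HasSum (fun x : dualLattice (subGram S b) =>
            pullbackCoeff S b b' k N c x v * expChar (subGram S b) x z) (P z v)) ∧
        (∀ z ∈ upperHalf (subGram S b) p, ∀ v : Fin N → κ' → ℂ,
          P z v = pullbackOperator S b b' k N F z v) ∧
        (∀ z ∈ upperHalf (subGram S b) p, ∀ (v : Fin N → κ' → ℂ) (σ : Equiv.Perm (Fin N)),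
          P z (fun i => v (σ i)) = P z v) ∧
        (∀ v : Fin N → κ' → ℂ,
          IsModularForm (subGram S b) p (k + N) (fun z => P z v)) ∧
        (1 ≤ N → ∀ v : Fin N → κ' → ℂ,
          IsCuspForm (subGram S b) p (k + N) (fun z => P z v)) := by
  refine ⟨hF.exists_isFourierExpansion hS hΛ hL hp, fun c hc =>
    ⟨hc.finite_support hS.1 hΛ hL hp hF, fun N => ⟨pullbackMap S b b' k N F,
      fun z hz v => hc.hasSum_pullbackCoeff hS.1 hΛ hL hp hF N hz v, fun _ _ _ => rfl,
      fun z _ v σ => pullbackOperator_symm S b b' k N F z v σ,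
      hF.isModularForm_pullback hS hΛ hL hp b' N,
      fun hN => hF.isCuspForm_pullback hS hΛ hL hp b' hN⟩⟩⟩
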